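/- Let $m\ge 3$, $n\ge 0$ and $2\le s\le m-1$ be integers. Let $(\overline M^{m+n},\overline g)$ be a smooth Riemannian or Lorentzian manifold with Levi-Civita connection $\overline\nabla$, and let $\Sigma^m$ be a (smoothly) immersed submanifold of $\overline M$, assumed to be spacelike (i.e. with Riemannian induced metric) if $\overline M$ is Lorentzian. Let $q\in\Sigma$, and let $T_q^\perp\Sigma\subset T_q\overline M$ be the normal space of $\Sigma$ at $q$. A point of a submanifold of a Riemannian or Lorentzian manifold is called *umbilic* if the second fundamental form of the submanifold at this point (the normal component of the ambient covariant derivative) equals the induced metric at this point times a normal vector. A submanifold $M$ of $\overline M$ with Riemannian or Lorentzian induced metric is called *totally geodesic at $q\in M$* if every geodesic $c$ of $M$ with $c(0)=q$ is a geodesic of $\overline M$ for all times in some neighbourhood of $0$. Let $\mathcal M$ be the family of all embedded $(s+n)$-dimensional submanifolds $M$ of $\overline M$ through $q$, with Riemannian or Lorentzian induced metric (automatic if $\overline M$ is Riemannian), that are totally geodesic at $q$ and satisfy $T_q^\perp\Sigma\subset T_qM$. For $M\in\mathcal M$ let $S_M:=M\cap\Sigma$, which near $q$ is an $s$-dimensional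 submanifold. (If $\Sigma$ is immersed by $x:\Sigma\to\overline M$, then $S_M$ means $x^{-1}(M)\subset\Sigma$ near $q$.) Then: 1. For every $M\in\mathcal M$, the point $q$ is umbilic in $S_M$ as a submanifold of $\overline M$ if and only if it is umbilic in $S_M$ as a submanifold of $M$. 2. If for every $M\in\mathcal M$ the point $q$ is umbilic in $S_M$ as a submanifold of $\overline M$ (equivalently, of $M$), then $q$ is umbilic in $\Sigma$. -/

import Mathlib

open Manifold Topology
open scoped ContDiff

noncomputable section

namespace UmbilicSections

/-! ### Metrics

A manifold of dimension `d` is modelled on `Vec d = ℝᵈ`. In Mathlib the tangent space of such a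
manifold at a point `x` is, by definition, the vector space `Vec d`, a tangent vector being identified
with its coordinates in the preferred chart `chartAt x`. -/

/-- The model space of `d`-dimensional manifolds. -/
abbrev Vec (d : ℕ) : Type := EuclideanSpace ℝ (Fin d)

/-- A field of bilinear forms on the tangent spaces of a `d`-dimensional manifold. -/
abbrev BilinField (d : ℕ) (N : Type*) [TopologicalSpace N] [ChartedSpace (Vec d) N] : Type _ :=
  (x : N) → (TangentSpace (𝓡 d) x →L[ℝ] TangentSpace (𝓡 d) x →L[ℝ] ℝ)

/-- The value of a field of bilinear forms at `x`, on the tangent space `T_x N = Vec d`. -/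
def BilinField.at {d : ℕ} {N : Type*} [TopologicalSpace N] [ChartedSpace (Vec d) N]
    (g : BilinField d N) (x : N) : Vec d →L[ℝ] Vec d →L[ℝ] ℝ := g x

section Metric

variable {d : ℕ} {N : Type*} [TopologicalSpace N] [ChartedSpace (Vec d) N]

/-- The field of bilinear forms is smooth, as a section of the bundle of bilinear forms. -/
def IsSmoothField [IsManifold (𝓡 d) ∞ N] (g : BilinField d N) : Prop :=
  ContMDiff (𝓡 d) ((𝓡 d).prod 𝓘(ℝ, Vec d →L[ℝ] Vec d →L[ℝ] ℝ)) ∞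
    (fun x ↦ Bundle.TotalSpace.mk' (Vec d →L[ℝ] Vec d →L[ℝ] ℝ)
      (E := fun x : N ↦ TangentSpace (𝓡 d) x →L[ℝ] TangentSpace (𝓡 d) x →L[ℝ] ℝ) x (g x))

/-- Symmetric and positive definite at every point. -/
def IsRiemannianField (g : BilinField d N) : Prop :=
  ∀ x, (∀ u v, g.at x u v = g.at x v u) ∧ ∀ u, u ≠ 0 → 0 < g.at x u u

/-- Symmetric and of signature `(-, +, …, +)` at every point: some vector is timelike, and the form
is positive definite on the orthogonal complement of that vector. -/
def IsLorentzianField (g : BilinField d N) : Prop :=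
  ∀ x, (∀ u v, g.at x u v = g.at x v u) ∧
    ∃ t, g.at x t t < 0 ∧ ∀ u, u ≠ 0 → g.at x t u = 0 → 0 < g.at x u u

end Metric

/-! ### The Levi-Civita connection and geodesics -/

section LeviCivita

variable {d : ℕ} {N : Type*} [TopologicalSpace N] [ChartedSpace (Vec d) N]

/-- The matrix `(g_ij)` of the metric in the preferred chart around `p`: at a point `y` of the
target of the chart, the form `(u, v) ↦ g(∂_u, ∂_v)` for the coordinate vector fields `∂_u`, `∂_v`. -/
def chartMetric (g : BilinField d N) (p : N) (y : Vec d) : Vec d →L[ℝ] Vec d →L[ℝ] ℝ :=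
  let A : Vec d →L[ℝ] Vec d := mfderiv 𝓘(ℝ, Vec d) (𝓡 d) (extChartAt (𝓡 d) p).symm y
  (g.at ((extChartAt (𝓡 d) p).symm y)).bilinearComp A A

/-- The Christoffel symbols of the first kind in the preferred chart around `p`, that is
`w ↦ ½ (∂_u g(v, w) + ∂_v g(u, w) - ∂_w g(u, v))`. -/
def christoffelFirst (g : BilinField d N) (p : N) (y u v : Vec d) : Vec d →L[ℝ] ℝ :=
  (1 / 2 : ℝ) • (fderiv ℝ (chartMetric g p) y u v + fderiv ℝ (chartMetric g p) y v u
    - ((fderiv ℝ (chartMetric g p) y).flip u).flip v)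

/-- The Christoffel symbols `Γ(u, v) = ∇_{∂_u} ∂_v` of the Levi-Civita connection of `g` in the
preferred chart around `p`: the vector with `g(Γ(u, v), w) = christoffelFirst g p y u v w`. -/
def christoffel (g : BilinField d N) (p : N) (y u v : Vec d) : Vec d :=
  (chartMetric g p y).inverse (christoffelFirst g p y u v)

/-- `c` is a geodesic of `g` on a neighbourhood of the time `t₀`: in the chart around `c t₀` it
satisfies the geodesic equation `x'' + Γ(x', x') = 0` at all times near `t₀`. -/
def IsGeodesicNear (g : BilinField d N) (c : ℝ → N) (t₀ : ℝ) : Prop :=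
  let x : ℝ → Vec d := fun t ↦ extChartAt (𝓡 d) (c t₀) (c t)
  ContinuousAt c t₀ ∧ ContDiffAt ℝ 2 x t₀ ∧
    ∀ᶠ t in 𝓝 t₀, deriv (deriv x) t + christoffel g (c t₀) (x t) (deriv x t) (deriv x t) = 0

end LeviCivita

/-! ### Immersed submanifolds -/

section Immersed

variable {d : ℕ} (k : ℕ) {N : Type*} [TopologicalSpace N] [ChartedSpace (Vec d) N]
  {P : Type*} [TopologicalSpace P] [ChartedSpace (Vec k) P]

/-- The differential of `f` at `q`, as a map from `T_q P = Vec k` to `T_{f q} N = Vec d`. -/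
def differential (d k : ℕ) {N : Type*} [TopologicalSpace N] [ChartedSpace (Vec d) N]
    {P : Type*} [TopologicalSpace P] [ChartedSpace (Vec k) P] (f : P → N) (q : P) :
    Vec k →L[ℝ] Vec d :=
  mfderiv (𝓡 k) (𝓡 d) f q

/-- The field of bilinear forms on `P` induced by `g`, i.e. the pull-back of `g` under `f`. -/
def inducedMetric (g : BilinField d N) (f : P → N) : BilinField k P :=
  fun q ↦ (g.at (f q)).bilinearComp (differential d k f q) (differential d k f q)

/-- The submanifold is spacelike: the induced metric is Riemannian. -/
def IsSpacelike (g : BilinField d N) (f : P → N) : Prop :=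
  IsRiemannianField (inducedMetric k g f)

/-- The submanifold is non-degenerate: the induced metric is either Riemannian or Lorentzian. -/
def IsNondegenerate (g : BilinField d N) (f : P → N) : Prop :=
  IsRiemannianField (inducedMetric k g f) ∨ IsLorentzianField (inducedMetric k g f)

/-- The tangent space of the submanifold at `q`, inside `T_{f q} N`. -/
def tangentAt (d k : ℕ) {N : Type*} [TopologicalSpace N] [ChartedSpace (Vec d) N]
    {P : Type*} [TopologicalSpace P] [ChartedSpace (Vec k) P] (f : P → N) (q : P) : Submodule ℝ (Vec d) :=
  LinearMap.range (differential d k f q : Vec k →ₗ[ℝ] Vec d)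

/-- The normal space of the submanifold at `q`: the vectors of `T_{f q} N` that are `g`-orthogonal
to the tangent space. -/
def normalAt (g : BilinField d N) (f : P → N) (q : P) : Submodule ℝ (Vec d) where
  carrier := {w | ∀ u ∈ tangentAt d k f q, g.at (f q) w u = 0}
  add_mem' {a b} ha hb u hu := by simp [ha u hu, hb u hu]
  zero_mem' u _ := by simp
  smul_mem' c a ha u hu := by simp [ha u hu]

open Classical in
/-- The normal component of `a ∈ T_{f q} N`: the normal vector `w` for which `a - w` is tangent to the
submanifold. It exists and is unique when the induced metric at `q` is nondegenerate. -/
def normalPart (g : BilinField d N) (f : P → N) (q : P) (a : Vec d) : Vec d :=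
  if h : ∃ w ∈ normalAt k g f q, a - w ∈ tangentAt d k f q then h.choose else 0

/-- The covariant derivative `∇_u (df V)` at `q` along the submanifold, for the Levi-Civita connection
`∇` of the ambient manifold, `V` being the extension of `v` to a vector field on the submanifold that
has constant coordinates in the chart around `q`. In coordinates it is `D²f(u, v) + Γ(Df u, Df v)`. -/
def ambientDeriv (g : BilinField d N) (f : P → N) (q : P) (u v : Vec k) : Vec d :=
  let F : Vec k → Vec d := writtenInExtChartAt (𝓡 k) (𝓡 d) q f
  let y : Vec k := extChartAt (𝓡 k) q q
  fderiv ℝ (fderiv ℝ F) y u v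
    + christoffel g (f q) (extChartAt (𝓡 d) (f q) (f q)) (fderiv ℝ F y u) (fderiv ℝ F y v)

/-- The second fundamental form at `q`: by the Gauss formula, the normal component of `∇_u V`. -/
def secondFundamentalForm (g : BilinField d N) (f : P → N) (q : P) (u v : Vec k) : Vec d :=
  normalPart k g f q (ambientDeriv k g f q u v)

/-- `q` is umbilic: the second fundamental form at `q` is the induced metric at `q` times a normal
vector (which then is the mean curvature vector). -/
def IsUmbilicAt (g : BilinField d N) (f : P → N) (q : P) : Prop :=
  ∃ H ∈ normalAt k g f q, ∀ u v : Vec k,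
    secondFundamentalForm k g f q u v = (inducedMetric k g f).at q u v • H

/-- The submanifold is totally geodesic at `p`: every geodesic of the submanifold (for the induced
metric) that starts at `p` is carried to a geodesic of the ambient manifold, for all times in a
neighbourhood of `0`. -/
def IsTotallyGeodesicAt (g : BilinField d N) (f : P → N) (p : P) : Prop :=
  ∀ c : ℝ → P, c 0 = p → IsGeodesicNear (inducedMetric k g f) c 0 → IsGeodesicNear g (f ∘ c) 0

end Immersed

/-! ### Normal sections -/

section Sections

variable {d : ℕ} (k l s : ℕ) {N : Type*} [TopologicalSpace N] [ChartedSpace (Vec d) N]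
  {P : Type*} [TopologicalSpace P] [ChartedSpace (Vec k) P]
  {M : Type*} [TopologicalSpace M] [ChartedSpace (Vec l) M]
  {S : Type*} [TopologicalSpace S] [ChartedSpace (Vec s) S]

/-- `i : M → N` is an (embedded, non-degenerate) submanifold of `N` through the point `f q = i p`,
totally geodesic there, whose tangent space at that point contains the normal space of `f` at `q`. -/
structure IsNormalSubmanifoldAt (g : BilinField d N) (f : P → N) (q : P) (i : M → N) (p : M) :
    Prop where
  isSmoothEmbedding : IsSmoothEmbedding (𝓡 l) (𝓡 d) ∞ i
  isNondegenerate : IsNondegenerate l g i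
  map_eq : i p = f q
  isTotallyGeodesicAt : IsTotallyGeodesicAt l g i p
  normal_le_tangent : normalAt k g f q ≤ tangentAt d l i p

/-- `S`, with its inclusions `j` into `P` and `j'` into `M`, is an open piece around `q` of the
intersection of the submanifolds `f : P → N` and `i : M → N`. As a subset of `P` this intersection
is `f ⁻¹' range i`, and `j` is a smooth embedding onto a neighbourhood of `q = j r` in it. -/
structure IsIntersectionNear (f : P → N) (q : P) (i : M → N) (j : S → P) (j' : S → M) (r : S) :
    Prop where
  isSmoothEmbedding : IsSmoothEmbedding (𝓡 s) (𝓡 k) ∞ j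
  contMDiff : ContMDiff (𝓡 s) (𝓡 l) ∞ j'
  comp_eq : f ∘ j = i ∘ j'
  map_eq : j r = q
  range_mem : Set.range j ∈ 𝓝[f ⁻¹' Set.range i] q

end Sections

end UmbilicSections

end

/-! Part 1. Geodesics of `M` leave `q` in every direction. If they are all geodesics of the ambient
manifold, the second fundamental form of `M` at `q` vanishes on the diagonal, and, being symmetric
and bilinear, it vanishes (`fderiv_fderiv_add_coordChristoffel`,
`ambientDeriv_of_isTotallyGeodesicAt`). Hence for a submanifold `S` of `M` the ambient covariant
derivatives at `q` are the images under the injective differential of `M` of those computed in `M`.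
Taking normal parts commutes with this differential, so the two second fundamental forms correspond.
So do the mean curvature vectors, because an ambient one equals the value of the second fundamental
form at `(u, u)` divided by the squared length of some `u ≠ 0` (`isUmbilicAt_comp_iff`).

Part 2. Let `II` be the second fundamental form of `Σ`. If `q` is umbilic in `S_M`, pairing with
vectors `ξ` normal to `Σ` gives a vector `H'` with `⟨II(u, v), ξ⟩ = ⟨u, v⟩ ⟨H', ξ⟩` for all `u, v`
tangent to `S_M` (`IsUmbilicAt.exists_apply_ambientDeriv`). Since `s ≥ 2`, any two tangent vectors
of `Σ` lie in an `s`-dimensional subspace `W` of `T_q Σ`. A small piece of the image under the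
exponential map of `W ⊕ T_q^⊥ Σ` is a member of the family: radial geodesics make it totally
geodesic at `q`, and in the Lorentzian case the normal space contains a timelike vector, so the sum
is nondegenerate. It meets `Σ` in a submanifold with tangent space `W`
(`exists_isNormalSubmanifoldAt`). The rest is algebra (`isUmbilicAt_of_forall_pair`). Fix `v₀ ≠ 0`
and let `H` be `II(v₀, v₀)` divided by the squared length of `v₀`. The pair `u, v₀` gives `II(u, u)
= ⟨u, u⟩ H`, and then the pair `u, v` gives `II(u, v) = ⟨u, v⟩ H`.

Most of the work is the exponential map. Integral curves of a vector field are obtained by inverting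
a smooth perturbation of the identity on the Banach space of curves on `[-1, 1]`, which gives smooth
dependence on the initial value (`exists_contDiff_flow`). Applied to the geodesic equation, and with
the inverse function theorem, this yields normal coordinates (`exists_exponential`,
`exists_isNormalChart`). -/

noncomputable section
namespace UmbilicSections

/-! ### Smooth dependence of solutions of ordinary differential equations on the initial value -/

/-! ### Smoothness of superposition operators on spaces of continuous curves. -/

section Nemytskii

variable {K : Type*} [TopologicalSpace K] [CompactSpace K]
  {E F : Type*} [NormedAddCommGroup E] [NormedSpace ℝ E] [NormedAddCommGroup F] [NormedSpace ℝ F]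

/-- Pointwise application of a family of continuous linear maps to a family of vectors. -/
def pointwiseApply (K E F : Type*) [TopologicalSpace K] [CompactSpace K]
    [NormedAddCommGroup E] [NormedSpace ℝ E] [NormedAddCommGroup F] [NormedSpace ℝ F] :
    C(K, E →L[ℝ] F) →L[ℝ] C(K, E) →L[ℝ] C(K, F) :=
  LinearMap.mkContinuous₂
    (LinearMap.mk₂ ℝ (fun (A : C(K, E →L[ℝ] F)) (γ : C(K, E)) ↦ (⟨fun t ↦ A t (γ t), A.continuous.clm_apply γ.continuous⟩ : C(K, F)))
      (fun _ _ _ ↦ by ext; simp) (fun _ _ _ ↦ by ext; simp) (fun _ _ _ ↦ by ext; simp)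
      (fun _ _ _ ↦ by ext; simp)) 1 (fun A γ ↦ by
    rw [one_mul, ContinuousMap.norm_le _ (by positivity)]
    exact fun t ↦ ((A t).le_opNorm _).trans
      (mul_le_mul (A.norm_coe_le_norm t) (γ.norm_coe_le_norm t) (by positivity) (by positivity)))

@[simp] theorem pointwiseApply_apply (A : C(K, E →L[ℝ] F)) (γ : C(K, E)) (t : K) :
    pointwiseApply K E F A γ t = A t (γ t) := rfl

/-- The range of `γ` is compact, so `f'` varies by at most `c` on balls of one common radius around
its points. The mean value inequality on these balls bounds the remainder uniformly in `t`. -/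
theorem hasFDerivAt_comp_left {f : E → F} {f' : E → E →L[ℝ] F} (hf : ∀ x, HasFDerivAt f (f' x) x)
    (hf' : Continuous f') (γ : C(K, E)) :
    HasFDerivAt (fun γ : C(K, E) ↦
        (⟨fun t ↦ f (γ t), (continuous_iff_continuousAt.2 fun x ↦ (hf x).continuousAt).comp
          γ.continuous⟩ : C(K, F)))
      (pointwiseApply K E F ⟨fun t ↦ f' (γ t), hf'.comp γ.continuous⟩) γ := by
  rw [hasFDerivAt_iff_isLittleO_nhds_zero, Asymptotics.isLittleO_iff]
  intro c hc
  have hunif := (isCompact_range γ.continuous).uniformContinuousAt_of_continuousAt f'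
    (fun a _ ↦ hf'.continuousAt) (Metric.dist_mem_uniformity hc)
  obtain ⟨δ, hδ, h⟩ := Metric.mem_uniformity_dist.1 hunif
  filter_upwards [Metric.ball_mem_nhds (0 : C(K, E)) hδ] with η hη
  rw [ContinuousMap.norm_le _ (by positivity)]
  intro t
  have hηt : ‖η t‖ < δ := (η.norm_coe_le_norm t).trans_lt (by simpa using hη)
  have key := (convex_ball (γ t) δ).norm_image_sub_le_of_norm_hasFDerivWithin_le' (f := f)
    (f' := f') (φ := f' (γ t)) (C := c) (x := γ t) (y := γ t + η t)
    (fun x _ ↦ (hf x).hasFDerivWithinAt) (fun x hx ↦ by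
      have := h (a := γ t) (b := x) (by rw [dist_comm]; exact hx) (Set.mem_range_self t)
      rw [← dist_eq_norm, dist_comm]
      exact this.le) (Metric.mem_ball_self hδ) (by simpa using hηt)
  simp only [add_sub_cancel_left] at key
  refine le_trans (le_of_eq ?_) (key.trans ?_)
  · simp
  · exact mul_le_mul_of_nonneg_left (η.norm_coe_le_norm t) hc.le

/-- Induction on the order: the derivative is `pointwiseApply` after the superposition operator of
`fderiv ℝ f`. The target changes from `F` to `E →L[ℝ] F`, so `F` is quantified inside the induction
and shares the universe of `E`. -/
theorem contDiff_comp_left_nat.{u, v} {K : Type u} [TopologicalSpace K] [CompactSpace K]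
    {E : Type v} [NormedAddCommGroup E] [NormedSpace ℝ E] (n : ℕ) : ∀ {F : Type v} [NormedAddCommGroup F] [NormedSpace ℝ F]
    {f : E → F} (hf : ContDiff ℝ n f), ContDiff ℝ n (fun γ : C(K, E) ↦
      (⟨fun t ↦ f (γ t), hf.continuous.comp γ.continuous⟩ : C(K, F))) := by
  induction n with
  | zero =>
    intro F _ _ f hf
    simp only [Nat.cast_zero, contDiff_zero] at hf ⊢
    exact ContinuousMap.continuous_postcomp ⟨f, hf⟩
  | succ n ih =>
    intro F _ _ f hf
    have hd : ContDiff ℝ n (fderiv ℝ f) := hf.fderiv_right (by norm_cast)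
    push_cast
    rw [contDiff_succ_iff_hasFDerivAt]
    refine ⟨_, ?_, fun γ ↦ hasFDerivAt_comp_left (f' := fderiv ℝ f) (fun x ↦
      (hf.differentiable (by norm_cast)).differentiableAt.hasFDerivAt) hd.continuous γ⟩
    exact (pointwiseApply K E F).contDiff.comp (ih hd)

theorem contDiff_comp_left.{u, v} {K : Type u} [TopologicalSpace K] [CompactSpace K]
    {E F : Type v} [NormedAddCommGroup E] [NormedSpace ℝ E] [NormedAddCommGroup F] [NormedSpace ℝ F]
    {f : E → F} (hf : ContDiff ℝ ∞ f) :
    ContDiff ℝ ∞ (fun γ : C(K, E) ↦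
      (⟨fun t ↦ f (γ t), hf.continuous.comp γ.continuous⟩ : C(K, F))) :=
  contDiff_infty.2 fun n ↦ contDiff_comp_left_nat n (hf.of_le (by exact_mod_cast le_top))

end Nemytskii

/-! ### Flows of Lipschitz vector fields. -/

section Flow

variable {E : Type*} [NormedAddCommGroup E] [NormedSpace ℝ E]

/-- The operator `γ ↦ (t ↦ ∫₀ᵗ γ)` on curves defined on `[-1, 1]`. -/
def primitiveCLM (E : Type*) [NormedAddCommGroup E] [NormedSpace ℝ E] :
    C(Set.Icc (-1 : ℝ) 1, E) →L[ℝ] C(Set.Icc (-1 : ℝ) 1, E) :=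
  LinearMap.mkContinuous
    { toFun := fun γ ↦ ⟨fun t ↦ ∫ τ in (0 : ℝ)..t, Set.IccExtend (by norm_num) γ τ,
        (intervalIntegral.continuous_primitive (fun a b ↦
          (γ.continuous.Icc_extend' (h := by norm_num)).intervalIntegrable a b) 0).comp
          continuous_subtype_val⟩
      map_add' := fun γ η ↦ by
        ext t
        exact intervalIntegral.integral_add
          ((γ.continuous.Icc_extend' (h := by norm_num)).intervalIntegrable _ _)
          ((η.continuous.Icc_extend' (h := by norm_num)).intervalIntegrable _ _)
      map_smul' := fun r γ ↦ by
        ext t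
        exact intervalIntegral.integral_smul r _ } 1 (fun γ ↦ by
    rw [one_mul, ContinuousMap.norm_le _ (by positivity)]
    intro t
    refine (intervalIntegral.norm_integral_le_of_norm_le_const (C := ‖γ‖)
      (fun τ _ ↦ γ.norm_coe_le_norm _)).trans ?_
    rw [sub_zero]
    exact mul_le_of_le_one_right (norm_nonneg _) (abs_le.2 t.2))

theorem primitiveCLM_apply (γ : C(Set.Icc (-1 : ℝ) 1, E)) (t : Set.Icc (-1 : ℝ) 1) :
    primitiveCLM E γ t = ∫ τ in (0 : ℝ)..t, Set.IccExtend (by norm_num) γ τ := rfl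

theorem norm_primitiveCLM_le : ‖primitiveCLM E‖ ≤ 1 :=
  LinearMap.mkContinuous_norm_le _ zero_le_one _

/-- A smooth Lipschitz vector field has, after multiplication by a small constant, a flow that is
defined for all times in `[-1, 1]` and depends smoothly on the initial value. -/
theorem exists_contDiff_flow [CompleteSpace E] {X : E → E} (hX : ContDiff ℝ ∞ X) {K : NNReal}
    (hK : LipschitzWith K X) :
    ∃ ε : ℝ, 0 < ε ∧ ∃ σ : E → ℝ → E, (∀ a, σ a 0 = a) ∧
      (∀ a, ∀ t ∈ Set.Icc (-1 : ℝ) 1, HasDerivAt (σ a) (ε • X (σ a t)) t) ∧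
      (∀ t ∈ Set.Icc (-1 : ℝ) 1, ContDiff ℝ ∞ (fun a ↦ σ a t)) ∧
      ∀ a₀, X a₀ = 0 → ∀ δ > 0, ∀ᶠ a in 𝓝 a₀, ∀ t ∈ Set.Icc (-1 : ℝ) 1, dist (σ a t) a₀ < δ := by
  set I := Set.Icc (-1 : ℝ) 1 with hI
  -- Integration from `0` has norm at most `1` on `[-1, 1]`, so `ε * K < 1` makes the Picard
  -- operator a contraction.
  obtain ⟨ε, hε, hεK⟩ : ∃ ε : ℝ, 0 < ε ∧ ε * K < 1 := by
    refine ⟨1 / (K + 1), by positivity, ?_⟩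
    rw [div_mul_eq_mul_div, one_mul, div_lt_one (by positivity)]
    linarith
  let N : C(I, E) → C(I, E) := fun γ ↦ ⟨fun t ↦ X (γ t), hX.continuous.comp γ.continuous⟩
  have hN : ContDiff ℝ ∞ N := contDiff_comp_left hX
  have hNK : ∀ γ η, ‖N γ - N η‖ ≤ K * ‖γ - η‖ := fun γ η ↦ by
    rw [ContinuousMap.norm_le _ (by positivity)]
    intro t
    refine le_trans (le_of_eq ?_) ((hK.norm_sub_le (γ t) (η t)).trans ?_)
    · simp [N]
    · exact mul_le_mul_of_nonneg_left ((γ - η).norm_coe_le_norm t) K.2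
  have hJ : ∀ γ, ‖primitiveCLM E γ‖ ≤ ‖γ‖ := fun γ ↦ by
    simpa using (primitiveCLM E).le_of_opNorm_le norm_primitiveCLM_le γ
  -- The integral curve of `ε • X` starting at `a` is the solution of `Ψ γ = const a`. Since `Ψ`
  -- differs from the identity by a contraction, it is a homeomorphism.
  let Ψ : C(I, E) → C(I, E) := fun γ ↦ γ - ε • primitiveCLM E (N γ)
  have hΨ : ContDiff ℝ ∞ Ψ :=
    contDiff_id.sub (((primitiveCLM E).contDiff.comp hN).const_smul ε)
  let c : NNReal := ⟨ε * K, by positivity⟩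
  have happ : ApproximatesLinearOn Ψ
      ((ContinuousLinearEquiv.refl ℝ C(I, E) : C(I, E) ≃L[ℝ] C(I, E)) :
        C(I, E) →L[ℝ] C(I, E)) Set.univ c := by
    intro γ _ η _
    have : Ψ γ - Ψ η - (γ - η) = -(ε • primitiveCLM E (N γ - N η)) := by
      simp only [Ψ, map_sub, smul_sub]; abel
    calc ‖Ψ γ - Ψ η - (γ - η)‖ = ε * ‖primitiveCLM E (N γ - N η)‖ := by
          rw [this, norm_neg, norm_smul, Real.norm_of_nonneg hε.le]
      _ ≤ ε * (K * ‖γ - η‖) := mul_le_mul_of_nonneg_left ((hJ _).trans (hNK _ _)) hε.le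
      _ = c * ‖γ - η‖ := (mul_assoc _ _ _).symm
  have hc : Subsingleton C(I, E) ∨ c < ‖((ContinuousLinearEquiv.refl ℝ C(I, E)).symm :
        C(I, E) →L[ℝ] C(I, E))‖₊⁻¹ := by
    rcases subsingleton_or_nontrivial C(I, E) with h | h
    · exact Or.inl h
    · right
      have : ‖((ContinuousLinearEquiv.refl ℝ C(I, E)).symm : C(I, E) →L[ℝ] C(I, E))‖₊ = 1 :=
        ContinuousLinearMap.nnnorm_id
      rw [this, inv_one]
      exact hεK
  let Φ := happ.toHomeomorph Ψ hc
  have hΦ : ∀ γ, Φ γ = Ψ γ := fun γ ↦ rfl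
  -- The derivative is `1 - T` with `‖T‖ ≤ ε * K < 1`, which the Neumann series inverts; so the
  -- inverse of `Φ` is smooth.
  have hderiv : ∀ γ, ∃ A : C(I, E) ≃L[ℝ] C(I, E), HasFDerivAt Φ (A : C(I, E) →L[ℝ] C(I, E)) γ := by
    intro γ
    let T : C(I, E) →L[ℝ] C(I, E) := ε • (primitiveCLM E).comp (fderiv ℝ N γ)
    have hT : ‖T‖ < 1 := by
      have h1 : ‖fderiv ℝ N γ‖ ≤ K :=
        norm_fderiv_le_of_lipschitz ℝ (LipschitzWith.of_dist_le_mul fun a b ↦ by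
          rw [dist_eq_norm, dist_eq_norm]; exact hNK a b)
      have h2 : ‖(primitiveCLM E).comp (fderiv ℝ N γ)‖ ≤ K :=
        (ContinuousLinearMap.opNorm_comp_le _ _).trans
          ((mul_le_mul norm_primitiveCLM_le h1 (by positivity) zero_le_one).trans (by simp))
      calc ‖T‖ ≤ ‖ε‖ * ‖(primitiveCLM E).comp (fderiv ℝ N γ)‖ :=
            ContinuousLinearMap.opNorm_smul_le _ _
        _ = ε * ‖(primitiveCLM E).comp (fderiv ℝ N γ)‖ := by rw [Real.norm_of_nonneg hε.le]
        _ ≤ ε * K := mul_le_mul_of_nonneg_left h2 hε.le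
        _ < 1 := hεK
    refine ⟨ContinuousLinearEquiv.ofUnit (Units.oneSub T hT), ?_⟩
    have hNd : HasFDerivAt N (fderiv ℝ N γ) γ :=
      (hN.differentiable (by simp)).differentiableAt.hasFDerivAt
    have := (hasFDerivAt_id γ).sub ((((primitiveCLM E).hasFDerivAt).comp γ hNd).const_smul ε)
    exact this
  choose A hA using hderiv
  have hsymm : ContDiff ℝ ∞ Φ.symm := Homeomorph.contDiff_symm Φ hA hΨ
  let s : E → C(I, E) := fun a ↦ Φ.symm (ContinuousMap.const I a)
  have hconst : ContDiff ℝ ∞ (fun a : E ↦ ContinuousMap.const I a) :=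
    (ContinuousLinearMap.const ℝ I : E →L[ℝ] C(I, E)).contDiff
  have hs : ContDiff ℝ ∞ s := hsymm.comp hconst
  have hle : (-1 : ℝ) ≤ 1 := by norm_num
  have hext : ∀ a, Continuous fun τ ↦ X (Set.IccExtend hle (s a) τ) := fun a ↦
    hX.continuous.comp (s a).continuous.Icc_extend'
  -- Extending the curve by constants outside `[-1, 1]` gives two-sided derivatives at the endpoints
  -- as well.
  let σ : E → ℝ → E := fun a t ↦ a + ε • ∫ τ in (0 : ℝ)..t, X (Set.IccExtend hle (s a) τ)
  have hσs : ∀ a (t : I), σ a t = s a t := by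
    intro a t
    have h1 : Ψ (s a) = ContinuousMap.const I a := Φ.apply_symm_apply _
    have h2 : s a t - ε • primitiveCLM E (N (s a)) t = a := congrArg (fun γ : C(I, E) ↦ γ t) h1
    rw [primitiveCLM_apply] at h2
    rw [sub_eq_iff_eq_add] at h2
    rw [h2]
    rfl
  refine ⟨ε, hε, σ, fun a ↦ by simp [σ], fun a t ht ↦ ?_, fun t ht ↦ ?_, fun a₀ ha₀ δ hδ ↦ ?_⟩
  · have h1 : HasDerivAt (σ a) (ε • X (Set.IccExtend hle (s a) t)) t :=
      ((intervalIntegral.integral_hasDerivAt_right ((hext a).intervalIntegrable _ _)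
        ((hext a).stronglyMeasurableAtFilter _ _) (hext a).continuousAt).const_smul ε).const_add a
    rwa [Set.IccExtend_of_mem hle _ ht, ← hσs] at h1
  · have : (fun a ↦ σ a t) = fun a ↦ ContinuousMap.evalCLM ℝ (⟨t, ht⟩ : I) (s a) :=
      funext fun a ↦ hσs a ⟨t, ht⟩
    rw [this]
    exact (ContinuousLinearMap.contDiff _).comp hs
  -- At a zero of `X` the solution is constant, and continuity of `s` in the supremum norm keeps
  -- nearby solutions close for all times at once.
  · have hs0 : s a₀ = ContinuousMap.const I a₀ := by
      refine (Homeomorph.symm_apply_eq Φ).2 ?_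
      rw [hΦ]
      have : N (ContinuousMap.const I a₀) = 0 := by ext t; exact ha₀
      simp [Ψ, this]
    filter_upwards [hs.continuous.continuousAt.eventually (Metric.ball_mem_nhds (s a₀) hδ)]
      with a ha t ht
    have := (ContinuousMap.dist_apply_le_dist (f := s a) (g := s a₀) ⟨t, ht⟩).trans_lt ha
    rw [hs0, ← hσs] at this
    exact this

end Flow
/-! ### Christoffel symbols and geodesics in coordinates -/

section Coordinates

variable {E : Type*} [NormedAddCommGroup E] [NormedSpace ℝ E]
  {E' : Type*} [NormedAddCommGroup E'] [NormedSpace ℝ E']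

/-- The Christoffel symbols of the first kind of the metric with coefficients `G`. -/
def lowerChristoffel (G : E → E →L[ℝ] E →L[ℝ] ℝ) (y u v : E) : E →L[ℝ] ℝ :=
  (1 / 2 : ℝ) • (fderiv ℝ G y u v + fderiv ℝ G y v u - ((fderiv ℝ G y).flip u).flip v)

/-- The Christoffel symbols of the metric with coefficients `G`. -/
def coordChristoffel (G : E → E →L[ℝ] E →L[ℝ] ℝ) (y u v : E) : E :=
  (G y).inverse (lowerChristoffel G y u v)

/-- The curve `x` satisfies the geodesic equation for the Christoffel symbols `Γ` near time `0`. -/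
def IsCoordGeodesic (Γ : E → E → E → E) (x : ℝ → E) : Prop :=
  ContDiffAt ℝ 2 x 0 ∧ ∀ᶠ t in 𝓝 0, deriv (deriv x) t + Γ (x t) (deriv x t) (deriv x t) = 0

theorem lowerChristoffel_apply (G : E → E →L[ℝ] E →L[ℝ] ℝ) (y u v w : E) :
    lowerChristoffel G y u v w = (1 / 2 : ℝ) *
      (fderiv ℝ G y u v w + fderiv ℝ G y v u w - fderiv ℝ G y w u v) := rfl

theorem coordChristoffel_add_left (G : E → E →L[ℝ] E →L[ℝ] ℝ) (y u u' v : E) :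
    coordChristoffel G y (u + u') v = coordChristoffel G y u v + coordChristoffel G y u' v := by
  rw [coordChristoffel, coordChristoffel, coordChristoffel, ← map_add]
  congr 1
  ext w
  simp only [lowerChristoffel_apply, map_add, add_apply]
  ring

theorem coordChristoffel_add_right (G : E → E →L[ℝ] E →L[ℝ] ℝ) (y u v v' : E) :
    coordChristoffel G y u (v + v') = coordChristoffel G y u v + coordChristoffel G y u v' := by
  rw [coordChristoffel, coordChristoffel, coordChristoffel, ← map_add]
  congr 1
  ext w
  simp only [lowerChristoffel_apply, map_add, add_apply]
  ring

theorem coordChristoffel_smul_smul (G : E → E →L[ℝ] E →L[ℝ] ℝ) (y u v : E) (a b : ℝ) :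
    coordChristoffel G y (a • u) (b • v) = (a * b) • coordChristoffel G y u v := by
  rw [coordChristoffel, coordChristoffel, ← map_smul]
  congr 1
  ext w
  simp only [lowerChristoffel_apply, map_smul, smul_apply, smul_eq_mul]
  ring

theorem coordChristoffel_zero (G : E → E →L[ℝ] E →L[ℝ] ℝ) (y : E) :
    coordChristoffel G y 0 0 = 0 := by
  simpa using coordChristoffel_smul_smul G y 0 0 0 0

theorem fderiv_bilin_apply {G : E' → E →L[ℝ] E →L[ℝ] ℝ} {y : E'} (hG : DifferentiableAt ℝ G y)
    (u : E') (v w : E) : fderiv ℝ (fun z ↦ G z v w) y u = fderiv ℝ G y u v w := by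
  have := (hG.hasFDerivAt.clm_apply (hasFDerivAt_const v y)).clm_apply (hasFDerivAt_const w y)
  rw [this.fderiv]
  simp

/-- Symmetry of `G` is needed near `y` and not only at `y`, because it is differentiated. -/
theorem coordChristoffel_comm {G : E → E →L[ℝ] E →L[ℝ] ℝ} {y : E} (hG : DifferentiableAt ℝ G y)
    (hsymm : ∀ᶠ z in 𝓝 y, ∀ u v, G z u v = G z v u) (u v : E) :
    coordChristoffel G y u v = coordChristoffel G y v u := by
  rw [coordChristoffel, coordChristoffel]
  congr 1
  ext w
  have : fderiv ℝ G y w u v = fderiv ℝ G y w v u := by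
    rw [← fderiv_bilin_apply hG, ← fderiv_bilin_apply hG]
    congr 1
    exact Filter.EventuallyEq.fderiv_eq (hsymm.mono fun z hz ↦ hz u v)
  rw [lowerChristoffel_apply, lowerChristoffel_apply, this]
  ring

set_option maxSynthPendingDepth 5 in
theorem contDiffAt_flip {V F₁ F₂ F₃ : Type*} [NormedAddCommGroup V] [NormedSpace ℝ V]
    [NormedAddCommGroup F₁] [NormedSpace ℝ F₁] [NormedAddCommGroup F₂] [NormedSpace ℝ F₂]
    [NormedAddCommGroup F₃] [NormedSpace ℝ F₃] {n : WithTop ℕ∞} {f : V → F₁ →L[ℝ] F₂ →L[ℝ] F₃}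
    {y : V} (hf : ContDiffAt ℝ n f y) : ContDiffAt ℝ n (fun p ↦ (f p).flip) y :=
  let T : (F₁ →L[ℝ] F₂ →L[ℝ] F₃) →L[ℝ] (F₂ →L[ℝ] F₁ →L[ℝ] F₃) :=
    (ContinuousLinearMap.flipₗᵢ ℝ F₁ F₂ F₃).toContinuousLinearEquiv
  ContDiffAt.comp (f := f) (g := T) y (T.contDiff (n := n)).contDiffAt hf

set_option maxSynthPendingDepth 5 in
theorem differentiableAt_flip {V F₁ F₂ F₃ : Type*} [NormedAddCommGroup V] [NormedSpace ℝ V]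
    [NormedAddCommGroup F₁] [NormedSpace ℝ F₁] [NormedAddCommGroup F₂] [NormedSpace ℝ F₂]
    [NormedAddCommGroup F₃] [NormedSpace ℝ F₃] {f : V → F₁ →L[ℝ] F₂ →L[ℝ] F₃}
    {y : V} (hf : DifferentiableAt ℝ f y) : DifferentiableAt ℝ (fun p ↦ (f p).flip) y :=
  let T : (F₁ →L[ℝ] F₂ →L[ℝ] F₃) →L[ℝ] (F₂ →L[ℝ] F₁ →L[ℝ] F₃) :=
    (ContinuousLinearMap.flipₗᵢ ℝ F₁ F₂ F₃).toContinuousLinearEquiv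
  DifferentiableAt.comp (f := f) (g := T) y T.differentiableAt hf

/-- A nondegenerate bilinear form on a finite-dimensional space is an isomorphism onto the dual. -/
theorem isInvertible_of_nondegenerate [FiniteDimensional ℝ E] {B : E →L[ℝ] E →L[ℝ] ℝ}
    (hB : ∀ u, (∀ v, B u v = 0) → u = 0) : B.IsInvertible := by
  have hinj : Function.Injective (B : E →ₗ[ℝ] E →L[ℝ] ℝ) := by
    rw [injective_iff_map_eq_zero]
    exact fun u hu ↦ hB u fun v ↦ by simpa using congrArg (fun φ : E →L[ℝ] ℝ ↦ φ v) hu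
  have hdim : Module.finrank ℝ E = Module.finrank ℝ (E →L[ℝ] ℝ) := by
    rw [← (LinearMap.toContinuousLinearMap (𝕜 := ℝ) (E := E) (F' := ℝ)).finrank_eq]
    exact (Subspace.dual_finrank_eq (K := ℝ) (V := E)).symm
  exact ⟨(LinearEquiv.ofInjectiveOfFinrankEq _ hinj hdim).toContinuousLinearEquiv, by ext; rfl⟩

theorem apply_coordChristoffel {G : E → E →L[ℝ] E →L[ℝ] ℝ} {y : E} (h : (G y).IsInvertible)
    (u v : E) : G y (coordChristoffel G y u v) = lowerChristoffel G y u v :=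
  h.self_apply_inverse (lowerChristoffel G y u v)

set_option maxSynthPendingDepth 5 in
theorem contDiffAt_coordChristoffel [CompleteSpace E] {G : E → E →L[ℝ] E →L[ℝ] ℝ} {y v : E}
    (hG : ContDiffAt ℝ ∞ G y) (h : (G y).IsInvertible) :
    ContDiffAt ℝ ∞ (fun p : E × E ↦ coordChristoffel G p.1 p.2 p.2) (y, v) := by
  have h1 : ContDiffAt ℝ ∞ (fun p : E × E ↦ fderiv ℝ G p.1) (y, v) :=
    (hG.fderiv_right (m := ∞) (by simp)).comp (y, v) contDiffAt_fst
  have h2 : ContDiffAt ℝ ∞ (fun p : E × E ↦ (G p.1).inverse) (y, v) := by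
    obtain ⟨A, hA⟩ := h
    have : ContDiffAt ℝ ∞ (fun z ↦ (G z).inverse) y := by
      refine ContDiffAt.comp y (g := ContinuousLinearMap.inverse) ?_ hG
      rw [← hA]
      exact contDiffAt_map_inverse A
    exact this.comp (y, v) contDiffAt_fst
  have hs : ContDiffAt ℝ ∞ (fun p : E × E ↦ p.2) (y, v) := contDiffAt_snd
  refine h2.clm_apply (ContDiffAt.const_smul _ (((h1.clm_apply hs).clm_apply hs).add
    ((h1.clm_apply hs).clm_apply hs) |>.sub ?_))
  exact contDiffAt_flip ((contDiffAt_flip h1).clm_apply hs) |>.clm_apply hs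

/-- The Gauss formula for the Christoffel symbols of the first kind. -/
theorem lowerChristoffel_pullback {G : E → E →L[ℝ] E →L[ℝ] ℝ} {H : E' → E' →L[ℝ] E' →L[ℝ] ℝ}
    {F : E' → E} {y : E'} (hF : ContDiffAt ℝ 2 F y) (hG : DifferentiableAt ℝ G (F y))
    (hsymm : ∀ u v, G (F y) u v = G (F y) v u)
    (hH : ∀ᶠ z in 𝓝 y, H z = (G (F z)).bilinearComp (fderiv ℝ F z) (fderiv ℝ F z)) (u v w : E') :
    lowerChristoffel H y u v w = G (F y) (fderiv ℝ (fderiv ℝ F) y u v) (fderiv ℝ F y w)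
      + lowerChristoffel G (F y) (fderiv ℝ F y u) (fderiv ℝ F y v) (fderiv ℝ F y w) := by
  have hdF : DifferentiableAt ℝ (fderiv ℝ F) y :=
    (hF.fderiv_right (m := 1) (by norm_num)).differentiableAt (by simp)
  have hFd : HasFDerivAt F (fderiv ℝ F y) y := (hF.differentiableAt (by simp)).hasFDerivAt
  have hGF : HasFDerivAt (fun z ↦ G (F z)) ((fderiv ℝ G (F y)).comp (fderiv ℝ F y)) y :=
    HasFDerivAt.comp (g := G) y hG.hasFDerivAt hFd
  have hHd : DifferentiableAt ℝ H y := by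
    refine DifferentiableAt.congr_of_eventuallyEq ?_ hH
    have h1 : DifferentiableAt ℝ (fun z ↦ (G (F z)).comp (fderiv ℝ F z)) y :=
      hGF.differentiableAt.clm_comp hdF
    exact differentiableAt_flip ((differentiableAt_flip h1).clm_comp hdF)
  -- Product rule for `⟨DF v, DF w⟩`. In the alternating sum of the three derivatives the terms with
  -- second derivatives of `F` cancel in pairs, except the two equal to `⟨D²F(u, v), DF w⟩`.
  have key : ∀ u v w, fderiv ℝ H y u v w
      = fderiv ℝ G (F y) (fderiv ℝ F y u) (fderiv ℝ F y v) (fderiv ℝ F y w)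
        + G (F y) (fderiv ℝ (fderiv ℝ F) y u v) (fderiv ℝ F y w)
        + G (F y) (fderiv ℝ F y v) (fderiv ℝ (fderiv ℝ F) y u w) := by
    intro u v w
    rw [← fderiv_bilin_apply hHd]
    have he : (fun z ↦ H z v w) =ᶠ[𝓝 y] fun z ↦ G (F z) (fderiv ℝ F z v) (fderiv ℝ F z w) :=
      hH.mono fun z hz ↦ by simp only [hz]; rfl
    rw [he.fderiv_eq]
    have h := (hGF.clm_apply (hdF.hasFDerivAt.clm_apply (hasFDerivAt_const v y))).clm_apply
      (hdF.hasFDerivAt.clm_apply (hasFDerivAt_const w y))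
    rw [h.fderiv]
    simp
    ring
  have hD : ∀ u v, fderiv ℝ (fderiv ℝ F) y u v = fderiv ℝ (fderiv ℝ F) y v u := fun u v ↦
    (hF.isSymmSndFDerivAt (by simp)) u v
  rw [lowerChristoffel_apply, lowerChristoffel_apply, key, key, key, hD v u, hD w u, hD w v,
    hsymm (fderiv ℝ F y v), hsymm (fderiv ℝ F y u)]
  ring

/-- The Gauss formula. -/
theorem apply_coordChristoffel_pullback {G : E → E →L[ℝ] E →L[ℝ] ℝ}
    {H : E' → E' →L[ℝ] E' →L[ℝ] ℝ} {F : E' → E} {y : E'} (hF : ContDiffAt ℝ 2 F y)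
    (hG : DifferentiableAt ℝ G (F y)) (hsymm : ∀ u v, G (F y) u v = G (F y) v u)
    (hH : ∀ᶠ z in 𝓝 y, H z = (G (F z)).bilinearComp (fderiv ℝ F z) (fderiv ℝ F z))
    (hGi : (G (F y)).IsInvertible) (hHi : (H y).IsInvertible) (u v w : E') :
    H y (coordChristoffel H y u v) w = G (F y) (fderiv ℝ (fderiv ℝ F) y u v
      + coordChristoffel G (F y) (fderiv ℝ F y u) (fderiv ℝ F y v)) (fderiv ℝ F y w) := by
  rw [apply_coordChristoffel hHi, lowerChristoffel_pullback hF hG hsymm hH, map_add,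
    apply_coordChristoffel hGi]
  rfl

/-- The second derivative of a composition. -/
theorem fderiv_fderiv_comp {E'' : Type*} [NormedAddCommGroup E''] [NormedSpace ℝ E'']
    {F : E' → E} {f : E'' → E'} {y : E''} (hF : ContDiffAt ℝ 2 F (f y)) (hf : ContDiffAt ℝ 2 f y)
    (u v : E'') :
    fderiv ℝ (fderiv ℝ (fun z ↦ F (f z))) y u v
      = fderiv ℝ (fderiv ℝ F) (f y) (fderiv ℝ f y u) (fderiv ℝ f y v)
        + fderiv ℝ F (f y) (fderiv ℝ (fderiv ℝ f) y u v) := by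
  have h1 : fderiv ℝ (fun z ↦ F (f z)) =ᶠ[𝓝 y] fun z ↦ (fderiv ℝ F (f z)).comp (fderiv ℝ f z) := by
    have hFe := hf.continuousAt.eventually (hF.eventually (by simp))
    filter_upwards [hFe, hf.eventually (by simp)] with z hz hz'
    exact fderiv_comp z (hz.differentiableAt (by simp)) (hz'.differentiableAt (by simp))
  rw [h1.fderiv_eq]
  have hdF : HasFDerivAt (fderiv ℝ F) (fderiv ℝ (fderiv ℝ F) (f y)) (f y) :=
    ((hF.fderiv_right (m := 1) (by norm_num)).differentiableAt (by simp)).hasFDerivAt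
  have hdf : HasFDerivAt (fderiv ℝ f) (fderiv ℝ (fderiv ℝ f) y) y :=
    ((hf.fderiv_right (m := 1) (by norm_num)).differentiableAt (by simp)).hasFDerivAt
  have hdFf : HasFDerivAt (fun z ↦ fderiv ℝ F (f z)) _ y :=
    hdF.comp y (hf.differentiableAt (by simp)).hasFDerivAt
  rw [(hdFf.clm_comp hdf).fderiv]
  simp [add_comm]

theorem fderiv_comp_curve {F : E' → E} {x : ℝ → E'} {t : ℝ} (hF : DifferentiableAt ℝ F (x t))
    (hx : DifferentiableAt ℝ x t) : deriv (fun τ ↦ F (x τ)) t = fderiv ℝ F (x t) (deriv x t) :=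
  (hF.hasFDerivAt.comp_hasDerivAt t hx.hasDerivAt).deriv

/-- The second derivative of a curve that is mapped into another space. -/
theorem deriv_deriv_comp_curve {F : E' → E} {x : ℝ → E'} {t : ℝ} (hF : ContDiffAt ℝ 2 F (x t))
    (hx : ContDiffAt ℝ 2 x t) :
    deriv (deriv (fun τ ↦ F (x τ))) t
      = fderiv ℝ (fderiv ℝ F) (x t) (deriv x t) (deriv x t)
        + fderiv ℝ F (x t) (deriv (deriv x) t) := by
  have h1 : deriv (fun τ ↦ F (x τ)) =ᶠ[𝓝 t] fun τ ↦ fderiv ℝ F (x τ) (deriv x τ) := by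
    filter_upwards [hx.continuousAt.eventually (hF.eventually (by simp)),
      hx.eventually (by simp)] with τ h h'
    exact fderiv_comp_curve (h.differentiableAt (by simp)) (h'.differentiableAt (by simp))
  rw [h1.deriv_eq]
  have hdF : HasFDerivAt (fderiv ℝ F) (fderiv ℝ (fderiv ℝ F) (x t)) (x t) :=
    ((hF.fderiv_right (m := 1) (by norm_num)).differentiableAt (by simp)).hasFDerivAt
  have hdx : HasDerivAt (deriv x) (deriv (deriv x) t) t := by
    have : ContDiffAt ℝ 1 (deriv x) t :=
      (hx.fderiv_right (m := 1) (by norm_num)).clm_apply contDiffAt_const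
    exact (this.differentiableAt (by simp)).hasDerivAt
  have hdFx : HasDerivAt (fun τ ↦ fderiv ℝ F (x τ)) _ t :=
    hdF.comp_hasDerivAt t (hx.differentiableAt (by simp)).hasDerivAt
  rw [(hdFx.clm_apply hdx).deriv]

end Coordinates

/-! ### The inverse function theorem and the exponential map. -/

section Exponential

/-- The inverse function theorem for a map that is smooth on an open set. -/
theorem exists_openPartialHomeomorph {E E' : Type*} [NormedAddCommGroup E] [NormedSpace ℝ E]
    [NormedAddCommGroup E'] [NormedSpace ℝ E'] [CompleteSpace E] {f : E → E'} {V : Set E}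
    (hV : IsOpen V) {a : E} (ha : a ∈ V) (hf : ContDiffOn ℝ ∞ f V) {A : E ≃L[ℝ] E'}
    (hA : HasFDerivAt f (A : E →L[ℝ] E') a) {U : Set E'} (hU : IsOpen U) (hfa : f a ∈ U) :
    ∃ Θ : OpenPartialHomeomorph E E', a ∈ Θ.source ∧ Θ.source ⊆ V ∧ Θ.target ⊆ U ∧
      (∀ x, Θ x = f x) ∧ ContDiffOn ℝ ∞ Θ.symm Θ.target := by
  have hat : ∀ x ∈ V, ContDiffAt ℝ ∞ f x := fun x hx ↦ hf.contDiffAt (hV.mem_nhds hx)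
  let Θ₀ := (hat a ha).toOpenPartialHomeomorph f hA (by simp)
  have hΘ₀ : ∀ x, Θ₀ x = f x := fun x ↦ rfl
  let R : Set (E →L[ℝ] E') := Set.range ((↑) : (E ≃L[ℝ] E') → E →L[ℝ] E')
  have hR : IsOpen R := ContinuousLinearEquiv.isOpen
  have hdf : ContinuousOn (fderiv ℝ f) V := hf.continuousOn_fderiv_of_isOpen hV (by simp)
  -- Shrinking to the points where the derivative is invertible makes the inverse smooth on the
  -- whole target, not only near `f a`.
  let W : Set E := (V ∩ f ⁻¹' U) ∩ (V ∩ fderiv ℝ f ⁻¹' R)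
  have hW : IsOpen W := (hf.continuousOn.isOpen_inter_preimage hV hU).inter
    (hdf.isOpen_inter_preimage hV hR)
  have haW : a ∈ W := ⟨⟨ha, hfa⟩, ha, A, hA.fderiv.symm⟩
  have haΘ₀ : a ∈ Θ₀.source := (hat a ha).mem_toOpenPartialHomeomorph_source hA (by simp)
  refine ⟨Θ₀.restrOpen W hW, ?_, ?_, ?_, fun x ↦ rfl, ?_⟩
  · rw [OpenPartialHomeomorph.restrOpen_source]
    exact ⟨haΘ₀, haW⟩
  · rw [OpenPartialHomeomorph.restrOpen_source]
    exact fun x hx ↦ hx.2.1.1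
  · intro y hy
    have h := (Θ₀.restrOpen W hW).map_target hy
    rw [OpenPartialHomeomorph.restrOpen_source] at h
    rw [← (Θ₀.restrOpen W hW).right_inv hy]
    exact h.2.1.2
  · intro y hy
    have h := (Θ₀.restrOpen W hW).map_target hy
    rw [OpenPartialHomeomorph.restrOpen_source] at h
    obtain ⟨A', hA'⟩ := h.2.2.2
    have hx := hat _ h.2.1.1
    refine ((Θ₀.restrOpen W hW).contDiffAt_symm (f₀' := A') hy ?_ hx).contDiffWithinAt
    rw [hA']
    exact (hx.differentiableAt (by simp)).hasFDerivAt

variable {E : Type*} [NormedAddCommGroup E] [NormedSpace ℝ E]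

/-- A curve whose phase curve solves the geodesic equation. -/
theorem deriv_deriv_eq_of_hasDerivAt {p q a : ℝ → E} {t : ℝ}
    (hp : ∀ᶠ τ in 𝓝 t, HasDerivAt p (q τ) τ) (hq : HasDerivAt q (a t) t) :
    deriv (deriv p) t = a t := by
  have : deriv p =ᶠ[𝓝 t] q := hp.mono fun τ h ↦ h.deriv
  rw [this.deriv_eq, hq.deriv]

variable [FiniteDimensional ℝ E]

/-- The geodesics issuing from a point form a smooth family: there is a smooth exponential map. -/
theorem exists_exponential {G : E → E →L[ℝ] E →L[ℝ] ℝ} {U : Set E} (hU : IsOpen U) {y₀ : E}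
    (hy₀ : y₀ ∈ U) (hG : ContDiffOn ℝ ∞ G U) (hGi : ∀ y ∈ U, (G y).IsInvertible) :
    ∃ e : E → E, ContDiff ℝ ∞ e ∧ e 0 = y₀ ∧ HasFDerivAt e (ContinuousLinearMap.id ℝ E) 0 ∧
      ∀ w, IsCoordGeodesic (coordChristoffel G) (fun t ↦ e (t • w)) := by
  have : CompleteSpace E := FiniteDimensional.complete ℝ E
  -- The geodesic spray, that is, the geodesic equation as a first-order system. The cutoff below
  -- makes it compactly supported and hence globally Lipschitz, without changing it near `(y₀, 0)`.
  let X₀ : E × E → E × E := fun p ↦ (p.2, -coordChristoffel G p.1 p.2 p.2)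
  let O : Set (E × E) := U ×ˢ Set.univ
  have hO : IsOpen O := hU.prod isOpen_univ
  have hX₀ : ∀ p ∈ O, ContDiffAt ℝ ∞ X₀ p := fun p hp ↦
    contDiffAt_snd.prodMk (contDiffAt_coordChristoffel (hG.contDiffAt (hU.mem_nhds hp.1))
      (hGi _ hp.1)).neg
  obtain ⟨r, hr, hrO⟩ := Metric.isOpen_iff.1 hO (y₀, 0) ⟨hy₀, trivial⟩
  let χ : ContDiffBump ((y₀, 0) : E × E) := ⟨r / 3, r / 2, by positivity, by linarith⟩
  have hχO : tsupport χ ⊆ O := by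
    rw [χ.tsupport_eq]
    exact (Metric.closedBall_subset_ball (half_lt_self hr)).trans hrO
  let X : E × E → E × E := fun p ↦ χ p • X₀ p
  have hX : ContDiff ℝ ∞ X := by
    rw [contDiff_iff_contDiffAt]
    intro p
    by_cases hp : p ∈ tsupport χ
    · exact χ.contDiff.contDiffAt.smul (hX₀ p (hχO hp))
    · have : X =ᶠ[𝓝 p] fun _ ↦ 0 := by
        filter_upwards [(isClosed_tsupport χ).isOpen_compl.mem_nhds hp] with q hq
        simp only [X, image_eq_zero_of_notMem_tsupport hq, zero_smul]
      exact contDiffAt_const.congr_of_eventuallyEq this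
  have hXc : HasCompactSupport X := χ.hasCompactSupport.smul_right
  obtain ⟨K, hK⟩ := hX.lipschitzWith_of_hasCompactSupport hXc (by simp)
  have hX0 : X (y₀, 0) = 0 := by simp [X, X₀, coordChristoffel_zero]
  obtain ⟨ε, hε, σ, hσ0, hσd, hσc, hσn⟩ := exists_contDiff_flow hX hK
  set δ := r / 3 with hδ
  have hXX₀ : ∀ p, dist p (y₀, 0) < δ → X p = X₀ p := fun p hp ↦ by
    have : χ p = 1 := χ.one_of_mem_closedBall (Metric.mem_closedBall.2 hp.le)
    simp only [X, this, one_smul]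
  obtain ⟨ρ, hρ, hball⟩ : ∃ ρ > 0, ∀ w : E, ‖w‖ < ρ →
      ∀ t ∈ Set.Icc (-1 : ℝ) 1, dist (σ (y₀, w) t) (y₀, 0) < δ := by
    have hc : ContinuousAt (fun w : E ↦ (y₀, w)) 0 := by fun_prop
    obtain ⟨ρ, hρ, h⟩ := Metric.eventually_nhds_iff.1
      (hc.eventually (hσn (y₀, 0) hX0 δ (by positivity)))
    exact ⟨ρ, hρ, fun w hw ↦ h (by simpa using hw)⟩
  have hdp : ∀ w : E, ‖w‖ < ρ → ∀ t ∈ Set.Icc (-1 : ℝ) 1,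
      HasDerivAt (fun t ↦ (σ (y₀, w) t).1) (ε • (σ (y₀, w) t).2) t := fun w hw t ht ↦ by
    have h := hσd (y₀, w) t ht
    rw [hXX₀ _ (hball w hw t ht)] at h
    exact h.fst
  have hdq : ∀ w : E, ‖w‖ < ρ → ∀ t ∈ Set.Icc (-1 : ℝ) 1,
      HasDerivAt (fun t ↦ (σ (y₀, w) t).2)
        (-(ε • coordChristoffel G (σ (y₀, w) t).1 (σ (y₀, w) t).2 (σ (y₀, w) t).2)) t :=
      fun w hw t ht ↦ by
    have h := hσd (y₀, w) t ht
    rw [hXX₀ _ (hball w hw t ht)] at h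
    exact (hasFDerivAt_snd.comp_hasDerivAt t h).congr_deriv (by simp [X₀])
  -- Homogeneity of geodesics: a geodesic run at speed `l` is the geodesic with velocity multiplied
  -- by `l`, by uniqueness of solutions. Small `w` and `|l| ≤ 1` keep both curves where the cut-off
  -- field is the spray.
  have hhom : ∀ w : E, ‖w‖ < ρ → ∀ l ∈ Set.Icc (-1 : ℝ) 1,
      (σ (y₀, l • w) 1).1 = (σ (y₀, w) l).1 := by
    intro w hw l hl
    have hlabs : |l| ≤ 1 := abs_le.2 hl
    have hlt : ∀ t ∈ Set.Icc (-1 : ℝ) 1, t * l ∈ Set.Icc (-1 : ℝ) 1 := fun t ht ↦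
      abs_le.1 (by rw [abs_mul]; exact mul_le_one₀ (abs_le.2 ht) (abs_nonneg _) hlabs)
    let g : ℝ → E × E := fun t ↦ ((σ (y₀, w) (t * l)).1, l • (σ (y₀, w) (t * l)).2)
    have hgd : ∀ t ∈ Set.Icc (-1 : ℝ) 1, HasDerivAt g (ε • X (g t)) t := by
      intro t ht
      have hg1 : dist (g t) (y₀, 0) < δ := by
        refine lt_of_le_of_lt ?_ (hball w hw _ (hlt t ht))
        rw [Prod.dist_eq, Prod.dist_eq]
        refine max_le_max le_rfl ?_
        simp only [g, dist_zero_right, norm_smul, Real.norm_eq_abs]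
        exact mul_le_of_le_one_left (norm_nonneg _) hlabs
      rw [hXX₀ _ hg1]
      have hm : HasDerivAt (fun t : ℝ ↦ t * l) l t := by simpa using (hasDerivAt_id t).mul_const l
      have h1 := (hdp w hw _ (hlt t ht)).scomp t hm
      have h2 := ((hdq w hw _ (hlt t ht)).scomp t hm).const_smul l
      refine (h1.prodMk h2).congr_deriv ?_
      simp only [X₀, g, coordChristoffel_smul_smul, Prod.smul_mk, Prod.mk.injEq]
      constructor <;> module
    have hL : ∀ t ∈ Set.Ioo (-1 : ℝ) 1,
        LipschitzOnWith (ε.toNNReal * K) (fun p ↦ ε • X p) Set.univ := fun t _ ↦ by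
      refine LipschitzWith.lipschitzOnWith (LipschitzWith.of_dist_le_mul fun a b ↦ ?_)
      rw [dist_smul₀, Real.norm_of_nonneg hε.le, NNReal.coe_mul,
        Real.coe_toNNReal _ hε.le, mul_assoc]
      exact mul_le_mul_of_nonneg_left (hK.dist_le_mul a b) hε.le
    have huniq := ODE_solution_unique_of_mem_Icc (f := σ (y₀, l • w)) (g := g) hL
      (t₀ := 0) (by norm_num)
      (fun t ht ↦ (hσd _ t ht).continuousAt.continuousWithinAt)
      (fun t ht ↦ hσd _ t (Set.Ioo_subset_Icc_self ht)) (fun _ _ ↦ trivial)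
      (fun t ht ↦ (hgd t ht).continuousAt.continuousWithinAt)
      (fun t ht ↦ hgd t (Set.Ioo_subset_Icc_self ht)) (fun _ _ ↦ trivial)
      (by simp only [g, zero_mul, hσ0])
    have := congrArg Prod.fst (huniq (x := 1) (by norm_num))
    simpa [g] using this
  -- The flow belongs to `ε • X`, so the position moves with velocity `ε` times the second
  -- component; the factor `ε⁻¹` compensates for this.
  let e : E → E := fun w ↦ (σ (y₀, ε⁻¹ • w) 1).1
  have he : ContDiff ℝ ∞ e :=
    ((hσc 1 (by norm_num)).comp (contDiff_const.prodMk (contDiff_id.const_smul ε⁻¹))).fst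
  -- the radial curves
  have hrad : ∀ w, ∃ w' : E, ‖w'‖ < ρ ∧ ∃ η > 0, w = (ε / η) • w' ∧
      ∀ t ∈ Set.Ioo (-η) η, e (t • w) = (σ (y₀, w') (η⁻¹ * t)).1 := by
    intro w
    obtain ⟨η, hη, hηw⟩ : ∃ η > 0, ‖(η * ε⁻¹) • w‖ < ρ := by
      refine ⟨ρ / (2 * (ε⁻¹ * ‖w‖ + 1)), by positivity, ?_⟩
      rw [norm_smul, Real.norm_of_nonneg (by positivity)]
      rw [mul_assoc, div_mul_eq_mul_div, div_lt_iff₀ (by positivity)]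
      have : 0 ≤ ε⁻¹ * ‖w‖ := by positivity
      nlinarith
    refine ⟨(η * ε⁻¹) • w, hηw, η, hη, ?_, fun t ht ↦ ?_⟩
    · rw [smul_smul, show ε / η * (η * ε⁻¹) = 1 by field_simp, one_smul]
    · rw [← hhom _ hηw]
      · simp only [e, smul_smul]
        rw [show ε⁻¹ * t = η⁻¹ * t * (η * ε⁻¹) by field_simp]
      · rw [← div_eq_inv_mul, Set.mem_Icc, le_div_iff₀ hη, div_le_iff₀ hη]
        exact ⟨by linarith [ht.1], by linarith [ht.2]⟩
  have hrad1 : ∀ w : E, ∃ q : ℝ → E, q 0 = w ∧ (∀ᶠ t in 𝓝 0, HasDerivAt (fun t ↦ e (t • w)) (q t) t) ∧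
      ∀ᶠ t in 𝓝 0, HasDerivAt q (-coordChristoffel G (e (t • w)) (q t) (q t)) t := by
    intro w
    obtain ⟨w', hw', η, hη, hw, hew⟩ := hrad w
    have hIoo : Set.Ioo (-η) η ∈ 𝓝 (0 : ℝ) := Ioo_mem_nhds (by linarith) hη
    have hmem : ∀ t ∈ Set.Ioo (-η) η, η⁻¹ * t ∈ Set.Icc (-1 : ℝ) 1 := fun t ht ↦ by
      rw [← div_eq_inv_mul, Set.mem_Icc, le_div_iff₀ hη, div_le_iff₀ hη]
      exact ⟨by linarith [ht.1], by linarith [ht.2]⟩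
    have hm : ∀ t : ℝ, HasDerivAt (fun t : ℝ ↦ η⁻¹ * t) η⁻¹ t := fun t ↦ by
      simpa using (hasDerivAt_id t).const_mul η⁻¹
    refine ⟨fun t ↦ (ε / η) • (σ (y₀, w') (η⁻¹ * t)).2, by simp [hσ0, hw], ?_, ?_⟩
    · filter_upwards [hIoo] with t ht
      have h := (hdp w' hw' _ (hmem t ht)).scomp t (hm t)
      have h' := h.congr_of_eventuallyEq (f₁ := fun t ↦ e (t • w))
        (Filter.eventuallyEq_of_mem (isOpen_Ioo.mem_nhds ht) hew)
      exact h'.congr_deriv (by module)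
    · filter_upwards [hIoo] with t ht
      have h := ((hdq w' hw' _ (hmem t ht)).scomp t (hm t)).const_smul (ε / η)
      rw [hew t ht]
      refine h.congr_deriv ?_
      rw [coordChristoffel_smul_smul]
      module
  have he0 : e 0 = y₀ := by
    have h := hhom 0 (by simpa using hρ) 0 (by norm_num)
    rw [hσ0, smul_zero] at h
    simpa only [e, smul_zero] using h
  refine ⟨e, he, he0, ?_, fun w ↦ ⟨?_, ?_⟩⟩
  · have hd : HasFDerivAt e (fderiv ℝ e 0) 0 := (he.differentiable (by simp)).differentiableAt.hasFDerivAt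
    -- Along the ray through `w` the derivative of `e` is the initial velocity of the radial
    -- geodesic, which is `w`.
    have : fderiv ℝ e 0 = ContinuousLinearMap.id ℝ E := by
      ext w
      obtain ⟨q, hq0, hq, -⟩ := hrad1 w
      have h1 : HasDerivAt (fun t : ℝ ↦ t • w) w 0 := by
        simpa using (hasDerivAt_id (0 : ℝ)).smul_const w
      have hd' : HasFDerivAt e (fderiv ℝ e 0) ((0 : ℝ) • w) := by simpa using hd
      have h2 := hd'.comp_hasDerivAt (0 : ℝ) h1
      exact (h2.unique hq.self_of_nhds).trans hq0
    rwa [this] at hd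
  · exact ((he.comp (contDiff_id.smul contDiff_const)).of_le (by norm_cast)).contDiffAt
  · obtain ⟨q, hq0, hq, hq'⟩ := hrad1 w
    filter_upwards [hq.eventually_nhds, hq'] with t ht ht'
    rw [deriv_deriv_eq_of_hasDerivAt (a := fun t ↦ -coordChristoffel G (e (t • w)) (q t) (q t))
      ht ht', ht.self_of_nhds.deriv]
    simp

end Exponential

/-! ### Geodesics of submanifolds, in coordinates. -/

section TotallyGeodesic

variable {E : Type*} [NormedAddCommGroup E] [NormedSpace ℝ E]
  {E' : Type*} [NormedAddCommGroup E'] [NormedSpace ℝ E']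

theorem contDiffAt_deriv {x : ℝ → E} {t : ℝ} (hx : ContDiffAt ℝ 2 x t) :
    ContDiffAt ℝ 1 (deriv x) t :=
  (hx.fderiv_right (m := 1) (by norm_num)).clm_apply contDiffAt_const

theorem IsCoordGeodesic.congr {Γ : E → E → E → E} {x x' : ℝ → E} (hx : IsCoordGeodesic Γ x)
    (h : x' =ᶠ[𝓝 0] x) : IsCoordGeodesic Γ x' := by
  refine ⟨hx.1.congr_of_eventuallyEq h, ?_⟩
  filter_upwards [hx.2, h.eventuallyEq_nhds] with t ht h't
  rw [h't.deriv.deriv_eq, h't.deriv_eq, h't.self_of_nhds]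
  exact ht

/-- If geodesics through a point are mapped to geodesics, then the second fundamental form
vanishes there. -/
theorem fderiv_fderiv_add_coordChristoffel [FiniteDimensional ℝ E']
    {G : E → E →L[ℝ] E →L[ℝ] ℝ} {H : E' → E' →L[ℝ] E' →L[ℝ] ℝ} {F : E' → E} {U : Set E'} {y : E'}
    (hU : IsOpen U) (hy : y ∈ U) (hH : ContDiffOn ℝ ∞ H U) (hHi : ∀ z ∈ U, (H z).IsInvertible)
    (hHs : ∀ z ∈ U, ∀ u v, H z u v = H z v u) (hF : ContDiffAt ℝ 2 F y)
    (hG : DifferentiableAt ℝ G (F y)) (hGs : ∀ᶠ z in 𝓝 (F y), ∀ u v, G z u v = G z v u)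
    (hgeod : ∀ x : ℝ → E', x 0 = y → IsCoordGeodesic (coordChristoffel H) x →
      IsCoordGeodesic (coordChristoffel G) (fun t ↦ F (x t))) (u v : E') :
    fderiv ℝ (fderiv ℝ F) y u v + coordChristoffel G (F y) (fderiv ℝ F y u) (fderiv ℝ F y v)
      = fderiv ℝ F y (coordChristoffel H y u v) := by
  obtain ⟨e, he, he0, hed, hgeo⟩ := exists_exponential hU hy hH hHi
  -- The second fundamental form in coordinates. It vanishes on the diagonal, since the geodesic
  -- with velocity `w` is mapped to a geodesic; symmetry and polarization then give `B = 0`.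
  let B : E' → E' → E := fun u v ↦ fderiv ℝ (fderiv ℝ F) y u v
    + coordChristoffel G (F y) (fderiv ℝ F y u) (fderiv ℝ F y v)
    - fderiv ℝ F y (coordChristoffel H y u v)
  have hdiag : ∀ w, B w w = 0 := by
    intro w
    have h1 := hgeo w
    have hx0 : e ((0 : ℝ) • w) = y := by rw [zero_smul, he0]
    have h2 := hgeod _ hx0 h1
    have hd : deriv (fun t : ℝ ↦ e (t • w)) 0 = w := by
      have h1 : HasDerivAt (fun t : ℝ ↦ t • w) w 0 := by
        simpa using (hasDerivAt_id (0 : ℝ)).smul_const w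
      have h2 : HasFDerivAt e (ContinuousLinearMap.id ℝ E') ((0 : ℝ) • w) := by simpa using hed
      exact (h2.comp_hasDerivAt (0 : ℝ) h1).deriv
    have hF' : ContDiffAt ℝ 2 F (e ((0 : ℝ) • w)) := by rwa [hx0]
    have h3 := h2.2.self_of_nhds
    rw [deriv_deriv_comp_curve hF' h1.1,
      fderiv_comp_curve (hF'.differentiableAt (by simp)) (h1.1.differentiableAt (by simp)), hd,
      eq_neg_of_add_eq_zero_left h1.2.self_of_nhds, hd, hx0, map_neg] at h3
    simp only [hx0] at h3
    simp only [B]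
    rw [← h3]
    abel
  have hsymm : B u v = B v u := by
    simp only [B]
    rw [coordChristoffel_comm hG hGs,
      coordChristoffel_comm ((hH.contDiffAt (hU.mem_nhds hy)).differentiableAt (by simp))
        (Filter.eventually_of_mem (hU.mem_nhds hy) hHs),
      (hF.isSymmSndFDerivAt (by simp)) u v]
  have hadd : B (u + v) (u + v) = B u u + B u v + (B v u + B v v) := by
    simp only [B, map_add, add_apply, coordChristoffel_add_left,
      coordChristoffel_add_right]
    abel
  rw [hdiag, hdiag, hdiag, hsymm, zero_add, add_zero, ← two_smul ℝ, eq_comm,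
    smul_eq_zero_iff_right (by norm_num), ← hsymm] at hadd
  exact sub_eq_zero.1 hadd

/-- Geodesics are determined by their initial velocity. -/
theorem IsCoordGeodesic.eventuallyEq [CompleteSpace E] {G : E → E →L[ℝ] E →L[ℝ] ℝ} {x x' : ℝ → E}
    (hx : IsCoordGeodesic (coordChristoffel G) x) (hx' : IsCoordGeodesic (coordChristoffel G) x')
    (hG : ContDiffAt ℝ ∞ G (x 0)) (hGi : (G (x 0)).IsInvertible) (h0 : x 0 = x' 0)
    (h1 : deriv x 0 = deriv x' 0) : x =ᶠ[𝓝 0] x' := by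
  let X : E × E → E × E := fun p ↦ (p.2, -coordChristoffel G p.1 p.2 p.2)
  have hX : ContDiffAt ℝ 1 X (x 0, deriv x 0) :=
    (contDiffAt_snd.prodMk (contDiffAt_coordChristoffel hG hGi).neg).of_le (by norm_cast)
  obtain ⟨K, s, hs, hK⟩ := hX.exists_lipschitzOnWith
  have key : ∀ z : ℝ → E, IsCoordGeodesic (coordChristoffel G) z → z 0 = x 0 →
      deriv z 0 = deriv x 0 → ∀ᶠ t in 𝓝 (0 : ℝ),
        HasDerivAt (fun t ↦ (z t, deriv z t)) (X (z t, deriv z t)) t ∧ (z t, deriv z t) ∈ s := by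
    intro z hz hz0 hz1
    have hc : ContinuousAt (fun t ↦ (z t, deriv z t)) 0 :=
      hz.1.continuousAt.prodMk (contDiffAt_deriv hz.1).continuousAt
    have hs' : s ∈ 𝓝 (z 0, deriv z 0) := by rwa [hz0, hz1]
    filter_upwards [hc.eventually hs', hz.1.eventually (by simp), hz.2] with t ht h2 h
    refine ⟨?_, ht⟩
    have hd1 := (h2.differentiableAt (by simp)).hasDerivAt
    have hd2 := ((contDiffAt_deriv h2).differentiableAt (by simp)).hasDerivAt
    rw [eq_neg_of_add_eq_zero_left h] at hd2
    exact hd1.prodMk hd2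
  have := ODE_solution_unique_of_eventually (v := fun _ ↦ X) (s := fun _ ↦ s)
    (Filter.Eventually.of_forall fun _ ↦ hK) (key x hx rfl rfl) (key x' hx' h0.symm h1.symm)
    (by rw [h0, h1])
  exact this.mono fun t ht ↦ congrArg Prod.fst ht

/-- A geodesic of the ambient space that runs in a submanifold is a geodesic of the submanifold. -/
theorem IsCoordGeodesic.of_comp {G : E → E →L[ℝ] E →L[ℝ] ℝ} {H : E' → E' →L[ℝ] E' →L[ℝ] ℝ}
    {F : E' → E} {x : ℝ → E'} (hx : ContDiffAt ℝ 2 x 0)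
    (hFx : IsCoordGeodesic (coordChristoffel G) (fun t ↦ F (x t))) (hF : ContDiffAt ℝ 2 F (x 0))
    (hG : ∀ᶠ z in 𝓝 (x 0), DifferentiableAt ℝ G (F z) ∧ (∀ u v, G (F z) u v = G (F z) v u) ∧
      (G (F z)).IsInvertible)
    (hH : ∀ᶠ z in 𝓝 (x 0), H z = (G (F z)).bilinearComp (fderiv ℝ F z) (fderiv ℝ F z))
    (hHi : ∀ᶠ z in 𝓝 (x 0), (H z).IsInvertible) :
    IsCoordGeodesic (coordChristoffel H) x := by
  refine ⟨hx, ?_⟩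
  have hc := hx.continuousAt
  filter_upwards [hx.eventually (by simp), hFx.2, hc.eventually (hF.eventually (by simp)),
    hc.eventually hG, hc.eventually hH.eventually_nhds, hc.eventually hHi]
    with t ht hgeo hF hG hH hHi
  rw [deriv_deriv_comp_curve hF ht,
    fderiv_comp_curve (hF.differentiableAt (by simp)) (ht.differentiableAt (by simp))] at hgeo
  obtain ⟨A, hA⟩ := hHi
  have hinj : Function.Injective (H (x t)) := by rw [← hA]; exact A.injective
  -- By the Gauss formula, the covariant acceleration in the submanifold paired with `w` is the
  -- ambient one, which is zero, paired with `DF w`. Nondegeneracy of `H` concludes.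
  refine hinj ?_
  ext w
  rw [map_add, map_zero, add_apply, zero_apply,
    apply_coordChristoffel_pullback hF hG.1 hG.2.1 hH hG.2.2 ⟨A, hA⟩, hH.self_of_nhds,
    ContinuousLinearMap.bilinearComp_apply, ← add_apply, ← map_add, ← add_assoc,
    add_comm (fderiv ℝ F (x t) _), hgeo, map_zero, zero_apply]

/-- A submanifold that contains a geodesic of the ambient space in each direction at a point is
totally geodesic there. -/
theorem isCoordGeodesic_comp [CompleteSpace E'] {G : E → E →L[ℝ] E →L[ℝ] ℝ}
    {H : E' → E' →L[ℝ] E' →L[ℝ] ℝ} {F : E' → E} {y : E'} (hF : ContDiffAt ℝ 2 F y)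
    (hG : ∀ᶠ z in 𝓝 y, DifferentiableAt ℝ G (F z) ∧ (∀ u v, G (F z) u v = G (F z) v u) ∧
      (G (F z)).IsInvertible)
    (hH : ∀ᶠ z in 𝓝 y, H z = (G (F z)).bilinearComp (fderiv ℝ F z) (fderiv ℝ F z))
    (hHs : ContDiffAt ℝ ∞ H y) (hHi : ∀ᶠ z in 𝓝 y, (H z).IsInvertible)
    (hrad : ∀ v, ∃ x : ℝ → E', x 0 = y ∧ deriv x 0 = v ∧ ContDiffAt ℝ 2 x 0 ∧
      IsCoordGeodesic (coordChristoffel G) (fun t ↦ F (x t)))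
    {c : ℝ → E'} (hc0 : c 0 = y) (hc : IsCoordGeodesic (coordChristoffel H) c) :
    IsCoordGeodesic (coordChristoffel G) (fun t ↦ F (c t)) := by
  obtain ⟨x, hx0, hx1, hx2, hx⟩ := hrad (deriv c 0)
  subst hc0
  -- The ambient geodesic with the initial velocity of `c` runs inside the submanifold, so it is a
  -- geodesic of `H` and by uniqueness coincides with `c`.
  have hxH : IsCoordGeodesic (coordChristoffel H) x :=
    .of_comp hx2 hx (hx0 ▸ hF) (hx0 ▸ hG) (hx0 ▸ hH) (hx0 ▸ hHi)
  have := hc.eventuallyEq hxH hHs hHi.self_of_nhds hx0.symm hx1.symm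
  exact hx.congr (this.mono fun t ht ↦ by simp only [ht])

end TotallyGeodesic

/-! ### Metrics and differentials in the preferred charts. -/

section Charts

variable {d : ℕ} {N : Type*} [TopologicalSpace N] [ChartedSpace (Vec d) N]

/-- The frame of coordinate vector fields of the preferred chart around `p`. -/
def chartFrame (p : N) (y : Vec d) : Vec d →L[ℝ] Vec d :=
  mfderiv 𝓘(ℝ, Vec d) (𝓡 d) (extChartAt (𝓡 d) p).symm y

theorem chartMetric_apply (g : BilinField d N) (p : N) (y u v : Vec d) :
    chartMetric g p y u v
      = g.at ((extChartAt (𝓡 d) p).symm y) (chartFrame p y u) (chartFrame p y v) := rfl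

theorem isInvertible_chartFrame [IsManifold (𝓡 d) ∞ N] {p : N} {y : Vec d}
    (hy : y ∈ (extChartAt (𝓡 d) p).target) : (chartFrame p y).IsInvertible := by
  have : IsManifold (𝓡 d) 1 N := IsManifold.of_le (n := ∞) (by norm_cast)
  have h := isInvertible_mfderivWithin_extChartAt_symm (I := 𝓡 d) hy
  rw [ModelWithCorners.range_eq_univ, mfderivWithin_univ] at h
  exact h

theorem chartFrame_self [IsManifold (𝓡 d) ∞ N] (p : N) :
    chartFrame p (extChartAt (𝓡 d) p p) = ContinuousLinearMap.id ℝ (Vec d) := by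
  have : IsManifold (𝓡 d) 1 N := IsManifold.of_le (n := ∞) (by norm_cast)
  have h := mfderivWithin_range_extChartAt_symm (I := 𝓡 d) (x := p)
  rw [ModelWithCorners.range_eq_univ, mfderivWithin_univ] at h
  exact h

/-- The coordinate vector fields of the preferred chart are smooth. -/
theorem contMDiffOn_coordField [IsManifold (𝓡 d) ∞ N] (p : N) (u : Vec d) :
    ContMDiffOn 𝓘(ℝ, Vec d) (𝓡 d).tangent ∞ (fun y ↦ (⟨(extChartAt (𝓡 d) p).symm y,
      mfderiv 𝓘(ℝ, Vec d) (𝓡 d) (extChartAt (𝓡 d) p).symm y u⟩ : TangentBundle (𝓡 d) N))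
      (extChartAt (𝓡 d) p).target := by
  have : IsManifold (𝓡 d) 1 N := IsManifold.of_le (n := ∞) (by norm_cast)
  have ht := isOpen_extChartAt_target (I := 𝓡 d) p
  have h := (contMDiffOn_extChartAt_symm (I := 𝓡 d) (n := ∞) p).contMDiffOn_tangentMapWithin
    (m := ∞) (by simp) ht.uniqueMDiffOn
  have hs : ContMDiff 𝓘(ℝ, Vec d) (𝓘(ℝ, Vec d)).tangent ∞
      (fun y ↦ (⟨y, u⟩ : TangentBundle 𝓘(ℝ, Vec d) (Vec d))) :=
    contMDiff_vectorSpace_iff_contDiff.2 contDiff_const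
  refine (h.comp hs.contMDiffOn fun y hy ↦ hy).congr fun y hy ↦ ?_
  simp only [Function.comp_apply, tangentMapWithin]
  rw [mfderivWithin_of_mem_nhds (ht.mem_nhds hy)]

/-- The coefficients are the values of a smooth section of bilinear forms on smooth coordinate
vector fields. -/
theorem contDiffOn_chartMetric [IsManifold (𝓡 d) ∞ N] {g : BilinField d N} (hg : IsSmoothField g)
    (p : N) : ContDiffOn ℝ ∞ (chartMetric g p) (extChartAt (𝓡 d) p).target := by
  have : IsManifold (𝓡 d) 1 N := IsManifold.of_le (n := ∞) (by norm_cast)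
  rw [contDiffOn_clm_apply]
  intro u
  rw [contDiffOn_clm_apply]
  intro v
  rw [← contMDiffOn_iff_contDiffOn]
  intro y hy
  have h1 : ContMDiffWithinAt 𝓘(ℝ, Vec d) ((𝓡 d).prod 𝓘(ℝ, ℝ)) ∞
      (fun y ↦ Bundle.TotalSpace.mk' ℝ (E := Bundle.Trivial N ℝ) ((extChartAt (𝓡 d) p).symm y)
        (g ((extChartAt (𝓡 d) p).symm y)
          (mfderiv 𝓘(ℝ, Vec d) (𝓡 d) (extChartAt (𝓡 d) p).symm y u)
          (mfderiv 𝓘(ℝ, Vec d) (𝓡 d) (extChartAt (𝓡 d) p).symm y v)))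
      (extChartAt (𝓡 d) p).target y := by
    apply ContMDiffWithinAt.clm_bundle_apply₂ (F₁ := Vec d) (F₂ := Vec d)
    · exact hg.contMDiffAt.comp_contMDiffWithinAt y (contMDiffOn_extChartAt_symm p y hy)
    · exact contMDiffOn_coordField p u y hy
    · exact contMDiffOn_coordField p v y hy
  rw [Bundle.contMDiffWithinAt_totalSpace] at h1
  exact h1.2

/-- The form is symmetric and nondegenerate. -/
def IsNondegenerateForm {E : Type*} [NormedAddCommGroup E] [NormedSpace ℝ E]
    (B : E →L[ℝ] E →L[ℝ] ℝ) : Prop :=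
  (∀ u v, B u v = B v u) ∧ ∀ u, (∀ v, B u v = 0) → u = 0

theorem IsNondegenerateForm.of_pos {E : Type*} [NormedAddCommGroup E] [NormedSpace ℝ E]
    {B : E →L[ℝ] E →L[ℝ] ℝ} (hs : ∀ u v, B u v = B v u) (hpos : ∀ u, u ≠ 0 → 0 < B u u) :
    IsNondegenerateForm B := by
  refine ⟨hs, fun u hu ↦ ?_⟩
  by_contra h
  exact (hpos u h).ne' (hu u)

theorem IsNondegenerateForm.isInvertible {E : Type*} [NormedAddCommGroup E] [NormedSpace ℝ E]
    [FiniteDimensional ℝ E] {B : E →L[ℝ] E →L[ℝ] ℝ} (hB : IsNondegenerateForm B) :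
    B.IsInvertible :=
  isInvertible_of_nondegenerate hB.2

theorem IsRiemannianField.isNondegenerateForm {g : BilinField d N} (hg : IsRiemannianField g)
    (x : N) : IsNondegenerateForm (g.at x) :=
  .of_pos (hg x).1 (hg x).2

/-- A vector in the kernel of the form is orthogonal to `t`, where the form is positive definite,
yet has length zero. -/
theorem IsLorentzianField.isNondegenerateForm {g : BilinField d N} (hg : IsLorentzianField g)
    (x : N) : IsNondegenerateForm (g.at x) := by
  obtain ⟨hs, t, -, hpos⟩ := hg x
  refine ⟨hs, fun u hu ↦ ?_⟩
  by_contra h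
  exact (hpos u h (by rw [hs]; exact hu t)).ne' (hu u)

theorem isNondegenerateForm_chartMetric [IsManifold (𝓡 d) ∞ N] {g : BilinField d N}
    (hg : ∀ x, IsNondegenerateForm (g.at x)) (p : N) {y : Vec d}
    (hy : y ∈ (extChartAt (𝓡 d) p).target) : IsNondegenerateForm (chartMetric g p y) := by
  obtain ⟨A, hA⟩ := isInvertible_chartFrame hy
  have hgA : ∀ u v, chartMetric g p y u v
      = g.at ((extChartAt (𝓡 d) p).symm y) (A u) (A v) := fun u v ↦ by
    rw [chartMetric_apply, ← hA]; rfl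
  refine ⟨fun u v ↦ by rw [hgA, hgA, (hg _).1], fun u hu ↦ ?_⟩
  have : A u = 0 := (hg _).2 _ fun w ↦ by
    have := hu (A.symm w)
    rwa [hgA, A.apply_symm_apply] at this
  exact A.injective (this.trans (map_zero A).symm)

theorem chartMetric_self [IsManifold (𝓡 d) ∞ N] (g : BilinField d N) (p : N) :
    chartMetric g p (extChartAt (𝓡 d) p p) = g.at p := by
  ext u v
  rw [chartMetric_apply, chartFrame_self, extChartAt_to_inv]
  rfl

variable {k : ℕ} {P : Type*} [TopologicalSpace P] [ChartedSpace (Vec k) P]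

/-- The coordinate expression of a smooth map is smooth around the base point, and the metric that
it induces is, in coordinates, the pull-back of the coordinate expression of the metric. -/
theorem exists_isOpen_pullback [IsManifold (𝓡 d) ∞ N] [IsManifold (𝓡 k) ∞ P] (g : BilinField d N)
    {f : P → N} (hf : ContMDiff (𝓡 k) (𝓡 d) ∞ f) (q : P) :
    ∃ U : Set (Vec k), IsOpen U ∧ extChartAt (𝓡 k) q q ∈ U ∧ U ⊆ (extChartAt (𝓡 k) q).target ∧
      ContDiffOn ℝ ∞ (writtenInExtChartAt (𝓡 k) (𝓡 d) q f) U ∧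
      Set.MapsTo (fun z ↦ f ((extChartAt (𝓡 k) q).symm z)) U (extChartAt (𝓡 d) (f q)).source ∧
      ∀ z ∈ U, chartMetric (inducedMetric k g f) q z
        = (chartMetric g (f q) (writtenInExtChartAt (𝓡 k) (𝓡 d) q f z)).bilinearComp
          (fderiv ℝ (writtenInExtChartAt (𝓡 k) (𝓡 d) q f) z)
          (fderiv ℝ (writtenInExtChartAt (𝓡 k) (𝓡 d) q f) z) := by
  have : IsManifold (𝓡 d) 1 N := IsManifold.of_le (n := ∞) (by norm_cast)
  have : IsManifold (𝓡 k) 1 P := IsManifold.of_le (n := ∞) (by norm_cast)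
  set φ := extChartAt (𝓡 k) q with hφ
  set ψ := extChartAt (𝓡 d) (f q) with hψ
  set F : Vec k → Vec d := writtenInExtChartAt (𝓡 k) (𝓡 d) q f with hF
  have hFe : F = ψ ∘ (f ∘ φ.symm) := rfl
  have hφt : IsOpen φ.target := isOpen_extChartAt_target q
  have hφs : ContMDiffOn 𝓘(ℝ, Vec k) (𝓡 k) ∞ φ.symm φ.target := contMDiffOn_extChartAt_symm q
  have hfφ : ContMDiffOn 𝓘(ℝ, Vec k) (𝓡 d) ∞ (f ∘ φ.symm) φ.target := hf.comp_contMDiffOn hφs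
  let U := φ.target ∩ (f ∘ φ.symm) ⁻¹' ψ.source
  have hU : IsOpen U := hfφ.continuousOn.isOpen_inter_preimage hφt (isOpen_extChartAt_source _)
  have hFU : ContMDiffOn 𝓘(ℝ, Vec k) 𝓘(ℝ, Vec d) ∞ F U := by
    refine (contMDiffOn_extChartAt (I := 𝓡 d) (x := f q) (n := ∞)).comp
      (hfφ.mono Set.inter_subset_left) fun z hz ↦ ?_
    rw [← extChartAt_source (𝓡 d)]
    exact hz.2
  refine ⟨U, hU, ⟨mem_extChartAt_target q, ?_⟩, Set.inter_subset_left, hFU.contDiffOn,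
    fun z hz ↦ hz.2, fun z hz ↦ ?_⟩
  · simp only [Set.mem_preimage, Function.comp_apply, hφ, extChartAt_to_inv, hψ]
    exact mem_extChartAt_source _
  have hFz : ψ.symm (F z) = f (φ.symm z) := ψ.left_inv hz.2
  have hsymm : MDifferentiableAt 𝓘(ℝ, Vec k) (𝓡 k) φ.symm z :=
    ((hφs z hz.1).contMDiffAt (hφt.mem_nhds hz.1)).mdifferentiableAt (by simp)
  have hfd : MDifferentiableAt (𝓡 k) (𝓡 d) f (φ.symm z) := hf.contMDiffAt.mdifferentiableAt (by simp)
  have hFd : MDifferentiableAt 𝓘(ℝ, Vec k) 𝓘(ℝ, Vec d) F z :=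
    ((hFU z hz).contMDiffAt (hU.mem_nhds hz)).mdifferentiableAt (by simp)
  have hψd : MDifferentiableAt 𝓘(ℝ, Vec d) (𝓡 d) ψ.symm (F z) :=
    (((contMDiffOn_extChartAt_symm (I := 𝓡 d) (n := ∞) (f q)) _ (ψ.map_source hz.2)).contMDiffAt
      ((isOpen_extChartAt_target _).mem_nhds (ψ.map_source hz.2))).mdifferentiableAt (by simp)
  have h1 : mfderiv 𝓘(ℝ, Vec k) (𝓡 d) (f ∘ φ.symm) z
      = (mfderiv (𝓡 k) (𝓡 d) f (φ.symm z)).comp (mfderiv 𝓘(ℝ, Vec k) (𝓡 k) φ.symm z) :=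
    mfderiv_comp z hfd hsymm
  have h2 : mfderiv 𝓘(ℝ, Vec k) (𝓡 d) (ψ.symm ∘ F) z
      = (mfderiv 𝓘(ℝ, Vec d) (𝓡 d) ψ.symm (F z)).comp
        (mfderiv 𝓘(ℝ, Vec k) 𝓘(ℝ, Vec d) F z) := mfderiv_comp z hψd hFd
  have h3 : ψ.symm ∘ F =ᶠ[𝓝 z] f ∘ φ.symm := by
    filter_upwards [hU.mem_nhds hz] with z hz
    exact ψ.left_inv hz.2
  -- Both sides are the differential of one map, since `ψ.symm ∘ F` and `f ∘ φ.symm` agree near `z`.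
  have key : (differential d k f (φ.symm z)).comp (chartFrame q z)
      = (chartFrame (f q) (F z)).comp (fderiv ℝ F z) := by
    rw [mfderiv_eq_fderiv] at h2
    exact h1.symm.trans (h3.mfderiv_eq.symm.trans h2)
  ext u v
  rw [chartMetric_apply, ContinuousLinearMap.bilinearComp_apply, chartMetric_apply, hFz]
  change g.at (f (φ.symm z)) ((differential d k f (φ.symm z)).comp (chartFrame q z) u)
    ((differential d k f (φ.symm z)).comp (chartFrame q z) v) = _
  rw [key]
  rfl

theorem differential_eq_fderiv {f : P → N} {q : P} (hf : MDifferentiableAt (𝓡 k) (𝓡 d) f q) :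
    differential d k f q = fderiv ℝ (writtenInExtChartAt (𝓡 k) (𝓡 d) q f)
      (extChartAt (𝓡 k) q q) := by
  rw [differential, hf.mfderiv, ModelWithCorners.range_eq_univ, fderivWithin_univ]

theorem writtenInExtChartAt_self (f : P → N) (q : P) :
    writtenInExtChartAt (𝓡 k) (𝓡 d) q f (extChartAt (𝓡 k) q q) = extChartAt (𝓡 d) (f q) (f q) := by
  simp [writtenInExtChartAt]

/-- In charts adapted to the immersion, `f` is the injective linear map `x ↦ hf.equiv (x, 0)`, and
the differential of the chart of the domain is injective. -/
theorem injective_differential [IsManifold (𝓡 d) ∞ N] [IsManifold (𝓡 k) ∞ P] {f : P → N} {q : P}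
    (hf : IsImmersionAt (𝓡 k) (𝓡 d) ∞ f q) : Function.Injective (differential d k f q) := by
  have : IsManifold (𝓡 d) 1 N := IsManifold.of_le (n := ∞) (by norm_cast)
  have : IsManifold (𝓡 k) 1 P := IsManifold.of_le (n := ∞) (by norm_cast)
  have hfd : MDifferentiableAt (𝓡 k) (𝓡 d) f q := hf.contMDiffAt.mdifferentiableAt (by simp)
  set α := hf.domChart
  set β := hf.codChart
  have hα : ContMDiffOn (𝓡 k) (𝓡 k) ∞ α α.source :=
    contMDiffOn_of_mem_maximalAtlas hf.domChart_mem_maximalAtlas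
  have hα' : ContMDiffOn (𝓡 k) (𝓡 k) ∞ α.symm α.target :=
    contMDiffOn_symm_of_mem_maximalAtlas hf.domChart_mem_maximalAtlas
  have hβ : ContMDiffOn (𝓡 d) (𝓡 d) ∞ β β.source :=
    contMDiffOn_of_mem_maximalAtlas hf.codChart_mem_maximalAtlas
  have hqα : q ∈ α.source := hf.mem_domChart_source
  have hqβ : f q ∈ β.source := hf.mem_codChart_source
  have hβd : MDifferentiableAt (𝓡 d) (𝓡 d) β (f q) :=
    ((hβ _ hqβ).contMDiffAt (β.open_source.mem_nhds hqβ)).mdifferentiableAt (by simp)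
  have hα'd : MDifferentiableAt (𝓡 k) (𝓡 k) α.symm (α q) :=
    ((hα' _ (α.map_source hqα)).contMDiffAt
      (α.open_target.mem_nhds (α.map_source hqα))).mdifferentiableAt (by simp)
  have hαd : α.MDifferentiable (𝓡 k) (𝓡 k) :=
    ⟨hα.mdifferentiableOn (by simp), hα'.mdifferentiableOn (by simp)⟩
  have heq : β ∘ f =ᶠ[𝓝 q] fun x ↦ hf.equiv (α x, 0) := by
    filter_upwards [α.open_source.mem_nhds hqα] with x hx
    have hmem : α x ∈ (α.extend (𝓡 k)).target := by
      rw [OpenPartialHomeomorph.extend_target]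
      exact ⟨by simpa using α.map_source hx, by simp⟩
    have h := hf.writtenInCharts hmem
    have h' : β (f (α.symm (α x))) = hf.equiv (α x, 0) := by simpa using h
    rwa [α.left_inv hx] at h'
  let L : Vec k →L[ℝ] Vec d :=
    (hf.equiv : (Vec k × hf.complement) →L[ℝ] Vec d).comp (ContinuousLinearMap.inl ℝ _ _)
  have hL : Function.Injective L := hf.equiv.injective.comp (Prod.mk_left_injective 0)
  have hLd : MDifferentiableAt (𝓡 k) (𝓡 d) L (α q) := L.differentiableAt.mdifferentiableAt
  have hqd : MDifferentiableAt (𝓡 k) (𝓡 k) α q := hαd.mdifferentiableAt hqα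
  have h1 : mfderiv (𝓡 k) (𝓡 d) (β ∘ f) q
      = (mfderiv (𝓡 d) (𝓡 d) β (f q)).comp (mfderiv (𝓡 k) (𝓡 d) f q) := mfderiv_comp q hβd hfd
  have h2 : mfderiv (𝓡 k) (𝓡 d) (L ∘ α) q
      = (mfderiv (𝓡 k) (𝓡 d) L (α q)).comp (mfderiv (𝓡 k) (𝓡 k) α q) := mfderiv_comp q hLd hqd
  have h3 : ∀ w, (mfderiv (𝓡 k) (𝓡 d) (β ∘ f) q w : Vec d) = mfderiv (𝓡 k) (𝓡 d) (L ∘ α) q w :=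
    fun w ↦ by
      rw [Filter.EventuallyEq.mfderiv_eq (f₁ := β ∘ f) (f := L ∘ α) heq]; rfl
  intro a b hab
  have hab' : mfderiv (𝓡 k) (𝓡 d) (β ∘ f) q a = mfderiv (𝓡 k) (𝓡 d) (β ∘ f) q b := by
    rw [h1]
    exact congrArg (mfderiv (𝓡 d) (𝓡 d) β (f q)) hab
  have h4 : (mfderiv (𝓡 k) (𝓡 d) (L ∘ α) q a : Vec d) = mfderiv (𝓡 k) (𝓡 d) (L ∘ α) q b :=
    (h3 a).symm.trans (hab'.trans (h3 b))
  rw [h2, mfderiv_eq_fderiv, L.fderiv] at h4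
  exact hαd.mfderiv_injective hqα (hL h4)

end Charts

/-! ### Covariant derivatives along submanifolds. -/

section Submanifolds

variable {d k l : ℕ} {N : Type*} [TopologicalSpace N] [ChartedSpace (Vec d) N]
  {P : Type*} [TopologicalSpace P] [ChartedSpace (Vec k) P]
  {M : Type*} [TopologicalSpace M] [ChartedSpace (Vec l) M]

theorem isGeodesicNear_zero_iff {g : BilinField d N} {c : ℝ → N} {p : N} (hc : c 0 = p) :
    IsGeodesicNear g c 0 ↔ ContinuousAt c 0 ∧
      IsCoordGeodesic (coordChristoffel (chartMetric g p)) (fun t ↦ extChartAt (𝓡 d) p (c t)) := by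
  subst hc
  rfl

theorem continuousAt_extChartAt_symm_comp {p : M} {x : ℝ → Vec l}
    (hx0 : x 0 = extChartAt (𝓡 l) p p) (hx : ContinuousAt x 0) :
    ContinuousAt (fun t ↦ (extChartAt (𝓡 l) p).symm (x t)) 0 := by
  refine ContinuousAt.comp (g := (extChartAt (𝓡 l) p).symm) ?_ hx
  rw [hx0]
  exact continuousAt_extChartAt_symm p

/-- Being totally geodesic at a point, in coordinates. -/
theorem isTotallyGeodesicAt_iff {g : BilinField d N} {i : M → N} {p : M} (hi : Continuous i) :
    IsTotallyGeodesicAt l g i p ↔ ∀ x : ℝ → Vec l, x 0 = extChartAt (𝓡 l) p p →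
      IsCoordGeodesic (coordChristoffel (chartMetric (inducedMetric l g i) p)) x →
      IsCoordGeodesic (coordChristoffel (chartMetric g (i p)))
        (fun t ↦ writtenInExtChartAt (𝓡 l) (𝓡 d) p i (x t)) := by
  constructor
  · intro h x hx0 hx
    have hc0 : (extChartAt (𝓡 l) p).symm (x 0) = p := by rw [hx0, extChartAt_to_inv]
    have hcont := continuousAt_extChartAt_symm_comp hx0 hx.1.continuousAt
    have hgeo : IsGeodesicNear (inducedMetric l g i)
        (fun t ↦ (extChartAt (𝓡 l) p).symm (x t)) 0 := by
      refine (isGeodesicNear_zero_iff hc0).2 ⟨hcont, hx.congr ?_⟩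
      have ht : (extChartAt (𝓡 l) p).target ∈ 𝓝 (x 0) := by
        rw [hx0]; exact extChartAt_target_mem_nhds p
      filter_upwards [hx.1.continuousAt.eventually ht] with t ht
      exact (extChartAt (𝓡 l) p).right_inv ht
    exact ((isGeodesicNear_zero_iff (c := i ∘ fun t ↦ (extChartAt (𝓡 l) p).symm (x t))
      (congrArg i hc0)).1 (h _ hc0 hgeo)).2
  · intro h c hc0 hc
    obtain ⟨hcont, hgeo⟩ := (isGeodesicNear_zero_iff hc0).1 hc
    refine (isGeodesicNear_zero_iff (c := i ∘ c) (congrArg i hc0)).2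
      ⟨hi.continuousAt.comp hcont, (h _ (by rw [hc0]) hgeo).congr ?_⟩
    have hs : (extChartAt (𝓡 l) p).source ∈ 𝓝 (c 0) := by
      rw [hc0]; exact extChartAt_source_mem_nhds p
    filter_upwards [hcont.eventually hs] with t ht
    simp only [writtenInExtChartAt, Function.comp_apply, (extChartAt (𝓡 l) p).left_inv ht]

theorem contDiffAt_writtenInExtChartAt [IsManifold (𝓡 d) ∞ N] [IsManifold (𝓡 l) ∞ M] {i : M → N}
    (hi : ContMDiff (𝓡 l) (𝓡 d) ∞ i) (p : M) :
    ContDiffAt ℝ ∞ (writtenInExtChartAt (𝓡 l) (𝓡 d) p i) (extChartAt (𝓡 l) p p) := by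
  obtain ⟨U, hU, hpU, -, hF, -⟩ := exists_isOpen_pullback (0 : BilinField d N) hi p
  exact hF.contDiffAt (hU.mem_nhds hpU)

theorem contDiffOn_bilinearComp {E E' : Type*} [NormedAddCommGroup E] [NormedSpace ℝ E]
    [NormedAddCommGroup E'] [NormedSpace ℝ E'] {B : E' → E →L[ℝ] E →L[ℝ] ℝ} {A : E' → E' →L[ℝ] E}
    {U : Set E'} (hU : IsOpen U) (hB : ContDiffOn ℝ ∞ B U) (hA : ContDiffOn ℝ ∞ A U) :
    ContDiffOn ℝ ∞ (fun z ↦ (B z).bilinearComp (A z) (A z)) U := fun _ hz ↦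
  (contDiffAt_flip ((contDiffAt_flip ((hB.contDiffAt (hU.mem_nhds hz)).clm_comp
    (hA.contDiffAt (hU.mem_nhds hz)))).clm_comp
    (hA.contDiffAt (hU.mem_nhds hz)))).contDiffWithinAt

/-- A smooth map in coordinates, together with the metric that it induces. -/
theorem exists_isOpen_contDiffOn_chartMetric [IsManifold (𝓡 d) ∞ N] [IsManifold (𝓡 l) ∞ M]
    {g : BilinField d N} (hg : IsSmoothField g) {i : M → N} (hi : ContMDiff (𝓡 l) (𝓡 d) ∞ i)
    (p : M) :
    ∃ U : Set (Vec l), IsOpen U ∧ extChartAt (𝓡 l) p p ∈ U ∧ U ⊆ (extChartAt (𝓡 l) p).target ∧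
      ContDiffOn ℝ ∞ (chartMetric (inducedMetric l g i) p) U := by
  obtain ⟨U, hU, hpU, hUt, hF, hFm, hH⟩ := exists_isOpen_pullback g hi p
  refine ⟨U, hU, hpU, hUt, ContDiffOn.congr ?_ hH⟩
  refine contDiffOn_bilinearComp hU ((contDiffOn_chartMetric hg (i p)).comp hF fun _ hz ↦ ?_)
    (hF.fderiv_of_isOpen hU (by simp))
  exact (extChartAt (𝓡 d) (i p)).map_source (hFm hz)

theorem ambientDeriv_eq (g : BilinField d N) {f : P → N} {q : P}
    (hf : MDifferentiableAt (𝓡 k) (𝓡 d) f q) (u v : Vec k) :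
    ambientDeriv k g f q u v
      = fderiv ℝ (fderiv ℝ (writtenInExtChartAt (𝓡 k) (𝓡 d) q f)) (extChartAt (𝓡 k) q q) u v
        + coordChristoffel (chartMetric g (f q)) (extChartAt (𝓡 d) (f q) (f q))
          (differential d k f q u) (differential d k f q v) := by
  rw [differential_eq_fderiv hf]
  rfl

/-- Along a submanifold of a submanifold, the covariant derivative changes by tangent vectors. -/
theorem ambientDeriv_comp [IsManifold (𝓡 d) ∞ N] [IsManifold (𝓡 k) ∞ P] [IsManifold (𝓡 l) ∞ M]
    (g : BilinField d N) {i : M → N} (hi : ContMDiff (𝓡 l) (𝓡 d) ∞ i) {j : P → M}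
    (hj : ContMDiff (𝓡 k) (𝓡 l) ∞ j) (r : P) (u v : Vec k) :
    ambientDeriv k g (i ∘ j) r u v
      = ambientDeriv l g i (j r) (differential l k j r u) (differential l k j r v)
        + differential d l i (j r) (fderiv ℝ (fderiv ℝ (writtenInExtChartAt (𝓡 k) (𝓡 l) r j))
          (extChartAt (𝓡 k) r r) u v) := by
  have hid : MDifferentiableAt (𝓡 l) (𝓡 d) i (j r) := hi.contMDiffAt.mdifferentiableAt (by simp)
  have hjd : MDifferentiableAt (𝓡 k) (𝓡 l) j r := hj.contMDiffAt.mdifferentiableAt (by simp)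
  have hcomp : differential d k (i ∘ j) r = (differential d l i (j r)).comp (differential l k j r) :=
    mfderiv_comp r hid hjd
  rw [ambientDeriv_eq g (hid.comp r hjd), ambientDeriv_eq g hid, hcomp]
  have hF := (contDiffAt_writtenInExtChartAt hi (j r)).of_le (m := 2) (by norm_cast)
  have hf := (contDiffAt_writtenInExtChartAt hj r).of_le (m := 2) (by norm_cast)
  rw [← writtenInExtChartAt_self (k := k) (d := l) j r] at hF
  have heq : writtenInExtChartAt (𝓡 k) (𝓡 d) r (i ∘ j) =ᶠ[𝓝 (extChartAt (𝓡 k) r r)]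
      fun z ↦ writtenInExtChartAt (𝓡 l) (𝓡 d) (j r) i (writtenInExtChartAt (𝓡 k) (𝓡 l) r j z) := by
    obtain ⟨U, hU, hrU, -, -, hm, -⟩ := exists_isOpen_pullback (0 : BilinField l M) hj r
    filter_upwards [hU.mem_nhds hrU] with z hz
    simp only [writtenInExtChartAt, Function.comp_apply, (extChartAt (𝓡 l) (j r)).left_inv (hm hz)]
  rw [heq.fderiv.fderiv_eq, fderiv_fderiv_comp hF hf, writtenInExtChartAt_self (k := k) (d := l),
    differential_eq_fderiv hid, differential_eq_fderiv hjd]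
  simp only [ContinuousLinearMap.comp_apply, Function.comp_apply]
  abel

/-- At a point where the submanifold `M` is totally geodesic, covariant derivatives along `M` are
tangent to `M`: they are the covariant derivatives of `M`. -/
theorem ambientDeriv_of_isTotallyGeodesicAt [IsManifold (𝓡 d) ∞ N] [IsManifold (𝓡 l) ∞ M]
    {g : BilinField d N} (hg : IsSmoothField g) (hgn : ∀ x, IsNondegenerateForm (g.at x))
    {i : M → N} (hi : ContMDiff (𝓡 l) (𝓡 d) ∞ i) (hin : IsNondegenerate l g i) {p : M}
    (hgeo : IsTotallyGeodesicAt l g i p) (u v : Vec l) :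
    ambientDeriv l g i p u v = differential d l i p
      (coordChristoffel (chartMetric (inducedMetric l g i) p) (extChartAt (𝓡 l) p p) u v) := by
  obtain ⟨U, hU, hpU, hUt, hH⟩ := exists_isOpen_contDiffOn_chartMetric hg hi p
  have hid : MDifferentiableAt (𝓡 l) (𝓡 d) i p := hi.contMDiffAt.mdifferentiableAt (by simp)
  have hn : ∀ x, IsNondegenerateForm ((inducedMetric l g i).at x) := fun x ↦
    hin.elim (fun h ↦ h.isNondegenerateForm x) (fun h ↦ h.isNondegenerateForm x)
  have hHn : ∀ z ∈ U, IsNondegenerateForm (chartMetric (inducedMetric l g i) p z) := fun _ hz ↦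
    isNondegenerateForm_chartMetric hn p (hUt hz)
  have ht := extChartAt_target_mem_nhds (I := 𝓡 d) (i p)
  rw [ambientDeriv_eq g hid, differential_eq_fderiv hid,
    ← writtenInExtChartAt_self (k := l) (d := d) i p]
  refine fderiv_fderiv_add_coordChristoffel hU hpU hH (fun z hz ↦ (hHn z hz).isInvertible)
    (fun z hz ↦ (hHn z hz).1) ((contDiffAt_writtenInExtChartAt hi p).of_le (by norm_cast)) ?_ ?_
    ((isTotallyGeodesicAt_iff hi.continuous).1 hgeo) u v
  · rw [writtenInExtChartAt_self (k := l) (d := d) i p]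
    exact ((contDiffOn_chartMetric hg (i p)).contDiffAt ht).differentiableAt (by simp)
  · rw [writtenInExtChartAt_self (k := l) (d := d) i p]
    filter_upwards [ht] with z hz
    exact (isNondegenerateForm_chartMetric hgn (i p) hz).1

end Submanifolds

/-! ### The splitting into tangent and normal vectors. -/

section NormalPart

variable {d k : ℕ} {N : Type*} [TopologicalSpace N] [ChartedSpace (Vec d) N]
  {P : Type*} [TopologicalSpace P] [ChartedSpace (Vec k) P] {g : BilinField d N} {f : P → N} {q : P}

theorem inducedMetric_at (u v : Vec k) : (inducedMetric k g f).at q u v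
    = g.at (f q) (differential d k f q u) (differential d k f q v) := rfl

theorem mem_normalAt {w : Vec d} :
    w ∈ normalAt k g f q ↔ ∀ u, g.at (f q) w (differential d k f q u) = 0 :=
  ⟨fun h u ↦ h _ ⟨u, rfl⟩, fun h _ ⟨u, hu⟩ ↦ hu ▸ h u⟩

theorem differential_mem_tangentAt (u : Vec k) : differential d k f q u ∈ tangentAt d k f q :=
  ⟨u, rfl⟩

/-- The normal and the tangent space of a nondegenerate submanifold are complementary. -/
theorem exists_normal_add_tangent (hn : IsNondegenerateForm ((inducedMetric k g f).at q))
    (a : Vec d) : ∃ w ∈ normalAt k g f q, a - w ∈ tangentAt d k f q := by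
  obtain ⟨A, hA⟩ := hn.isInvertible
  -- The tangential part of `a` is the vector that represents this functional with respect to the
  -- nondegenerate induced metric.
  let φ : Vec k →L[ℝ] ℝ := (g.at (f q) a).comp (differential d k f q)
  refine ⟨a - differential d k f q (A.symm φ), mem_normalAt.2 fun u ↦ ?_, ?_⟩
  · have h : (inducedMetric k g f).at q (A.symm φ) u = φ u := by
      rw [← hA]
      exact congrArg (fun ψ : Vec k →L[ℝ] ℝ ↦ ψ u) (A.apply_symm_apply φ)
    rw [map_sub, sub_apply, ← inducedMetric_at, h, sub_eq_zero]
    rfl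
  · rw [sub_sub_cancel]
    exact differential_mem_tangentAt _

theorem eq_zero_of_normal_of_tangent (hn : IsNondegenerateForm ((inducedMetric k g f).at q))
    {a : Vec d} (h : a ∈ normalAt k g f q) (h' : a ∈ tangentAt d k f q) : a = 0 := by
  obtain ⟨u, rfl⟩ := h'
  rw [mem_normalAt] at h
  have : u = 0 := hn.2 u h
  rw [this]
  exact map_zero _

theorem normalPart_mem (hn : IsNondegenerateForm ((inducedMetric k g f).at q)) (a : Vec d) :
    normalPart k g f q a ∈ normalAt k g f q ∧ a - normalPart k g f q a ∈ tangentAt d k f q := by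
  have h := exists_normal_add_tangent hn a
  rw [normalPart, dif_pos h]
  exact h.choose_spec

theorem normalPart_eq (hn : IsNondegenerateForm ((inducedMetric k g f).at q)) {a w : Vec d}
    (hw : w ∈ normalAt k g f q) (ha : a - w ∈ tangentAt d k f q) : normalPart k g f q a = w := by
  obtain ⟨h1, h2⟩ := normalPart_mem hn a
  refine sub_eq_zero.1 (eq_zero_of_normal_of_tangent hn (sub_mem h1 hw) ?_)
  have := sub_mem ha h2
  rwa [sub_sub_sub_cancel_left] at this

end NormalPart

/-! ### Umbilic points in `M` and in the ambient manifold. -/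

section FirstPart

variable {d k l s : ℕ} {N : Type*} [TopologicalSpace N] [ChartedSpace (Vec d) N]
  {M : Type*} [TopologicalSpace M] [ChartedSpace (Vec l) M]
  {S : Type*} [TopologicalSpace S] [ChartedSpace (Vec s) S]

/-- A point of a submanifold of `M` is umbilic in the ambient manifold if and only if it is umbilic
in `M`, provided that `M` is totally geodesic there. -/
theorem isUmbilicAt_comp_iff (hs : 0 < s) [IsManifold (𝓡 d) ∞ N] [IsManifold (𝓡 l) ∞ M]
    [IsManifold (𝓡 s) ∞ S] {g : BilinField d N} (hg : IsSmoothField g)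
    (hgn : ∀ x, IsNondegenerateForm (g.at x)) {i : M → N} (hi : ContMDiff (𝓡 l) (𝓡 d) ∞ i)
    (hin : IsNondegenerate l g i) {j : S → M} (hj : ContMDiff (𝓡 s) (𝓡 l) ∞ j) {r : S}
    (hgeo : IsTotallyGeodesicAt l g i (j r))
    (hpos : ∀ u, u ≠ 0 → 0 < (inducedMetric s g (i ∘ j)).at r u u) :
    IsUmbilicAt s g (i ∘ j) r ↔ IsUmbilicAt s (inducedMetric l g i) j r := by
  have hid : MDifferentiableAt (𝓡 l) (𝓡 d) i (j r) := hi.contMDiffAt.mdifferentiableAt (by simp)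
  have hjd : MDifferentiableAt (𝓡 s) (𝓡 l) j r := hj.contMDiffAt.mdifferentiableAt (by simp)
  have hcomp : ∀ u, differential d s (i ∘ j) r u
      = differential d l i (j r) (differential l s j r u) := fun u ↦
    congrArg (fun A : Vec s →L[ℝ] Vec d ↦ A u) (mfderiv_comp r hid hjd)
  have hmet : (inducedMetric s g (i ∘ j)).at r
      = (inducedMetric s (inducedMetric l g i) j).at r := by
    ext u v
    rw [inducedMetric_at, inducedMetric_at, inducedMetric_at, hcomp, hcomp]
    rfl
  have hn : IsNondegenerateForm ((inducedMetric s g (i ∘ j)).at r) := .of_pos (fun u v ↦ (hgn _).1 _ _) hpos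
  have hn' : IsNondegenerateForm ((inducedMetric s (inducedMetric l g i) j).at r) := hmet ▸ hn
  set D := differential d l i (j r) with hD
  have hnormal : ∀ w, D w ∈ normalAt s g (i ∘ j) r ↔ w ∈ normalAt s (inducedMetric l g i) j r := by
    intro w
    rw [mem_normalAt, mem_normalAt]
    refine forall_congr' fun u ↦ ?_
    rw [hcomp]
    rfl
  let a : Vec s → Vec s → Vec l := fun u v ↦ ambientDeriv s (inducedMetric l g i) j r u v
  -- Here total geodesy enters: the derivative along `M` has no component normal to `M`.
  have hamb : ∀ u v, ambientDeriv s g (i ∘ j) r u v = D (a u v) := by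
    intro u v
    rw [ambientDeriv_comp g hi hj, ambientDeriv_of_isTotallyGeodesicAt hg hgn hi hin hgeo,
      ← map_add]
    congr 1
    rw [add_comm]
    exact (ambientDeriv_eq (inducedMetric l g i) hjd u v).symm
  have hpart : ∀ b, normalPart s g (i ∘ j) r (D b) = D (normalPart s (inducedMetric l g i) j r b) := by
    intro b
    obtain ⟨h1, u, hu⟩ := normalPart_mem hn' b
    refine normalPart_eq hn ((hnormal _).2 h1) ⟨u, ?_⟩
    rw [← map_sub, ← hu]
    exact hcomp u
  have hsff : ∀ u v, secondFundamentalForm s g (i ∘ j) r u v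
      = D (secondFundamentalForm s (inducedMetric l g i) j r u v) := fun u v ↦ by
    rw [secondFundamentalForm, hamb, hpart]
    rfl
  have hDinj : Function.Injective D := by
    rw [injective_iff_map_eq_zero]
    intro u hu
    have hnM : IsNondegenerateForm ((inducedMetric l g i).at (j r)) :=
      hin.elim (fun h ↦ h.isNondegenerateForm _) (fun h ↦ h.isNondegenerateForm _)
    refine hnM.2 u fun v ↦ ?_
    rw [inducedMetric_at, ← hD, hu, map_zero, zero_apply]
  constructor
  · rintro ⟨H, hH, h⟩
    -- The given `H` must be shown to lie in the image of `D`. For a vector `u ≠ 0`, which exists as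
    -- `s > 0`, it is a multiple of the second fundamental form at `(u, u)`, which lies there.
    have : Nonempty (Fin s) := ⟨⟨0, hs⟩⟩
    obtain ⟨u, hu⟩ := exists_ne (0 : Vec s)
    have hc := (hpos u hu).ne'
    set c := (inducedMetric s g (i ∘ j)).at r u u with hcdef
    set K := c⁻¹ • secondFundamentalForm s (inducedMetric l g i) j r u u with hK
    have hHK : H = D K := by
      rw [hK, map_smul, ← hsff, h, smul_smul, inv_mul_cancel₀ hc, one_smul]
    refine ⟨K, (hnormal K).1 (hHK ▸ hH), fun v w ↦ hDinj ?_⟩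
    rw [← hsff, h, map_smul, ← hHK, hmet]
  · rintro ⟨H, hH, h⟩
    refine ⟨D H, (hnormal H).2 hH, fun v w ↦ ?_⟩
    rw [hsff, h, map_smul, hmet]

end FirstPart

/-! ### Riemannian and Lorentzian forms. -/

section Forms

variable {E : Type*} [NormedAddCommGroup E] [NormedSpace ℝ E]

/-- In a Lorentzian vector space the form is positive definite on the orthogonal complement of any
timelike vector. -/
theorem pos_of_orthogonal_timelike {B : E →L[ℝ] E →L[ℝ] ℝ} (hs : ∀ u v, B u v = B v u) {t : E}
    (ht : ∀ u, u ≠ 0 → B t u = 0 → 0 < B u u) {t' : E} (ht' : B t' t' < 0) {u : E} (hu : u ≠ 0)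
    (htu : B t' u = 0) : 0 < B u u := by
  by_contra hneg
  rw [not_lt] at hneg
  -- This combination is orthogonal to `t`. If it is nonzero, its square length is positive; but if
  -- `B u u ≤ 0`, the expansion, which has no mixed term, is nonpositive. If it vanishes, pairing
  -- with `t'` gives `B t u = 0`.
  by_cases hw : B t u • t' - B t t' • u = 0
  · have h : B t' (B t u • t' - B t t' • u) = 0 := by rw [hw, map_zero]
    rw [map_sub, map_smul, map_smul, htu, smul_zero, sub_zero, smul_eq_mul] at h
    exact hneg.not_gt (ht u hu ((mul_eq_zero.1 h).resolve_right ht'.ne))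
  · have h := ht _ hw (by
      rw [map_sub, map_smul, map_smul, smul_eq_mul, smul_eq_mul, mul_comm, sub_self])
    have hexp : B (B t u • t' - B t t' • u) (B t u • t' - B t t' • u)
        = B t u ^ 2 * B t' t' + B t t' ^ 2 * B u u := by
      simp only [map_sub, map_smul, sub_apply, smul_apply, smul_eq_mul, hs u t', htu]
      ring
    rw [hexp] at h
    nlinarith [sq_nonneg (B t u), sq_nonneg (B t t')]

/-- Positive definiteness on the orthogonal complement of a fixed vector is an open condition. -/
theorem eventually_pos_of_orthogonal [FiniteDimensional ℝ E] {B₀ : E →L[ℝ] E →L[ℝ] ℝ} {t : E}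
    (h : ∀ u, u ≠ 0 → B₀ t u = 0 → 0 < B₀ u u) :
    ∀ᶠ B in 𝓝 B₀, ∀ u, u ≠ 0 → B t u = 0 → 0 < B u u := by
  have : ProperSpace E := FiniteDimensional.proper ℝ E
  have key : ∀ᶠ B in 𝓝 B₀, ∀ u ∈ Metric.sphere (0 : E) 1, B t u = 0 → 0 < B u u := by
    -- By compactness a neighbourhood of each unit vector suffices: there either `B t u ≠ 0` or `B u
    -- u > 0` persists.
    refine (isCompact_sphere 0 1).eventually_forall_of_forall_eventually fun u hu ↦ ?_
    have hu0 : u ≠ 0 := by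
      rintro rfl
      simp at hu
    have hc1 : Continuous fun z : (E →L[ℝ] E →L[ℝ] ℝ) × E ↦ z.1 t z.2 := by fun_prop
    have hc2 : Continuous fun z : (E →L[ℝ] E →L[ℝ] ℝ) × E ↦ z.1 z.2 z.2 := by fun_prop
    by_cases h0 : B₀ t u = 0
    · have := (hc2.continuousAt (x := (B₀, u))).eventually_const_lt (u := 0) (h u hu0 h0)
      exact this.mono fun _ hz _ ↦ hz
    · have := (hc1.continuousAt (x := (B₀, u))).eventually_ne (y := 0) h0
      exact this.mono fun _ hz hz' ↦ absurd hz' hz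
  filter_upwards [key] with B hB u hu htu
  have hn : ‖u‖ ≠ 0 := norm_ne_zero_iff.2 hu
  have h1 := hB (‖u‖⁻¹ • u) (by simp [norm_smul, hn]) (by rw [map_smul, htu, smul_zero])
  rw [map_smul, map_smul, smul_apply, smul_eq_mul, smul_eq_mul, ← mul_assoc] at h1
  exact (pos_iff_pos_of_mul_pos h1).1 (by positivity)

/-- The form is positive definite or of signature `(-, +, …, +)`. -/
def IsRiemannianOrLorentzian (ε : Bool) (B : E →L[ℝ] E →L[ℝ] ℝ) : Prop :=
  (∀ u v, B u v = B v u) ∧ ∃ t, (ε = true ∧ t = 0 ∨ ε = false ∧ B t t < 0) ∧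
    ∀ u, u ≠ 0 → B t u = 0 → 0 < B u u

theorem IsRiemannianOrLorentzian.eventually [FiniteDimensional ℝ E] {ε : Bool}
    {B₀ : E →L[ℝ] E →L[ℝ] ℝ} (h : IsRiemannianOrLorentzian ε B₀) :
    ∀ᶠ B in 𝓝 B₀, (∀ u v, B u v = B v u) → IsRiemannianOrLorentzian ε B := by
  -- In the Riemannian case `t = 0` and its orthogonal complement is the whole space, so one
  -- argument serves both signatures.
  obtain ⟨-, t, ht, hpos⟩ := h
  have h1 : ∀ᶠ B : E →L[ℝ] E →L[ℝ] ℝ in 𝓝 B₀, (ε = true ∧ t = 0 ∨ ε = false ∧ B t t < 0) := by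
    rcases ht with ht | ht
    · exact Filter.Eventually.of_forall fun _ ↦ Or.inl ht
    · have hc : Continuous fun B : E →L[ℝ] E →L[ℝ] ℝ ↦ B t t := by fun_prop
      exact (hc.continuousAt.eventually (gt_mem_nhds ht.2)).mono fun B hB ↦ Or.inr ⟨ht.1, hB⟩
  filter_upwards [h1, eventually_pos_of_orthogonal hpos] with B hB hB' hs
  exact ⟨hs, t, hB, hB'⟩

theorem IsRiemannianOrLorentzian.pullback {E' : Type*} [NormedAddCommGroup E'] [NormedSpace ℝ E']
    {ε : Bool} {B : E →L[ℝ] E →L[ℝ] ℝ} (h : IsRiemannianOrLorentzian ε B) (A : E' ≃L[ℝ] E) :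
    IsRiemannianOrLorentzian ε (B.bilinearComp (A : E' →L[ℝ] E) (A : E' →L[ℝ] E)) := by
  obtain ⟨hs, t, ht, hpos⟩ := h
  refine ⟨fun u v ↦ hs _ _, A.symm t, ?_, fun u hu htu ↦ hpos _ (by simpa using hu) ?_⟩
  · simpa using ht
  · simpa using htu

end Forms

/-! ### Linear pieces in charts as embedded submanifolds. -/

section Embedding

variable {d k : ℕ} {N : Type*} [TopologicalSpace N] [ChartedSpace (Vec d) N]

/-- A diffeomorphism from `ℝᵏ` onto the ball of radius `δ` around `0`. -/
abbrev toBall (k : ℕ) (δ : ℝ) : OpenPartialHomeomorph (Vec k) (Vec k) :=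
  OpenPartialHomeomorph.univBall 0 δ

theorem toBall_mem {δ : ℝ} (hδ : 0 < δ) (z : Vec k) : toBall k δ z ∈ Metric.ball (0 : Vec k) δ := by
  rw [← OpenPartialHomeomorph.univBall_target 0 hδ]
  exact (toBall k δ).map_source (by simp)

theorem toBall_zero (δ : ℝ) : toBall k δ 0 = 0 := OpenPartialHomeomorph.univBall_apply_zero 0 δ

theorem toBall_symm_apply {δ : ℝ} (z : Vec k) : (toBall k δ).symm (toBall k δ z) = z :=
  (toBall k δ).left_inv (by simp)

theorem toBall_apply_symm {δ : ℝ} (hδ : 0 < δ) {z : Vec k} (hz : z ∈ Metric.ball (0 : Vec k) δ) :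
    toBall k δ ((toBall k δ).symm z) = z :=
  (toBall k δ).right_inv (by rwa [OpenPartialHomeomorph.univBall_target 0 hδ])

theorem contDiff_toBall (δ : ℝ) : ContDiff ℝ ∞ (toBall k δ) := OpenPartialHomeomorph.contDiff_univBall

theorem contDiffAt_toBall_symm {δ : ℝ} {z : Vec k} (hz : z ∈ Metric.ball (0 : Vec k) δ) :
    ContDiffAt ℝ ∞ (toBall k δ).symm z :=
  OpenPartialHomeomorph.contDiffOn_univBall_symm.contDiffAt (Metric.isOpen_ball.mem_nhds hz)

/-- Differentiating the two identities between the map and its inverse makes their derivatives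
mutually inverse. -/
theorem exists_hasFDerivAt_toBall {δ : ℝ} (hδ : 0 < δ) (z : Vec k) :
    ∃ A : Vec k ≃L[ℝ] Vec k, HasFDerivAt (toBall k δ) (A : Vec k →L[ℝ] Vec k) z ∧
      HasFDerivAt (toBall k δ).symm (A.symm : Vec k →L[ℝ] Vec k) (toBall k δ z) := by
  have h1 : HasFDerivAt (toBall k δ) _ z :=
    ((contDiff_toBall δ).differentiable (by simp)).differentiableAt.hasFDerivAt
  have h2 : HasFDerivAt (toBall k δ).symm _ (toBall k δ z) :=
    ((contDiffAt_toBall_symm (toBall_mem hδ z)).differentiableAt (by simp)).hasFDerivAt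
  have h3 : (fderiv ℝ (toBall k δ).symm (toBall k δ z)).comp (fderiv ℝ (toBall k δ) z)
      = ContinuousLinearMap.id ℝ _ := by
    refine (h2.comp z h1).unique ((hasFDerivAt_id z).congr_of_eventuallyEq ?_)
    exact Filter.Eventually.of_forall fun y ↦ toBall_symm_apply y
  have h2' : HasFDerivAt (toBall k δ).symm (fderiv ℝ (toBall k δ).symm (toBall k δ z))
    (toBall k δ z) := h2
  have h1' : HasFDerivAt (toBall k δ) (fderiv ℝ (toBall k δ) z)
      ((toBall k δ).symm (toBall k δ z)) := by rwa [toBall_symm_apply]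
  have h4 : (fderiv ℝ (toBall k δ) z).comp (fderiv ℝ (toBall k δ).symm (toBall k δ z))
      = ContinuousLinearMap.id ℝ _ := by
    refine (h1'.comp _ h2').unique ((hasFDerivAt_id _).congr_of_eventuallyEq ?_)
    filter_upwards [Metric.isOpen_ball.mem_nhds (toBall_mem hδ z)] with y hy
    exact toBall_apply_symm hδ hy
  refine ⟨ContinuousLinearEquiv.equivOfInverse _ _ (fun x ↦ ?_) (fun x ↦ ?_), h1, h2⟩
  · exact congrArg (fun T : Vec k →L[ℝ] Vec k ↦ T x) h3
  · exact congrArg (fun T : Vec k →L[ℝ] Vec k ↦ T x) h4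

/-- A piece of a linear subspace in a chart is an embedded submanifold. -/
theorem isSmoothEmbedding_linear_in_chart [IsManifold (𝓡 d) ∞ N]
    {χ : OpenPartialHomeomorph N (Vec d)} (hχ : χ ∈ IsManifold.maximalAtlas (𝓡 d) ∞ N)
    {L : Vec k →L[ℝ] Vec d} (hL : Function.Injective L) {δ : ℝ} (hδ : 0 < δ)
    (hLχ : ∀ x ∈ Metric.ball (0 : Vec k) δ, L x ∈ χ.target) :
    IsSmoothEmbedding (𝓡 k) (𝓡 d) ∞ (fun z ↦ χ.symm (L (toBall k δ z))) := by
  have hmem : ∀ z, L (toBall k δ z) ∈ χ.target := fun z ↦ hLχ _ (toBall_mem hδ z)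
  refine ⟨?_, ?_⟩
  -- A complement of the range of `L` turns `L` into `y ↦ e (y, 0)`, the normal form of an immersion
  -- in the charts `toBall k δ` and `χ`.
  · obtain ⟨W, hW⟩ := Submodule.exists_isCompl (LinearMap.range (L : Vec k →ₗ[ℝ] Vec d))
    let e : (Vec k × W) ≃ₗ[ℝ] Vec d :=
      ((LinearEquiv.ofInjective (L : Vec k →ₗ[ℝ] Vec d) hL).prodCongr (LinearEquiv.refl ℝ W)).trans
        (Submodule.prodEquivOfIsCompl _ _ hW)
    have he : ∀ y, e (y, 0) = L y := fun y ↦ by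
      simp [e]
    refine ⟨W, inferInstance, inferInstance, fun z ↦ ?_⟩
    refine IsImmersionAtOfComplement.mk_of_charts e.toContinuousLinearEquiv (toBall k δ) χ (by simp)
      (χ.map_target (hmem z)) ?_ hχ (fun y _ ↦ χ.map_target (hmem y)) ?_
    · refine OpenPartialHomeomorph.mem_maximalAtlas_of_contMDiffOn (I := 𝓡 k) (n := ∞)
        (φ := toBall k δ) ?_ ?_
      · exact (contDiff_toBall δ).contMDiff.contMDiffOn
      · rw [OpenPartialHomeomorph.univBall_target 0 hδ]
        exact OpenPartialHomeomorph.contDiffOn_univBall_symm.contMDiffOn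
    · intro y hy
      have hy' : y ∈ Metric.ball (0 : Vec k) δ := by
        rw [← OpenPartialHomeomorph.univBall_target 0 hδ]
        simpa using hy
      have h1 : toBall k δ ((toBall k δ).symm y) = y := toBall_apply_symm hδ hy'
      have h2 : χ (χ.symm (L y)) = L y := χ.right_inv (hLχ y hy')
      simp only [Function.comp_apply, OpenPartialHomeomorph.extend_coe,
        OpenPartialHomeomorph.extend_coe_symm, modelWithCornersSelf_coe,
        modelWithCornersSelf_coe_symm, id]
      rw [h1, h2]
      exact (he y).symm
  · have h1 : IsEmbedding (toBall k δ) :=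
      ((toBall k δ).isOpenEmbedding (by simp)).isEmbedding
    have h2 : IsEmbedding L :=
      (LinearMap.isClosedEmbedding_of_injective (f := (L : Vec k →ₗ[ℝ] Vec d))
        (LinearMap.ker_eq_bot.2 hL)).isEmbedding
    have h3 : IsEmbedding (χ.target.codRestrict (fun z ↦ L (toBall k δ z)) hmem) :=
      (h2.comp h1).codRestrict _ _
    exact χ.symm.isOpenEmbedding_restrict.isEmbedding.comp h3

end Embedding

/-! ### Normal coordinates. -/

section NormalChart

variable {d : ℕ} {N : Type*} [TopologicalSpace N] [ChartedSpace (Vec d) N]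

/-- `χ` is a system of normal coordinates at `p`: the straight lines through the origin
are geodesics, and the differential at the origin is the identity with respect to the preferred
chart. -/
structure IsNormalChart [IsManifold (𝓡 d) ∞ N] (g : BilinField d N) (p : N)
    (χ : OpenPartialHomeomorph N (Vec d)) : Prop where
  mem_maximalAtlas : χ ∈ IsManifold.maximalAtlas (𝓡 d) ∞ N
  mem_source : p ∈ χ.source
  apply_self : χ p = 0
  source_subset : χ.source ⊆ (extChartAt (𝓡 d) p).source
  contDiffOn : ContDiffOn ℝ ∞ (fun w ↦ extChartAt (𝓡 d) p (χ.symm w)) χ.target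
  hasFDerivAt : HasFDerivAt (fun w ↦ extChartAt (𝓡 d) p (χ.symm w)) (ContinuousLinearMap.id ℝ _) 0
  isCoordGeodesic : ∀ w, IsCoordGeodesic (coordChristoffel (chartMetric g p))
    (fun t ↦ extChartAt (𝓡 d) p (χ.symm (t • w)))

/-- The exponential map has the identity as its derivative at the origin, so it has a local inverse;
`χ` is the preferred chart followed by this inverse. -/
theorem exists_isNormalChart [IsManifold (𝓡 d) ∞ N] {g : BilinField d N} (hg : IsSmoothField g)
    (hgn : ∀ x, IsNondegenerateForm (g.at x)) (p : N) :
    ∃ χ : OpenPartialHomeomorph N (Vec d), IsNormalChart g p χ := by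
  obtain ⟨e, he, he0, hed, hgeo⟩ := exists_exponential (isOpen_extChartAt_target (I := 𝓡 d) p)
    (mem_extChartAt_target p) (contDiffOn_chartMetric hg p)
    fun y hy ↦ (isNondegenerateForm_chartMetric hgn p hy).isInvertible
  obtain ⟨Θ, h0, -, hΘt, hΘe, hΘs⟩ := exists_openPartialHomeomorph isOpen_univ (Set.mem_univ 0)
    he.contDiffOn (A := ContinuousLinearEquiv.refl ℝ (Vec d)) hed
    (isOpen_extChartAt_target (I := 𝓡 d) p) (by rw [he0]; exact mem_extChartAt_target p)
  have hct : (extChartAt (𝓡 d) p).target = (chartAt (Vec d) p).target := by simp [mfld_simps]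
  rw [hct] at hΘt
  have hcc : ∀ x, extChartAt (𝓡 d) p x = chartAt (Vec d) p x := fun x ↦ by simp [mfld_simps]
  rw [hcc] at he0
  let χ := (chartAt (Vec d) p).trans Θ.symm
  have hχt : χ.target = Θ.source := by
    ext w
    simp only [χ, OpenPartialHomeomorph.trans_target, OpenPartialHomeomorph.symm_target,
      OpenPartialHomeomorph.symm_symm, Set.mem_inter_iff, Set.mem_preimage]
    exact ⟨fun h ↦ h.1, fun h ↦ ⟨h, hΘt (Θ.map_source h)⟩⟩
  have hχe : ∀ w ∈ Θ.source, extChartAt (𝓡 d) p (χ.symm w) = e w := fun w hw ↦ by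
    rw [hcc, ← hΘe]
    exact (chartAt (Vec d) p).right_inv (hΘt (Θ.map_source hw))
  have hev : (fun w ↦ extChartAt (𝓡 d) p (χ.symm w)) =ᶠ[𝓝 0] e :=
    Filter.eventuallyEq_of_mem (Θ.open_source.mem_nhds h0) hχe
  refine ⟨χ, ?_, ?_, ?_, ?_, ?_, ?_, fun w ↦ ?_⟩
  · refine OpenPartialHomeomorph.mem_maximalAtlas_of_contMDiffOn (I := 𝓡 d) (n := ∞) (φ := χ) ?_ ?_
    · have h1 := contMDiffOn_chart (I := 𝓡 d) (n := ∞) (x := p)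
      exact hΘs.contMDiffOn.comp (h1.mono fun x hx ↦ hx.1) fun x hx ↦ hx.2
    · have h1 := contMDiffOn_chart_symm (I := 𝓡 d) (n := ∞) (x := p)
      rw [hχt]
      exact h1.comp (he.contDiffOn.congr fun x _ ↦ hΘe x).contMDiffOn
        fun x hx ↦ hΘt (Θ.map_source hx)
  · refine ⟨mem_chart_source _ p, ?_⟩
    change chartAt (Vec d) p p ∈ Θ.target
    rw [← he0, ← hΘe]
    exact Θ.map_source h0
  · change Θ.symm (chartAt (Vec d) p p) = 0
    rw [← he0, ← hΘe, Θ.left_inv h0]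
  · rw [extChartAt_source]
    exact fun x hx ↦ hx.1
  · rw [hχt]
    exact he.contDiffOn.congr hχe
  · exact hed.congr_of_eventuallyEq hev
  · refine (hgeo w).congr ?_
    have hc : Filter.Tendsto (fun t : ℝ ↦ t • w) (𝓝 0) (𝓝 0) :=
      Continuous.tendsto' (by fun_prop) _ _ (zero_smul ℝ w)
    exact hc.eventually hev

end NormalChart

/-! ### Exponential images of linear subspaces. -/

section Pieces

variable {d l : ℕ} {N : Type*} [TopologicalSpace N] [ChartedSpace (Vec d) N]

theorem chartMetric_vec (h : BilinField l (Vec l)) (p y : Vec l) : chartMetric h p y = h.at y := by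
  have h1 : chartFrame p y = ContinuousLinearMap.id ℝ (Vec l) := by
    have : ((extChartAt (𝓡 l) p).symm : Vec l → Vec l) = id := rfl
    rw [chartFrame, this]
    exact mfderiv_id
  ext u v
  rw [chartMetric_apply, h1]
  rfl

theorem differential_extChartAt_symm_comp [IsManifold (𝓡 d) ∞ N] {p : N} {F : Vec l → Vec d}
    {z : Vec l} (hF : DifferentiableAt ℝ F z) (hz : F z ∈ (extChartAt (𝓡 d) p).target) :
    differential d l (fun z ↦ (extChartAt (𝓡 d) p).symm (F z)) z
      = (chartFrame p (F z)).comp (fderiv ℝ F z) := by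
  have : IsManifold (𝓡 d) 1 N := IsManifold.of_le (n := ∞) (by norm_cast)
  have h1 : MDifferentiableAt 𝓘(ℝ, Vec d) (𝓡 d) (extChartAt (𝓡 d) p).symm (F z) :=
    (((contMDiffOn_extChartAt_symm (I := 𝓡 d) (n := ∞) p) _ hz).contMDiffAt
      ((isOpen_extChartAt_target _).mem_nhds hz)).mdifferentiableAt (by simp)
  have h2 := mfderiv_comp z h1 hF.mdifferentiableAt
  rw [mfderiv_eq_fderiv] at h2
  exact h2

theorem inducedMetric_extChartAt_symm_comp [IsManifold (𝓡 d) ∞ N] (g : BilinField d N) {p : N}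
    {F : Vec l → Vec d} {z : Vec l} (hF : DifferentiableAt ℝ F z)
    (hz : F z ∈ (extChartAt (𝓡 d) p).target) :
    (inducedMetric l g (fun z ↦ (extChartAt (𝓡 d) p).symm (F z))).at z
      = (chartMetric g p (F z)).bilinearComp (fderiv ℝ F z) (fderiv ℝ F z) := by
  ext u v
  rw [inducedMetric_at, differential_extChartAt_symm_comp hF hz]
  rfl

/-- A submanifold, parametrized in the preferred chart of the ambient manifold, is totally geodesic
at a point if it contains a geodesic in every direction. -/
theorem isTotallyGeodesicAt_extChartAt_symm_comp [IsManifold (𝓡 d) ∞ N] {g : BilinField d N}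
    (hg : IsSmoothField g) (hgn : ∀ x, IsNondegenerateForm (g.at x)) {p : N} {F : Vec l → Vec d}
    (hF : ContDiff ℝ ∞ F) (hFt : ∀ z, F z ∈ (extChartAt (𝓡 d) p).target)
    (h0 : F 0 = extChartAt (𝓡 d) p p)
    (hin : IsNondegenerate l g (fun z ↦ (extChartAt (𝓡 d) p).symm (F z)))
    (hrad : ∀ v, ∃ x : ℝ → Vec l, x 0 = 0 ∧ deriv x 0 = v ∧ ContDiffAt ℝ 2 x 0 ∧
      IsCoordGeodesic (coordChristoffel (chartMetric g p)) (fun t ↦ F (x t))) :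
    IsTotallyGeodesicAt l g (fun z ↦ (extChartAt (𝓡 d) p).symm (F z)) 0 := by
  intro c hc0 hc
  set i : Vec l → N := fun z ↦ (extChartAt (𝓡 d) p).symm (F z) with hi
  have hi0 : i 0 = p := by rw [hi]; simp only [h0, extChartAt_to_inv]
  have hto := isOpen_extChartAt_target (I := 𝓡 d) p
  have hFc : Continuous F := hF.continuous
  have hFd : Differentiable ℝ F := hF.differentiable (by simp)
  have hic : Continuous i :=
    (continuousOn_extChartAt_symm p).comp_continuous hFc hFt
  obtain ⟨hcc, hcg⟩ := (isGeodesicNear_zero_iff hc0).1 hc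
  have hG := contDiffOn_chartMetric hg p
  have hH : ∀ z, chartMetric (inducedMetric l g i) (0 : Vec l) z
      = (chartMetric g p (F z)).bilinearComp (fderiv ℝ F z) (fderiv ℝ F z) := fun z ↦ by
    rw [chartMetric_vec]
    exact inducedMetric_extChartAt_symm_comp g (hFd z) (hFt z)
  have hn : ∀ x, IsNondegenerateForm ((inducedMetric l g i).at x) := fun x ↦
    hin.elim (fun h ↦ h.isNondegenerateForm x) (fun h ↦ h.isNondegenerateForm x)
  have hHs : ContDiffOn ℝ ∞ (chartMetric (inducedMetric l g i) (0 : Vec l)) Set.univ :=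
    (contDiffOn_bilinearComp isOpen_univ (hG.comp hF.contDiffOn fun z _ ↦ hFt z)
      (hF.contDiffOn.fderiv_of_isOpen isOpen_univ (by simp))).congr fun z _ ↦ hH z
  refine (isGeodesicNear_zero_iff (c := i ∘ c) (p := p) (by simp [hc0, hi0])).2
    ⟨hic.continuousAt.comp hcc, ?_⟩
  refine (isCoordGeodesic_comp (y := 0) (hF.contDiffAt.of_le (by norm_cast))
    (.of_forall fun z ↦ ⟨?_, (isNondegenerateForm_chartMetric hgn p (hFt z)).1,
      (isNondegenerateForm_chartMetric hgn p (hFt z)).isInvertible⟩)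
    (.of_forall hH) (hHs.contDiffAt Filter.univ_mem) (.of_forall fun z ↦ ?_) hrad
    (c := c) hc0 hcg).congr (.of_forall fun t ↦ ?_)
  · exact (hG.contDiffAt (hto.mem_nhds (hFt z))).differentiableAt (by simp)
  · rw [chartMetric_vec]
    exact (hn z).isInvertible
  · exact (extChartAt (𝓡 d) p).right_inv (hFt _)

/-- The image of a small ball of a linear subspace under the exponential map. -/
abbrev linearPiece (χ : OpenPartialHomeomorph N (Vec d)) (L : Vec l →L[ℝ] Vec d) (δ : ℝ) :
    Vec l → N := fun z ↦ χ.symm (L (toBall l δ z))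

/-- Straight lines through the origin of the subspace are ambient geodesics, which makes the piece
totally geodesic at its centre. The signature of the induced metric is an open condition, so it
persists from the centre to a small ball. -/
theorem IsNormalChart.exists_linearPiece [IsManifold (𝓡 d) ∞ N] {g : BilinField d N}
    (hg : IsSmoothField g) (hgn : ∀ x, IsNondegenerateForm (g.at x)) {p : N}
    {χ : OpenPartialHomeomorph N (Vec d)} (hχ : IsNormalChart g p χ) (L : Vec l →L[ℝ] Vec d)
    {ε : Bool} (hB : IsRiemannianOrLorentzian ε ((g.at p).bilinearComp L L)) :
    ∃ δ > 0, (∀ x ∈ Metric.ball (0 : Vec l) δ, L x ∈ χ.target) ∧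
      linearPiece χ L δ 0 = p ∧
      IsNondegenerate l g (linearPiece χ L δ) ∧ IsTotallyGeodesicAt l g (linearPiece χ L δ) 0 ∧
      tangentAt d l (linearPiece χ L δ) 0 = LinearMap.range (L : Vec l →ₗ[ℝ] Vec d) := by
  set ψ := extChartAt (𝓡 d) p with hψ
  let e : Vec d → Vec d := fun w ↦ ψ (χ.symm w)
  have hct : ContDiffOn ℝ ∞ e χ.target := hχ.contDiffOn
  have h0t : (0 : Vec d) ∈ χ.target := by
    rw [← hχ.apply_self]; exact χ.map_source hχ.mem_source
  have hχ0 : χ.symm 0 = p := by rw [← hχ.apply_self, χ.left_inv hχ.mem_source]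
  have het : ∀ w ∈ χ.target, e w ∈ ψ.target := fun w hw ↦
    ψ.map_source (hχ.source_subset (χ.map_target hw))
  have hψe : ∀ w ∈ χ.target, ψ.symm (e w) = χ.symm w := fun w hw ↦
    ψ.left_inv (hχ.source_subset (χ.map_target hw))
  let V : Set (Vec l) := L ⁻¹' χ.target
  have hV : IsOpen V := χ.open_target.preimage L.continuous
  have h0V : (0 : Vec l) ∈ V := by simpa [V] using h0t
  let E : Vec l → Vec d := fun x ↦ e (L x)
  have hE : ContDiffOn ℝ ∞ E V := hct.comp L.contDiff.contDiffOn fun x hx ↦ hx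
  have hE0 : HasFDerivAt E L 0 := by
    have h : HasFDerivAt e (ContinuousLinearMap.id ℝ _) (L 0) := by
      rw [map_zero]; exact hχ.hasFDerivAt
    exact h.comp 0 L.hasFDerivAt
  have hE0' : E 0 = ψ p := by simp only [E, e, map_zero, hχ0]
  let B : Vec l → Vec l →L[ℝ] Vec l →L[ℝ] ℝ := fun x ↦
    (chartMetric g p (E x)).bilinearComp (fderiv ℝ E x) (fderiv ℝ E x)
  have hBc : ContDiffOn ℝ ∞ B V := contDiffOn_bilinearComp hV
    ((contDiffOn_chartMetric hg p).comp hE fun x hx ↦ het _ hx) (hE.fderiv_of_isOpen hV (by simp))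
  have hB0 : B 0 = (g.at p).bilinearComp L L := by
    simp only [B, hE0.fderiv, hE0', hψ, chartMetric_self]
  have hBe : ∀ᶠ x in 𝓝 (0 : Vec l), (∀ u v, B x u v = B x v u) → IsRiemannianOrLorentzian ε (B x) :=
    (hBc.continuousOn.continuousAt (hV.mem_nhds h0V)).eventually (by rw [hB0]; exact hB.eventually)
  obtain ⟨δ, hδ, hδB⟩ := Metric.eventually_nhds_iff_ball.1 (hBe.and (hV.mem_nhds h0V))
  have hδt : ∀ x ∈ Metric.ball (0 : Vec l) δ, L x ∈ χ.target := fun x hx ↦ (hδB x hx).2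
  have hb := contDiff_toBall (k := l) δ
  let F : Vec l → Vec d := fun z ↦ E (toBall l δ z)
  have hF : ContDiff ℝ ∞ F := contDiffOn_univ.1
    (hE.comp hb.contDiffOn fun z _ ↦ hδt _ (toBall_mem hδ z))
  have hFt : ∀ z, F z ∈ ψ.target := fun z ↦ het _ (hδt _ (toBall_mem hδ z))
  have hFd : Differentiable ℝ F := hF.differentiable (by simp)
  have hF0 : F 0 = ψ p := by simp only [F, toBall_zero, hE0']
  have hiF : linearPiece χ L δ = fun z ↦ ψ.symm (F z) := by
    ext z
    exact (hψe _ (hδt _ (toBall_mem hδ z))).symm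
  have hind : ∀ z, IsRiemannianOrLorentzian ε ((inducedMetric l g (linearPiece χ L δ)).at z) := by
    intro z
    obtain ⟨A, hA, -⟩ := exists_hasFDerivAt_toBall hδ z
    have hm := toBall_mem hδ z
    have hEd : HasFDerivAt E (fderiv ℝ E (toBall l δ z)) (toBall l δ z) :=
      ((hE.contDiffAt (hV.mem_nhds (hδt _ hm))).differentiableAt (by simp)).hasFDerivAt
    have hFz : fderiv ℝ F z = (fderiv ℝ E (toBall l δ z)).comp (A : Vec l →L[ℝ] Vec l) :=
      (hEd.comp z hA).fderiv
    rw [hiF, inducedMetric_extChartAt_symm_comp g (hFd z) (hFt z), hFz]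
    refine ((hδB _ hm).1 fun u v ↦ ?_).pullback A
    exact (isNondegenerateForm_chartMetric hgn p (het _ (hδt _ hm))).1 _ _
  have hin : IsNondegenerate l g (linearPiece χ L δ) := by
    cases ε with
    | true =>
      refine Or.inl fun z ↦ ⟨(hind z).1, fun u hu ↦ ?_⟩
      obtain ⟨-, t, ht, hpos⟩ := hind z
      have ht0 : t = 0 := by simpa using ht
      exact hpos u hu (by rw [ht0, map_zero, zero_apply])
    | false =>
      refine Or.inr fun z ↦ ⟨(hind z).1, ?_⟩
      obtain ⟨-, t, ht, hpos⟩ := hind z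
      exact ⟨t, by simpa using ht, hpos⟩
  have hi0 : linearPiece χ L δ 0 = p := by
    rw [linearPiece, toBall_zero, map_zero, hχ0]
  obtain ⟨A, hA, hA'⟩ := exists_hasFDerivAt_toBall (k := l) hδ 0
  refine ⟨δ, hδ, hδt, hi0, hin, ?_, ?_⟩
  · rw [hiF] at hin ⊢
    refine isTotallyGeodesicAt_extChartAt_symm_comp hg hgn hF hFt hF0 hin fun v ↦ ?_
    -- The parametrization by `toBall` has derivative `A` at the origin; pulling back the line in
    -- direction `A v` gives initial velocity `v`.
    refine ⟨fun t ↦ (toBall l δ).symm (t • A v), ?_, ?_, ?_, ?_⟩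
    · have := toBall_symm_apply (k := l) (δ := δ) 0
      rw [toBall_zero] at this
      simpa only [zero_smul] using this
    · rw [toBall_zero, ← zero_smul ℝ (A v)] at hA'
      have h1 : HasDerivAt (fun t : ℝ ↦ t • A v) (A v) 0 := by
        simpa using (hasDerivAt_id (0 : ℝ)).smul_const (A v)
      exact (hA'.comp_hasDerivAt (0 : ℝ) h1).deriv.trans (A.symm_apply_apply v)
    · have h1 : ContDiffAt ℝ ∞ (toBall l δ).symm ((0 : ℝ) • A v) := by
        rw [zero_smul]; exact contDiffAt_toBall_symm (Metric.mem_ball_self hδ)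
      exact (h1.comp (0 : ℝ) (contDiff_id.smul contDiff_const).contDiffAt).of_le (by norm_cast)
    · refine (hχ.isCoordGeodesic (L (A v))).congr ?_
      have hc : Filter.Tendsto (fun t : ℝ ↦ t • A v) (𝓝 0) (𝓝 0) :=
        Continuous.tendsto' (by fun_prop) _ _ (zero_smul ℝ (A v))
      filter_upwards [hc.eventually (Metric.ball_mem_nhds 0 hδ)] with t ht
      simp only [F, E, e]
      rw [toBall_apply_symm hδ ht, map_smul]
  · have hEb : HasFDerivAt E L (toBall l δ 0) := by rwa [toBall_zero]
    have hF0d : fderiv ℝ F 0 = L.comp (A : Vec l →L[ℝ] Vec l) := (hEb.comp 0 hA).fderiv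
    rw [tangentAt, hiF, differential_extChartAt_symm_comp (hFd 0) (hFt 0), hF0, hψ, chartFrame_self,
      hF0d]
    ext w
    constructor
    · rintro ⟨u, rfl⟩
      exact ⟨A u, rfl⟩
    · rintro ⟨u, rfl⟩
      exact ⟨A.symm u, congrArg L (A.apply_symm_apply u)⟩

end Pieces

/-! ### Transversal intersection with the immersed submanifold. -/

section Intersection

variable {d k l s : ℕ} {N : Type*} [TopologicalSpace N] [ChartedSpace (Vec d) N]
  {Q : Type*} [TopologicalSpace Q] [ChartedSpace (Vec k) Q]

/-- In normal coordinates, a projection onto the tangent space of a submanifold restricts to a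
chart of the submanifold. -/
theorem IsNormalChart.exists_projection_chart [IsManifold (𝓡 d) ∞ N] [IsManifold (𝓡 k) ∞ Q]
    {g : BilinField d N} {f : Q → N} (hf : ContMDiff (𝓡 k) (𝓡 d) ∞ f) {q : Q}
    {χ : OpenPartialHomeomorph N (Vec d)} (hχ : IsNormalChart g (f q) χ)
    {P : Vec d →L[ℝ] Vec k} (hP : ∀ u, P (differential d k f q u) = u) :
    ∃ θ : OpenPartialHomeomorph Q (Vec k), θ ∈ IsManifold.maximalAtlas (𝓡 k) ∞ Q ∧ q ∈ θ.source ∧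
      θ q = 0 ∧ (∀ x ∈ θ.source, f x ∈ χ.source ∧ θ x = P (χ (f x))) ∧
      ∀ (L : Vec s →L[ℝ] Vec k) (δ : ℝ), 0 < δ → (∀ x ∈ Metric.ball (0 : Vec s) δ, L x ∈ θ.target) →
        tangentAt k s (linearPiece θ L δ) 0 = LinearMap.range (L : Vec s →ₗ[ℝ] Vec k) := by
  set φ := extChartAt (𝓡 k) q with hφ
  set ψ := extChartAt (𝓡 d) (f q) with hψ
  have hφct : φ.target = (chartAt (Vec k) q).target := by rw [hφ]; simp [mfld_simps]
  have hφt : IsOpen φ.target := isOpen_extChartAt_target q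
  have hφs : ContMDiffOn 𝓘(ℝ, Vec k) (𝓡 k) ∞ φ.symm φ.target := contMDiffOn_extChartAt_symm q
  have hfφ : ContMDiffOn 𝓘(ℝ, Vec k) (𝓡 d) ∞ (f ∘ φ.symm) φ.target := hf.comp_contMDiffOn hφs
  let V := φ.target ∩ (f ∘ φ.symm) ⁻¹' χ.source
  have hV : IsOpen V := hfφ.continuousOn.isOpen_inter_preimage hφt χ.open_source
  have hqV : φ q ∈ V := by
    refine ⟨mem_extChartAt_target q, ?_⟩
    simp only [Set.mem_preimage, Function.comp_apply, hφ, extChartAt_to_inv]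
    exact hχ.mem_source
  let w : Vec k → Vec d := fun y ↦ χ (f (φ.symm y))
  have hw : ContDiffOn ℝ ∞ w V := by
    have h := (contMDiffOn_of_mem_maximalAtlas hχ.mem_maximalAtlas).comp
      (hfφ.mono Set.inter_subset_left) (fun y (hy : y ∈ V) ↦ hy.2)
    exact h.contDiffOn
  have hwq : w (φ q) = 0 := by
    simp only [w, hφ, extChartAt_to_inv, hχ.apply_self]
  have hwd : HasFDerivAt w (differential d k f q) (φ q) := by
    have h1 : HasFDerivAt w (fderiv ℝ w (φ q)) (φ q) :=
      ((hw.contDiffAt (hV.mem_nhds hqV)).differentiableAt (by simp)).hasFDerivAt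
    have h2 : HasFDerivAt (fun w ↦ ψ (χ.symm w)) (ContinuousLinearMap.id ℝ _) (w (φ q)) := by
      rw [hwq]; exact hχ.hasFDerivAt
    have h3 : writtenInExtChartAt (𝓡 k) (𝓡 d) q f =ᶠ[𝓝 (φ q)] fun y ↦ ψ (χ.symm (w y)) := by
      filter_upwards [hV.mem_nhds hqV] with y hy
      have h : χ.symm (χ (f (φ.symm y))) = f (φ.symm y) := χ.left_inv hy.2
      simp only [w, h]
      rfl
    have h4 : differential d k f q = fderiv ℝ w (φ q) := by
      rw [differential_eq_fderiv (hf.contMDiffAt.mdifferentiableAt (by simp)), h3.fderiv_eq]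
      exact (h2.comp _ h1).fderiv
    rwa [h4]
  -- In normal coordinates the differential of `f` is unchanged and `P` is a left inverse of it, so
  -- the inverse function theorem applies to `P ∘ w`.
  have hPw : HasFDerivAt (fun y ↦ P (w y))
      ((ContinuousLinearEquiv.refl ℝ (Vec k) : Vec k ≃L[ℝ] Vec k) : Vec k →L[ℝ] Vec k) (φ q) := by
    have h : P.comp (differential d k f q)
        = ((ContinuousLinearEquiv.refl ℝ (Vec k) : Vec k ≃L[ℝ] Vec k) : Vec k →L[ℝ] Vec k) :=
      ContinuousLinearMap.ext hP
    rw [← h]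
    exact P.hasFDerivAt.comp _ hwd
  obtain ⟨Θ, hqΘ, hΘV, -, hΘe, hΘs⟩ := exists_openPartialHomeomorph hV hqV
    (P.contDiff.comp_contDiffOn hw) hPw isOpen_univ (Set.mem_univ _)
  let θ := (chartAt (Vec k) q).trans Θ
  have hθs : ∀ x ∈ θ.source, x ∈ φ.source ∧ φ x ∈ Θ.source := fun x hx ↦
    ⟨by rw [hφ, extChartAt_source]; exact hx.1, hx.2⟩
  have hθt : θ.target = Θ.target := by
    ext y
    simp only [θ, OpenPartialHomeomorph.trans_target, Set.mem_inter_iff, Set.mem_preimage]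
    exact ⟨fun h ↦ h.1, fun h ↦ ⟨h, hφct ▸ (hΘV (Θ.map_target h)).1⟩⟩
  have hqθ : q ∈ θ.source := ⟨mem_chart_source _ q, hqΘ⟩
  have hθe : ∀ x ∈ θ.source, f x ∈ χ.source ∧ θ x = P (χ (f x)) := fun x hx ↦ by
    obtain ⟨h1, h2⟩ := hθs x hx
    have h3 := (hΘV h2).2
    have h4 : φ.symm (φ x) = x := φ.left_inv h1
    simp only [Set.mem_preimage, Function.comp_apply, h4] at h3
    refine ⟨h3, ?_⟩
    change Θ (φ x) = _
    rw [hΘe]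
    simp only [Function.comp_apply, w, h4]
  have hθ0 : θ q = 0 := by rw [(hθe q hqθ).2, hχ.apply_self, map_zero]
  refine ⟨θ, ?_, hqθ, hθ0, hθe, fun L δ hδ hLθ ↦ ?_⟩
  · refine OpenPartialHomeomorph.mem_maximalAtlas_of_contMDiffOn (I := 𝓡 k) (n := ∞) (φ := θ) ?_ ?_
    · have h1 := contMDiffOn_chart (I := 𝓡 k) (n := ∞) (x := q)
      have h2 : ContDiffOn ℝ ∞ Θ Θ.source :=
        (((P.contDiff.comp_contDiffOn hw).mono hΘV).congr fun x _ ↦ hΘe x)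
      exact h2.contMDiffOn.comp (h1.mono fun x hx ↦ hx.1) fun x hx ↦ hx.2
    · have h1 := contMDiffOn_chart_symm (I := 𝓡 k) (n := ∞) (x := q)
      rw [hθt]
      refine h1.comp hΘs.contMDiffOn fun x hx ↦ ?_
      exact hφct.subset (hΘV (Θ.map_target hx)).1
  · obtain ⟨A, hA, -⟩ := exists_hasFDerivAt_toBall (k := s) hδ 0
    have hΘq : Θ (φ q) = 0 := hθ0
    have h0t : (0 : Vec k) ∈ Θ.target := hΘq ▸ Θ.map_source hqΘ
    have hΘ0 : Θ.symm 0 = φ q := by rw [← hΘq, Θ.left_inv hqΘ]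
    have hΘd : HasFDerivAt Θ.symm
        ((ContinuousLinearEquiv.refl ℝ (Vec k)).symm : Vec k →L[ℝ] Vec k) (L (toBall s δ 0)) := by
      rw [toBall_zero, map_zero]
      refine Θ.hasFDerivAt_symm h0t ?_
      rw [hΘ0]
      exact hPw.congr_of_eventuallyEq (.of_forall hΘe)
    let F : Vec s → Vec k := fun z ↦ Θ.symm (L (toBall s δ z))
    have hF : HasFDerivAt F (L.comp (A : Vec s →L[ℝ] Vec s)) 0 :=
      HasFDerivAt.comp (f := fun z ↦ L (toBall s δ z)) 0 hΘd (L.hasFDerivAt.comp 0 hA)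
    have hF0 : F 0 = φ q := by simp only [F, toBall_zero, map_zero, hΘ0]
    have hd := differential_extChartAt_symm_comp (p := q) hF.differentiableAt
      (by rw [hF0]; exact mem_extChartAt_target q)
    rw [hF0, hφ, chartFrame_self, hF.fderiv] at hd
    have hd' : differential k s (linearPiece θ L δ) 0
      = (ContinuousLinearMap.id ℝ (Vec k)).comp (L.comp (A : Vec s →L[ℝ] Vec s)) := hd
    rw [tangentAt, hd']
    ext x
    constructor
    · rintro ⟨u, rfl⟩
      exact ⟨A u, rfl⟩
    · rintro ⟨u, rfl⟩
      exact ⟨A.symm u, congrArg L (A.apply_symm_apply u)⟩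

theorem exists_leftInverse {a b : ℕ} {L : Vec a →L[ℝ] Vec b} (hL : Function.Injective L) :
    ∃ Λ : Vec b →L[ℝ] Vec a, ∀ x, Λ (L x) = x := by
  obtain ⟨Λ, hΛ⟩ := LinearMap.exists_leftInverse_of_injective (L : Vec a →ₗ[ℝ] Vec b)
    (LinearMap.ker_eq_bot.2 hL)
  exact ⟨LinearMap.toContinuousLinearMap Λ, fun x ↦ LinearMap.congr_fun hΛ x⟩

/-- The image under the exponential map of a linear subspace that contains the kernel of a
projection onto the tangent space of a submanifold intersects the submanifold transversally. -/
theorem IsNormalChart.exists_isIntersectionNear [IsManifold (𝓡 d) ∞ N] [IsManifold (𝓡 k) ∞ Q]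
    {g : BilinField d N} {f : Q → N} (hf : ContMDiff (𝓡 k) (𝓡 d) ∞ f) {q : Q}
    {χ : OpenPartialHomeomorph N (Vec d)} (hχ : IsNormalChart g (f q) χ)
    {P : Vec d →L[ℝ] Vec k} (hP : ∀ u, P (differential d k f q u) = u)
    {K : Vec s →L[ℝ] Vec k} (hK : Function.Injective K)
    {L : Vec l →L[ℝ] Vec d} (hL : Function.Injective L)
    (hKL : ∀ a, (∃ x, L x = a) ↔ ∃ y, K y = P a)
    {δ : ℝ} (hδ : 0 < δ) (hLχ : ∀ x ∈ Metric.ball (0 : Vec l) δ, L x ∈ χ.target) :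
    ∃ (j : Vec s → Q) (j' : Vec s → Vec l),
      IsIntersectionNear k l s f q (linearPiece χ L δ) j j' 0 ∧
      tangentAt k s j 0 = LinearMap.range (K : Vec s →ₗ[ℝ] Vec k) := by
  obtain ⟨θ, hθ, hqθ, hθ0, hθe, htan⟩ := hχ.exists_projection_chart (s := s) hf hP
  obtain ⟨Λ, hΛ⟩ := exists_leftInverse hL
  obtain ⟨ΛK, hΛK⟩ := exists_leftInverse hK
  have h0t : (0 : Vec k) ∈ θ.target := hθ0 ▸ θ.map_source hqθ
  have hθ0' : θ.symm 0 = q := by rw [← hθ0, θ.left_inv hqθ]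
  have hcont : ContinuousAt (fun y ↦ Λ (χ (f (θ.symm (K y))))) 0 := by
    have h1 : ContinuousAt θ.symm (K 0) := by
      rw [map_zero]; exact θ.continuousAt_symm h0t
    have h2 : ContinuousAt χ (f (θ.symm (K 0))) := by
      rw [map_zero, hθ0']; exact χ.continuousAt hχ.mem_source
    have h3 : ContinuousAt f (θ.symm (K 0)) := hf.continuous.continuousAt
    have h4 : ContinuousAt (fun y ↦ θ.symm (K y)) 0 :=
      ContinuousAt.comp (f := K) h1 K.continuous.continuousAt
    exact Λ.continuous.continuousAt.comp
      (ContinuousAt.comp (f := fun y ↦ f (θ.symm (K y))) h2 (ContinuousAt.comp (g := f) h3 h4))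
  -- This fixes the radius `η`: the piece of the intersection must stay inside the given piece of
  -- `M`, which has radius `δ`.
  have hev : ∀ᶠ y in 𝓝 (0 : Vec s), Λ (χ (f (θ.symm (K y)))) ∈ Metric.ball (0 : Vec l) δ := by
    refine hcont.eventually (Metric.isOpen_ball.mem_nhds ?_)
    simp only [map_zero, hθ0', hχ.apply_self]
    exact Metric.mem_ball_self hδ
  have hev' : ∀ᶠ y in 𝓝 (0 : Vec s), K y ∈ θ.target :=
    K.continuous.continuousAt.eventually (θ.open_target.mem_nhds (by rwa [map_zero]))
  obtain ⟨η, hη, hηb⟩ := Metric.eventually_nhds_iff_ball.1 (hev.and hev')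
  have hηt : ∀ y ∈ Metric.ball (0 : Vec s) η, K y ∈ θ.target := fun y hy ↦ (hηb y hy).2
  let j : Vec s → Q := linearPiece θ K η
  let a : Vec s → Vec d := fun z ↦ χ (f (j z))
  have hjs : ∀ z, j z ∈ θ.source := fun z ↦ θ.map_target (hηt _ (toBall_mem hη z))
  have hemb := isSmoothEmbedding_linear_in_chart hθ hK hη hηt
  have hjsm : ContMDiff (𝓡 s) (𝓡 k) ∞ j := hemb.contMDiff
  have hPa : ∀ z, P (a z) = K (toBall s η z) := fun z ↦ by
    rw [← (hθe _ (hjs z)).2]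
    exact θ.right_inv (hηt _ (toBall_mem hη z))
  -- In normal coordinates, `f x` lies in the subspace `range L`, the preimage of `range K` under
  -- `P`, exactly when `θ x = P (χ (f x))` lies in `range K`. Thus the intersection is linear in the
  -- chart `θ`.
  have haL : ∀ z, L (Λ (a z)) = a z := fun z ↦ by
    obtain ⟨x, hx⟩ := (hKL (a z)).2 ⟨_, (hPa z).symm⟩
    rw [← hx, hΛ]
  have hab : ∀ z, Λ (a z) ∈ Metric.ball (0 : Vec l) δ := fun z ↦ (hηb _ (toBall_mem hη z)).1
  refine ⟨j, fun z ↦ (toBall l δ).symm (Λ (a z)), ⟨hemb, ?_, ?_, ?_, ?_⟩, htan K η hη hηt⟩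
  · have h1 : ContMDiff (𝓡 s) (𝓡 d) ∞ a := contMDiffOn_univ.1 <|
      (contMDiffOn_of_mem_maximalAtlas hχ.mem_maximalAtlas).comp (hf.comp hjsm).contMDiffOn
        fun z _ ↦ (hθe _ (hjs z)).1
    have h2 : ContDiff ℝ ∞ fun z ↦ Λ (a z) := Λ.contDiff.comp h1.contDiff
    have h3 : ContDiff ℝ ∞ fun z ↦ (toBall l δ).symm (Λ (a z)) := contDiff_iff_contDiffAt.2 fun z ↦
      (contDiffAt_toBall_symm (hab z)).comp z h2.contDiffAt
    exact h3.contMDiff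
  · ext z
    simp only [Function.comp_apply, linearPiece]
    rw [toBall_apply_symm hδ (hab z), haL]
    exact (χ.left_inv (hθe _ (hjs z)).1).symm
  · simp only [j, linearPiece, toBall_zero, map_zero, hθ0']
  · rw [mem_nhdsWithin]
    -- The condition through the left inverse `ΛK` is open in `Q` and, on `range K`, says that the
    -- parameter lies in the ball of radius `η`.
    refine ⟨θ.source ∩ θ ⁻¹' (ΛK ⁻¹' Metric.ball (0 : Vec s) η),
      θ.continuousOn.isOpen_inter_preimage θ.open_source
        (Metric.isOpen_ball.preimage ΛK.continuous), ⟨hqθ, ?_⟩, ?_⟩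
    · simp only [Set.mem_preimage, hθ0, map_zero]
      exact Metric.mem_ball_self hη
    · rintro x ⟨⟨hx, hxη⟩, z, hz⟩
      have h1 : χ (f x) = L (toBall l δ z) := by
        rw [← hz]
        exact χ.right_inv (hLχ _ (toBall_mem hδ z))
      obtain ⟨y, hy⟩ := (hKL (χ (f x))).1 ⟨_, h1.symm⟩
      rw [← (hθe x hx).2] at hy
      have hyη : y ∈ Metric.ball (0 : Vec s) η := by
        have h2 : ΛK (θ x) ∈ Metric.ball (0 : Vec s) η := hxη
        rwa [← hy, hΛK] at h2
      refine ⟨(toBall s η).symm y, ?_⟩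
      simp only [j, linearPiece]
      rw [toBall_apply_symm hη hyη, hy, θ.left_inv hx]

end Intersection

/-! ### Subspaces of prescribed dimension. -/

section LinearAlgebra

theorem exists_le_finrank_eq_add {E : Type*} [AddCommGroup E] [Module ℝ E] [FiniteDimensional ℝ E]
    (t : ℕ) (W : Submodule ℝ E) (h : Module.finrank ℝ W + t ≤ Module.finrank ℝ E) :
    ∃ W' : Submodule ℝ E, W ≤ W' ∧ Module.finrank ℝ W' = Module.finrank ℝ W + t := by
  induction t with
  | zero => exact ⟨W, le_rfl, rfl⟩
  | succ t ih =>
    obtain ⟨W', hW, hW'⟩ := ih (by omega)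
    have hlt : W' < ⊤ := lt_top_iff_ne_top.2 fun htop ↦ by
      rw [htop, finrank_top] at hW'
      omega
    obtain ⟨x, -, hx⟩ := SetLike.exists_of_lt hlt
    have h1 : W' < W' ⊔ Submodule.span ℝ {x} := lt_of_le_of_ne le_sup_left fun heq ↦ hx <| by
      rw [heq]
      exact Submodule.mem_sup_right (Submodule.mem_span_singleton_self x)
    have h2 := Submodule.finrank_lt_finrank_of_lt h1
    have h3 := Submodule.finrank_add_le_finrank_add_finrank W' (Submodule.span ℝ {x})
    have h4 : Module.finrank ℝ (Submodule.span ℝ {x}) ≤ 1 := by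
      simpa using finrank_span_le_card (R := ℝ) ({x} : Set E)
    exact ⟨_, hW.trans h1.le, by omega⟩

theorem exists_injective_range_eq {a b : ℕ} (W : Submodule ℝ (Vec b))
    (hW : Module.finrank ℝ W = a) :
    ∃ L : Vec a →L[ℝ] Vec b, Function.Injective L ∧ ∀ w, (∃ x, L x = w) ↔ w ∈ W := by
  let A : Vec a ≃L[ℝ] W := ContinuousLinearEquiv.ofFinrankEq (by rw [hW]; simp)
  refine ⟨W.subtypeL.comp (A : Vec a →L[ℝ] W), Subtype.val_injective.comp A.injective,
    fun w ↦ ⟨?_, fun hw ↦ ⟨A.symm ⟨w, hw⟩, ?_⟩⟩⟩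
  · rintro ⟨x, rfl⟩
    exact (A x).2
  · simp

/-- Here `2 ≤ s` is essential: the span of two vectors has dimension at most `2` and can be enlarged
to dimension `s`. -/
theorem exists_injective_pair_mem_range {m s : ℕ} (hs : 2 ≤ s) (hsm : s ≤ m) (u v : Vec m) :
    ∃ K : Vec s →L[ℝ] Vec m, Function.Injective K ∧ (∃ x, K x = u) ∧ ∃ y, K y = v := by
  have h1 : Module.finrank ℝ (Submodule.span ℝ {u, v}) ≤ 2 := by
    classical
    refine (finrank_span_le_card (R := ℝ) ({u, v} : Set (Vec m))).trans ?_
    rw [Set.toFinset_insert, Set.toFinset_singleton]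
    exact Finset.card_le_two
  obtain ⟨W, hW, hWs⟩ := exists_le_finrank_eq_add
    (s - Module.finrank ℝ (Submodule.span ℝ {u, v})) (Submodule.span ℝ {u, v}) (by
      rw [finrank_euclideanSpace_fin]; omega)
  obtain ⟨K, hK, hKW⟩ := exists_injective_range_eq (a := s) W (by omega)
  exact ⟨K, hK, (hKW u).2 (hW (Submodule.subset_span (by simp))),
    (hKW v).2 (hW (Submodule.subset_span (by simp)))⟩

/-- The preimage of `range K` under `P` is the kernel of a surjection onto the quotient by `range
K`, so its dimension is `(m + n) - (m - s) = s + n`. -/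
theorem exists_injective_range_eq_comap {m n s : ℕ} {P : Vec (m + n) →L[ℝ] Vec m}
    (hP : Function.Surjective P) {K : Vec s →L[ℝ] Vec m} (hK : Function.Injective K) :
    ∃ L : Vec (s + n) →L[ℝ] Vec (m + n), Function.Injective L ∧
      ∀ a, (∃ x, L x = a) ↔ ∃ y, K y = P a := by
  let R := LinearMap.range (K : Vec s →ₗ[ℝ] Vec m)
  let T : Vec (m + n) →ₗ[ℝ] Vec m ⧸ R := R.mkQ ∘ₗ (P : Vec (m + n) →ₗ[ℝ] Vec m)
  have hT : LinearMap.range T = ⊤ :=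
    LinearMap.range_eq_top.2 ((Submodule.mkQ_surjective R).comp hP)
  have h1 := LinearMap.finrank_range_add_finrank_ker T
  have h2 := Submodule.finrank_quotient_add_finrank R
  have h3 : Module.finrank ℝ R = s := by
    rw [LinearMap.finrank_range_of_inj hK, finrank_euclideanSpace_fin]
  rw [hT, finrank_top, finrank_euclideanSpace_fin] at h1
  rw [h3, finrank_euclideanSpace_fin] at h2
  obtain ⟨L, hL, hLr⟩ := exists_injective_range_eq (a := s + n) (LinearMap.ker T) (by omega)
  refine ⟨L, hL, fun a ↦ (hLr a).trans ?_⟩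
  rw [LinearMap.mem_ker, LinearMap.comp_apply, Submodule.mkQ_apply, Submodule.Quotient.mk_eq_zero]
  rfl

end LinearAlgebra

/-! ### Tangential projection along the normal space. -/

section NormalSections

variable {d k : ℕ} {N : Type*} [TopologicalSpace N] [ChartedSpace (Vec d) N]
  {Q : Type*} [TopologicalSpace Q] [ChartedSpace (Vec k) Q]

/-- The orthogonal projection onto the tangent space of a nondegenerate submanifold. -/
theorem exists_tangentProjection {g : BilinField d N} {f : Q → N} {q : Q}
    (hn : IsNondegenerateForm ((inducedMetric k g f).at q)) :
    ∃ P : Vec d →L[ℝ] Vec k, (∀ u, P (differential d k f q u) = u) ∧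
      ∀ a, a - differential d k f q (P a) ∈ normalAt k g f q := by
  have hP : ∀ a, ∃ u, a - differential d k f q u ∈ normalAt k g f q := fun a ↦ by
    obtain ⟨w, hw, u, hu⟩ := exists_normal_add_tangent hn a
    refine ⟨u, ?_⟩
    have h : a - differential d k f q u = w := by
      rw [sub_eq_iff_eq_add, ← sub_eq_iff_eq_add']
      exact hu.symm
    rwa [h]
  have huniq : ∀ u, differential d k f q u ∈ normalAt k g f q → u = 0 := fun u hu ↦
    hn.2 u (mem_normalAt.1 hu)
  choose P hP using hP
  have hPu : ∀ a u, a - differential d k f q u ∈ normalAt k g f q → P a = u := fun a u h ↦ by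
    refine sub_eq_zero.1 (huniq _ ?_)
    have := sub_mem h (hP a)
    rwa [sub_sub_sub_cancel_left, ← map_sub] at this
  let P' : Vec d →ₗ[ℝ] Vec k :=
    { toFun := P
      map_add' := fun a b ↦ hPu _ _ (by
        rw [map_add, add_sub_add_comm]
        exact add_mem (hP a) (hP b))
      map_smul' := fun c a ↦ hPu _ _ (by
        rw [map_smul, RingHom.id_apply, ← smul_sub]
        exact Submodule.smul_mem _ c (hP a)) }
  refine ⟨LinearMap.toContinuousLinearMap P', fun u ↦ hPu _ _ ?_, hP⟩
  rw [sub_self]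
  exact zero_mem _

end NormalSections

/-! ### Existence of normal sections. -/

section NormalSections

variable {m n s : ℕ} {N : Type*} [TopologicalSpace N] [ChartedSpace (Vec (m + n)) N]
  {Q : Type*} [TopologicalSpace Q] [ChartedSpace (Vec m) Q]

/-- The span of the normal space and of a spacelike subspace of the tangent space is nondegenerate. -/
theorem exists_isRiemannianOrLorentzian {g : BilinField (m + n) N} {f : Q → N} {q : Q}
    (hg : IsRiemannianField g ∨ IsLorentzianField g)
    (hpos : ∀ u, u ≠ 0 → 0 < (inducedMetric m g f).at q u u)
    {P : Vec (m + n) →L[ℝ] Vec m} (hP : ∀ u, P (differential (m + n) m f q u) = u)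
    (hPn : ∀ a, a - differential (m + n) m f q (P a) ∈ normalAt m g f q)
    {l : ℕ} {L : Vec l →L[ℝ] Vec (m + n)} (hL : Function.Injective L)
    (hLn : ∀ a, P a = 0 → ∃ x, L x = a) :
    ∃ ε, IsRiemannianOrLorentzian ε ((g.at (f q)).bilinearComp L L) := by
  have hL0 : ∀ u, u ≠ 0 → L u ≠ 0 := fun u hu h ↦ hu (hL (h.trans (map_zero L).symm))
  rcases hg with hg | hg
  · exact ⟨true, fun u v ↦ (hg _).1 _ _, 0, Or.inl ⟨rfl, rfl⟩,
      fun u hu _ ↦ (hg _).2 _ (hL0 u hu)⟩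
  · obtain ⟨hs, t, ht, htpos⟩ := hg (f q)
    set D := differential (m + n) m f q
    -- The tangential part of the timelike vector `t` has nonnegative square length, so its normal
    -- part is timelike. That part lies in `range L`, because `P` annihilates it.
    have hnt : (g.at (f q)) (t - D (P t)) (t - D (P t)) < 0 := by
      have h1 : g.at (f q) (t - D (P t)) (D (P t)) = 0 := mem_normalAt.1 (hPn t) _
      have h2 : 0 ≤ g.at (f q) (D (P t)) (D (P t)) := by
        by_cases h0 : P t = 0
        · rw [h0, map_zero, map_zero]
        · exact (hpos _ h0).le
      have h3 : g.at (f q) t t = g.at (f q) (t - D (P t)) (t - D (P t))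
          + 2 * g.at (f q) (t - D (P t)) (D (P t)) + g.at (f q) (D (P t)) (D (P t)) := by
        simp only [map_sub, sub_apply, hs (D (P t)) t]
        ring
      linarith
    obtain ⟨x, hx⟩ := hLn (t - D (P t)) (by rw [map_sub, hP, sub_self])
    rw [← hx] at hnt
    exact ⟨false, fun u v ↦ hs _ _, x, Or.inr ⟨rfl, hnt⟩, fun u hu hxu ↦
      pos_of_orthogonal_timelike hs htpos hnt (hL0 u hu) hxu⟩

/-- There is a normal section in the direction of every subspace of the tangent space. -/
theorem exists_isNormalSubmanifoldAt [IsManifold (𝓡 (m + n)) ∞ N] [IsManifold (𝓡 m) ∞ Q]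
    {g : BilinField (m + n) N} (hg : IsSmoothField g)
    (hgRL : IsRiemannianField g ∨ IsLorentzianField g)
    {f : Q → N} (hf : ContMDiff (𝓡 m) (𝓡 (m + n)) ∞ f) {q : Q}
    (hpos : ∀ u, u ≠ 0 → 0 < (inducedMetric m g f).at q u u)
    {K : Vec s →L[ℝ] Vec m} (hK : Function.Injective K) :
    ∃ (i : Vec (s + n) → N) (j : Vec s → Q) (j' : Vec s → Vec (s + n)),
      IsNormalSubmanifoldAt m (s + n) g f q i 0 ∧
      IsIntersectionNear m (s + n) s f q i j j' 0 ∧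
      tangentAt m s j 0 = LinearMap.range (K : Vec s →ₗ[ℝ] Vec m) := by
  have hgn : ∀ x, IsNondegenerateForm (g.at x) := fun x ↦
    hgRL.elim (fun h ↦ h.isNondegenerateForm x) fun h ↦ h.isNondegenerateForm x
  have hn : IsNondegenerateForm ((inducedMetric m g f).at q) := .of_pos (fun u v ↦ (hgn _).1 _ _) hpos
  obtain ⟨P, hP, hPn⟩ := exists_tangentProjection hn
  obtain ⟨L, hL, hKL⟩ := exists_injective_range_eq_comap
    (fun u ↦ ⟨_, hP u⟩ : Function.Surjective P) hK
  have hker : ∀ a, P a = 0 → ∃ x, L x = a := fun a ha ↦ (hKL a).2 ⟨0, by rw [map_zero, ha]⟩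
  obtain ⟨ε, hε⟩ := exists_isRiemannianOrLorentzian hgRL hpos hP hPn hL hker
  obtain ⟨χ, hχ⟩ := exists_isNormalChart hg hgn (f q)
  obtain ⟨δ, hδ, hLχ, hi0, hin, hgeo, htan⟩ := hχ.exists_linearPiece hg hgn L hε
  obtain ⟨j, j', hj, hjt⟩ := hχ.exists_isIntersectionNear hf hP hK hL hKL hδ hLχ
  refine ⟨linearPiece χ L δ, j, j', ⟨?_, hin, hi0, hgeo, fun a ha ↦ ?_⟩, hj, hjt⟩
  · exact isSmoothEmbedding_linear_in_chart hχ.mem_maximalAtlas hL hδ hLχ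
  · rw [htan]
    refine hker a ?_
    have h1 : differential (m + n) m f q (P a) ∈ normalAt m g f q := by
      have := sub_mem ha (hPn a)
      rwa [sub_sub_cancel] at this
    exact hn.2 _ (mem_normalAt.1 h1)

end NormalSections

/-! ### From umbilic intersections to an umbilic point. -/

section Umbilic

variable {d k s : ℕ} {N : Type*} [TopologicalSpace N] [ChartedSpace (Vec d) N]
  {Q : Type*} [TopologicalSpace Q] [ChartedSpace (Vec k) Q]
  {S : Type*} [TopologicalSpace S] [ChartedSpace (Vec s) S]

theorem differential_comp {f : Q → N} (hf : ContMDiff (𝓡 k) (𝓡 d) ∞ f) {j : S → Q}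
    (hj : ContMDiff (𝓡 s) (𝓡 k) ∞ j) (r : S) (u : Vec s) :
    differential d s (f ∘ j) r u = differential d k f (j r) (differential k s j r u) :=
  congrArg (fun A : Vec s →L[ℝ] Vec d ↦ A u)
    (mfderiv_comp r (hf.contMDiffAt.mdifferentiableAt (by simp))
      (hj.contMDiffAt.mdifferentiableAt (by simp)))

theorem inducedMetric_comp_pos [IsManifold (𝓡 d) ∞ N] [IsManifold (𝓡 k) ∞ Q]
    [IsManifold (𝓡 s) ∞ S] {g : BilinField d N} {f : Q → N} (hf : ContMDiff (𝓡 k) (𝓡 d) ∞ f)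
    {j : S → Q} (hj : IsSmoothEmbedding (𝓡 s) (𝓡 k) ∞ j) {r : S}
    (hpos : ∀ u, u ≠ 0 → 0 < (inducedMetric k g f).at (j r) u u) (u : Vec s) (hu : u ≠ 0) :
    0 < (inducedMetric s g (f ∘ j)).at r u u := by
  rw [inducedMetric_at, differential_comp hf hj.contMDiff]
  have h := injective_differential (hj.isImmersion.isImmersionAt r)
  exact hpos _ fun h0 ↦ hu (h (h0.trans (map_zero _).symm))

/-- If `j r` is umbilic in a submanifold of `f`, then the normal curvatures of `f` in the
directions tangent to that submanifold are all equal. -/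
theorem IsUmbilicAt.exists_apply_ambientDeriv [IsManifold (𝓡 d) ∞ N] [IsManifold (𝓡 k) ∞ Q]
    [IsManifold (𝓡 s) ∞ S] {g : BilinField d N}
    (hgs : ∀ x u v, g.at x u v = g.at x v u) {f : Q → N} (hf : ContMDiff (𝓡 k) (𝓡 d) ∞ f) {j : S → Q}
    (hj : ContMDiff (𝓡 s) (𝓡 k) ∞ j) {r : S}
    (hpos : ∀ u, u ≠ 0 → 0 < (inducedMetric s g (f ∘ j)).at r u u)
    (h : IsUmbilicAt s g (f ∘ j) r) :
    ∃ H : Vec d, ∀ u ∈ tangentAt k s j r, ∀ v ∈ tangentAt k s j r, ∀ ξ ∈ normalAt k g f (j r),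
      g.at (f (j r)) (ambientDeriv k g f (j r) u v) ξ
        = (inducedMetric k g f).at (j r) u v * g.at (f (j r)) H ξ := by
  have hn : IsNondegenerateForm ((inducedMetric s g (f ∘ j)).at r) := .of_pos (fun u v ↦ hgs _ _ _) hpos
  obtain ⟨H, -, hH⟩ := h
  -- `H` is normal to the smaller submanifold and may have a component tangent to `f`; only its
  -- pairing with vectors normal to `f` matters.
  refine ⟨H, ?_⟩
  rintro _ ⟨u, rfl⟩ _ ⟨v, rfl⟩ ξ hξ
  have hξt : ∀ x, g.at (f (j r)) (differential d k f (j r) x) ξ = 0 := fun x ↦ by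
    rw [hgs]; exact mem_normalAt.1 hξ x
  obtain ⟨-, x, hx⟩ := normalPart_mem hn (ambientDeriv s g (f ∘ j) r u v)
  have h1 := hH u v
  rw [secondFundamentalForm] at h1
  rw [h1, eq_sub_iff_add_eq, ambientDeriv_comp g hf hj] at hx
  change differential d s (f ∘ j) r x + _ = _ at hx
  rw [differential_comp hf hj] at hx
  have h2 := congrArg (fun a ↦ g.at (f (j r)) a ξ) hx
  simp only [map_add, add_apply, hξt, map_smul, smul_apply, smul_eq_mul, zero_add, add_zero] at h2
  rw [inducedMetric_at, differential_comp hf hj, differential_comp hf hj] at h2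
  exact h2.symm

/-- A point is umbilic if, in the directions of every plane, the normal curvatures are all equal. -/
theorem isUmbilicAt_of_forall_pair {g : BilinField d N} (hgn : ∀ x, IsNondegenerateForm (g.at x))
    (hk : 0 < k) {f : Q → N} {q : Q} (hpos : ∀ u, u ≠ 0 → 0 < (inducedMetric k g f).at q u u)
    (h : ∀ x y : Vec k, ∃ H : Vec d, ∀ u ∈ ({x, y} : Set (Vec k)), ∀ v ∈ ({x, y} : Set (Vec k)),
      ∀ ξ ∈ normalAt k g f q, g.at (f q) (ambientDeriv k g f q u v) ξ
        = (inducedMetric k g f).at q u v * g.at (f q) H ξ) :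
    IsUmbilicAt k g f q := by
  have hn : IsNondegenerateForm ((inducedMetric k g f).at q) := .of_pos (fun u v ↦ (hgn _).1 _ _) hpos
  set G := (inducedMetric k g f).at q
  set B := g.at (f q)
  have hsff : ∀ u v, ∀ ξ ∈ normalAt k g f q,
      B (secondFundamentalForm k g f q u v) ξ = B (ambientDeriv k g f q u v) ξ := by
    intro u v ξ hξ
    obtain ⟨-, x, hx⟩ := normalPart_mem hn (ambientDeriv k g f q u v)
    have h1 : B (differential d k f q x) ξ = 0 := by
      rw [(hgn _).1]; exact mem_normalAt.1 hξ x
    have h2 : B (ambientDeriv k g f q u v - normalPart k g f q (ambientDeriv k g f q u v)) ξ = 0 := by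
      rw [← hx]; exact h1
    rw [map_sub, sub_apply, sub_eq_zero] at h2
    exact h2.symm
  have : Nonempty (Fin k) := ⟨⟨0, hk⟩⟩
  obtain ⟨v₀, hv₀⟩ := exists_ne (0 : Vec k)
  have hG₀ := (hpos v₀ hv₀).ne'
  -- The vectors `H'` depend on the pair and are determined only through their pairings with normal
  -- vectors. The fixed direction `v₀` supplies one global candidate.
  set H := (G v₀ v₀)⁻¹ • secondFundamentalForm k g f q v₀ v₀ with hHdef
  have hH : H ∈ normalAt k g f q := Submodule.smul_mem _ _ (normalPart_mem hn _).1
  have hHξ : ∀ ξ ∈ normalAt k g f q, B H ξ = (G v₀ v₀)⁻¹ * B (ambientDeriv k g f q v₀ v₀) ξ :=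
    fun ξ hξ ↦ by rw [hHdef, map_smul, smul_apply, hsff _ _ ξ hξ, smul_eq_mul]
  have hdiag : ∀ u, ∀ ξ ∈ normalAt k g f q, B (ambientDeriv k g f q u u) ξ = G u u * B H ξ := by
    intro u ξ hξ
    obtain ⟨H', hH'⟩ := h u v₀
    rw [hHξ ξ hξ, hH' u (by simp) u (by simp) ξ hξ, hH' v₀ (by simp) v₀ (by simp) ξ hξ,
      inv_mul_cancel_left₀ hG₀]
  -- The difference is normal, so it pairs to zero with the tangential part of `b`; only normal `ξ`
  -- need be tested.
  refine ⟨H, hH, fun u v ↦ sub_eq_zero.1 ((hgn (f q)).2 _ fun b ↦ ?_)⟩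
  have hmem : secondFundamentalForm k g f q u v - G u v • H ∈ normalAt k g f q :=
    sub_mem (normalPart_mem hn _).1 (Submodule.smul_mem _ _ hH)
  obtain ⟨ξ, hξ, hb⟩ := exists_normal_add_tangent hn b
  rw [← sub_add_cancel b ξ, map_add, hmem _ hb, zero_add]
  obtain ⟨H', hH'⟩ := h u v
  change B (secondFundamentalForm k g f q u v - G u v • H) ξ = 0
  rw [map_sub, map_smul, sub_apply, smul_apply, smul_eq_mul, hsff _ _ ξ hξ,
    hH' u (by simp) v (by simp) ξ hξ]
  -- For `u ≠ 0`, the value at `(u, u)` is given both by `H'` and by `H`; dividing by `G u u` shows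
  -- that they pair equally with `ξ`.
  by_cases hu : u = 0
  · rw [hu, map_zero, zero_apply, zero_mul, zero_mul, sub_self]
  · have h1 := hdiag u ξ hξ
    rw [hH' u (by simp) u (by simp) ξ hξ] at h1
    rw [mul_left_cancel₀ (hpos u hu).ne' h1, sub_self]

end Umbilic

end UmbilicSections
end

/-! ### The theorem. -/

open UmbilicSections in
theorem theorem4p8 (m n s : ℕ) (hm : 3 ≤ m) (hs : 2 ≤ s) (hsm : s ≤ m - 1)
    -- the ambient manifold and its Riemannian or Lorentzian metric
    {N : Type*} [TopologicalSpace N] [ChartedSpace (Vec (m + n)) N] [IsManifold (𝓡 (m + n)) ∞ N]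
    (g : BilinField (m + n) N) (hg : IsSmoothField g)
    -- the immersed submanifold
    {Q : Type*} [TopologicalSpace Q] [ChartedSpace (Vec m) Q] [IsManifold (𝓡 m) ∞ Q]
    (f : Q → N) (hf : IsImmersion (𝓡 m) (𝓡 (m + n)) ∞ f)
    (hgf : IsRiemannianField g ∨ (IsLorentzianField g ∧ IsSpacelike m g f))
    (q : Q) :
    -- being umbilic in the intersection as a submanifold of `N` or of `M` is equivalent
    (∀ (M : Type*) [TopologicalSpace M] [ChartedSpace (Vec (s + n)) M]
        [IsManifold (𝓡 (s + n)) ∞ M] (i : M → N) (p : M),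
      IsNormalSubmanifoldAt m (s + n) g f q i p →
      ∀ (S : Type*) [TopologicalSpace S] [ChartedSpace (Vec s) S] [IsManifold (𝓡 s) ∞ S]
        (j : S → Q) (j' : S → M) (r : S),
      IsIntersectionNear m (s + n) s f q i j j' r →
      (IsUmbilicAt s g (f ∘ j) r ↔ IsUmbilicAt s (inducedMetric (s + n) g i) j' r)) ∧
    -- if `q` is umbilic in all intersections, then it is umbilic
    ((∀ (M : Type) [TopologicalSpace M] [ChartedSpace (Vec (s + n)) M]
        [IsManifold (𝓡 (s + n)) ∞ M] (i : M → N) (p : M),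
      IsNormalSubmanifoldAt m (s + n) g f q i p →
      ∀ (S : Type) [TopologicalSpace S] [ChartedSpace (Vec s) S] [IsManifold (𝓡 s) ∞ S]
        (j : S → Q) (j' : S → M) (r : S),
      IsIntersectionNear m (s + n) s f q i j j' r →
      IsUmbilicAt s g (f ∘ j) r) →
    IsUmbilicAt m g f q) := by
  have hgRL : IsRiemannianField g ∨ IsLorentzianField g := hgf.imp_right And.left
  have hgn : ∀ x, IsNondegenerateForm (g.at x) := fun x ↦
    hgRL.elim (fun h ↦ h.isNondegenerateForm x) fun h ↦ h.isNondegenerateForm x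
  have hfs : ContMDiff (𝓡 m) (𝓡 (m + n)) ∞ f := hf.contMDiff
  have hpos : ∀ u, u ≠ 0 → 0 < (inducedMetric m g f).at q u u := by
    rcases hgf with h | ⟨-, h⟩
    · intro u hu
      have hinj := injective_differential (hf.isImmersionAt q)
      exact (h _).2 _ fun h0 ↦ hu (hinj (h0.trans (map_zero _).symm))
    · exact (h q).2
  refine ⟨?_, fun h ↦ ?_⟩
  · intro M _ _ _ i p hi S _ _ _ j j' r hj
    have hj'p : j' r = p := hi.isSmoothEmbedding.isEmbedding.injective <| by
      rw [hi.map_eq, ← hj.map_eq]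
      exact (congrFun hj.comp_eq r).symm
    have hp : ∀ u, u ≠ 0 → 0 < (inducedMetric s g (f ∘ j)).at r u u :=
      inducedMetric_comp_pos hfs hj.isSmoothEmbedding (by rwa [hj.map_eq])
    rw [hj.comp_eq] at hp ⊢
    exact isUmbilicAt_comp_iff (by omega) hg hgn hi.isSmoothEmbedding.contMDiff hi.isNondegenerate
      hj.contMDiff (hj'p ▸ hi.isTotallyGeodesicAt) hp
  · refine isUmbilicAt_of_forall_pair hgn (by omega) hpos fun x y ↦ ?_
    obtain ⟨K, hK, hx, hy⟩ := exists_injective_pair_mem_range hs (by omega : s ≤ m) x y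
    obtain ⟨i, j, j', hi, hj, hjt⟩ := exists_isNormalSubmanifoldAt hg hgRL hfs hpos hK
    -- The pieces are parametrized by whole model spaces, so submanifolds in `Type` are enough for
    -- the hypothesis.
    have hu := h (Vec (s + n)) i 0 hi (Vec s) j j' 0 hj
    obtain ⟨H, hH⟩ := hu.exists_apply_ambientDeriv (fun x ↦ (hgn x).1) hfs
      hj.isSmoothEmbedding.contMDiff
      (inducedMetric_comp_pos hfs hj.isSmoothEmbedding (by rwa [hj.map_eq]))
    rw [hjt, hj.map_eq] at hH
    have hmem : ∀ u ∈ ({x, y} : Set (Vec m)), u ∈ LinearMap.range (K : Vec s →ₗ[ℝ] Vec m) := by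
      rintro u (rfl | rfl)
      exacts [hx, hy]
    exact ⟨H, fun u hu v hv ↦ hH u (hmem u hu) v (hmem v hv)⟩
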